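/- Let $k$ be any field. For a finite quiver $\Gamma$ let $k\Gamma$ be its path algebra, with basis all paths and $pq$ equal to "first $q$, then $p$" if $q$ ends where $p$ starts, and $0$ otherwise. For $m\ge 1$ let $B_m$ be the path algebra of the quiver $0\to 1\to\dots\to m-1$. For objects $X,Y$ of a $k$-linear triangulated category $\mathcal T$ put $\mathrm{Hom}^i(X,Y)=\mathrm{Hom}(X,Y[i])$ and $\mathrm{Hom}^\bullet(X,Y)=\bigoplus_i \mathrm{Hom}^i(X,Y)$; $\mathcal T$ is Ext-finite if all $\mathrm{Hom}^\bullet(X,Y)$ are finite-dimensional. An object $E$ is exceptional if $\mathrm{Hom}(E,E)=k$ and $\mathrm{Hom}^i(E,E)=0$ for $i\ne 0$. A sequence $(E_1,\dots,E_n)$ of exceptional objects is a strong exceptional collection if $\mathrm{Hom}^i(E_a,E_b)=0$ for all $i$ when $a>b$, and $\mathrm{Hom}^i(E_a,E_b)=0$ for all $a,b$ and all $i\neq 0$. Left and right mutations of a collection replace two neighbours $(E,F)$ by $(L_E(F),E)$, respectively by $(F,R_F(E))$, where $$L_E(F)=\mathrm{Cone}(\mathrm{Hom}^\bullet(E,F)\otimes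 E\to F),\qquad R_F(E)=\mathrm{Cone}(E\to \mathrm{Hom}^\bullet(E,F)^*\otimes F)[-1].$$ Two $k$-algebras $A$ and $B$ are mutation-equivalent if there are an Ext-finite $k$-linear triangulated category $\mathcal T$ with a dg enhancement and strong exceptional collections $(E_1,\dots,E_n)$ and $(E'_1,\dots,E'_n)$ in $\mathcal T$ with $A\cong\mathrm{End}(\bigoplus E_i)$ and $B\cong \mathrm{End}(\bigoplus E'_i)$ such that, up to isomorphism of the objects, the second collection is obtained from the first by finitely many left and right mutations and shifts of single objects. They are derived Morita-equivalent if there is a $k$-linear equivalence of triangulated categories $\mathrm{Perf}\,A\simeq\mathrm{Perf}\,B$, where $\mathrm{Perf}\,A$ is the full subcategory of the derived category of right $A$-modules whose objects are the complexes isomorphic in it to bounded complexes of finitely generated projective modules. Then the following hold. 1. For every quiver $\Gamma$ of Dynkin type $D_4$, with any orientation of the arrows, the algebra $B_2\otimes_k B_2$ is mutation-equivalent to $k\Gamma$ and derived Morita-equivalent to $k\Gamma$. 2. For every quiver $\Gamma$ of Dynkin type $E_6$, with any orientation of the arrows, the algebra $B_3\otimes_k B_2$ is mutation-equivalent to $k\Gamma$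 and derived Morita-equivalent to $k\Gamma$. -/

import Mathlib

open CategoryTheory CategoryTheory.Limits CategoryTheory.Pretriangulated
open scoped TensorProduct ModuleCat.Algebra ZeroObject

universe u

noncomputable section

universe w v u₁ v₁

/-! ### Path algebras -/

section PathAlgebra

/-- All paths of a quiver: a source, a target and a path from the source to the target. -/
abbrev QuiverPath (Γ : Type u₁) [Quiver.{v₁} Γ] := Σ a b : Γ, Quiver.Path a b

/-- The path algebra `kΓ`: the vector space with basis all paths of `Γ`. -/
def PathAlgebra (k : Type u) [Field k] (Γ : Type u₁) [Quiver.{v₁} Γ] :=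
  QuiverPath Γ →₀ k

namespace PathAlgebra

variable (k : Type u) [Field k] (Γ : Type u₁) [Quiver.{v₁} Γ]

instance : AddCommGroup (PathAlgebra k Γ) := inferInstanceAs (AddCommGroup (QuiverPath Γ →₀ k))

instance : Module k (PathAlgebra k Γ) := inferInstanceAs (Module k (QuiverPath Γ →₀ k))

variable {Γ} in
/-- The basis element of `kΓ` given by a path. -/
def ofPath (p : QuiverPath Γ) : PathAlgebra k Γ := Finsupp.single p 1

variable {Γ} in
open Classical in
/-- The product `p q` of two paths: first `q`, then `p` if `q` ends where `p` starts, and `0`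
otherwise. -/
def pathMul (p q : QuiverPath Γ) : PathAlgebra k Γ :=
  if h : q.2.1 = p.1 then ofPath k ⟨q.1, p.2.1, q.2.2.comp (p.2.2.cast h.symm rfl)⟩ else 0

/-- The bilinear extension of the product of paths. -/
def mulₗ : PathAlgebra k Γ →ₗ[k] PathAlgebra k Γ →ₗ[k] PathAlgebra k Γ :=
  Finsupp.linearCombination k fun p : QuiverPath Γ =>
    (Finsupp.linearCombination k fun q : QuiverPath Γ => pathMul k p q :
      (QuiverPath Γ →₀ k) →ₗ[k] PathAlgebra k Γ)

instance : Mul (PathAlgebra k Γ) := ⟨fun x y => mulₗ k Γ x y⟩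

/-- The unit `∑ v, e_v`, where `e_v` is the path of length zero at `v`. -/
instance [Fintype Γ] : One (PathAlgebra k Γ) :=
  ⟨∑ v : Γ, ofPath k ⟨v, v, Quiver.Path.nil⟩⟩

variable {k Γ}

lemma mul_def (x y : PathAlgebra k Γ) : x * y = mulₗ k Γ x y := rfl

lemma ofPath_mul_ofPath (p q : QuiverPath Γ) :
    ofPath k p * ofPath k q = pathMul k p q := by
  have h : mulₗ k Γ (ofPath k p) = (Finsupp.linearCombination k fun q : QuiverPath Γ =>
      pathMul k p q : (QuiverPath Γ →₀ k) →ₗ[k] PathAlgebra k Γ) :=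
    (Finsupp.linearCombination_single k 1 p).trans (one_smul k _)
  rw [mul_def, h]
  exact (Finsupp.linearCombination_single k 1 q).trans (one_smul k _)

lemma ofPath_mul_ofPath_of_eq {a b c : Γ} (p : Quiver.Path b c) (q : Quiver.Path a b) :
    ofPath k ⟨b, c, p⟩ * ofPath k ⟨a, b, q⟩ = ofPath k ⟨a, c, q.comp p⟩ := by
  rw [ofPath_mul_ofPath, pathMul, dif_pos rfl]
  rfl

lemma ofPath_mul_ofPath_of_ne {p q : QuiverPath Γ} (h : q.2.1 ≠ p.1) :
    ofPath k p * ofPath k q = 0 := by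
  rw [ofPath_mul_ofPath, pathMul, dif_neg h]

instance : NonUnitalNonAssocRing (PathAlgebra k Γ) where
  left_distrib x y z := map_add (mulₗ k Γ x) y z
  right_distrib x y z := LinearMap.map_add₂ (mulₗ k Γ) x y z
  zero_mul x := LinearMap.map_zero₂ (mulₗ k Γ) x
  mul_zero x := map_zero (mulₗ k Γ x)

instance : IsScalarTower k (PathAlgebra k Γ) (PathAlgebra k Γ) :=
  ⟨fun c x y => LinearMap.map_smul₂ (mulₗ k Γ) c x y⟩

instance : SMulCommClass k (PathAlgebra k Γ) (PathAlgebra k Γ) :=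
  ⟨fun c x y => (map_smul (mulₗ k Γ x) c y).symm⟩

/-- Induction over linear combinations of paths. -/
lemma induction_on {P : PathAlgebra k Γ → Prop} (x : PathAlgebra k Γ) (zero : P 0)
    (add : ∀ x y, P x → P y → P (x + y)) (smul : ∀ (c : k) p, P (c • ofPath k p)) : P x := by
  refine Finsupp.induction_linear (motive := P) x zero add fun p c => ?_
  have h : c • (Finsupp.single p 1 : QuiverPath Γ →₀ k) = Finsupp.single p c := by simp
  exact h ▸ smul c p

lemma mul_assoc_aux (x y z : PathAlgebra k Γ) : x * y * z = x * (y * z) := by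
  have key : ∀ p q r : QuiverPath Γ,
      ofPath k p * ofPath k q * ofPath k r = ofPath k p * (ofPath k q * ofPath k r) := by
    rintro ⟨p₁, p₂, p⟩ ⟨q₁, q₂, q⟩ ⟨r₁, r₂, r⟩
    by_cases h₁ : q₂ = p₁ <;> by_cases h₂ : r₂ = q₁
    · subst h₁ h₂
      simp only [ofPath_mul_ofPath_of_eq, Quiver.Path.comp_assoc]
    · subst h₁
      rw [ofPath_mul_ofPath_of_eq, ofPath_mul_ofPath_of_ne (by exact h₂),
        ofPath_mul_ofPath_of_ne (by exact h₂), mul_zero]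
    · subst h₂
      rw [ofPath_mul_ofPath_of_eq, ofPath_mul_ofPath_of_ne (by exact h₁),
        ofPath_mul_ofPath_of_ne (by exact h₁), zero_mul]
    · rw [ofPath_mul_ofPath_of_ne (p := ⟨p₁, p₂, p⟩) (by exact h₁),
        ofPath_mul_ofPath_of_ne (p := ⟨q₁, q₂, q⟩) (by exact h₂), mul_zero, zero_mul]
  induction x using induction_on with
  | zero => simp only [zero_mul]
  | add x x' hx hx' => simp only [add_mul, hx, hx']
  | smul a p =>
    induction y using induction_on with
    | zero => simp only [zero_mul, mul_zero]
    | add y y' hy hy' => simp only [add_mul, mul_add, hy, hy']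
    | smul b q =>
      induction z using induction_on with
      | zero => simp only [mul_zero]
      | add z z' hz hz' => simp only [mul_add, hz, hz']
      | smul c r => simp only [smul_mul_assoc, mul_smul_comm, key]

variable [Fintype Γ]

lemma one_def : (1 : PathAlgebra k Γ) = ∑ v : Γ, ofPath k ⟨v, v, Quiver.Path.nil⟩ := rfl

lemma one_mul_aux (x : PathAlgebra k Γ) : 1 * x = x := by
  induction x using induction_on with
  | zero => rw [mul_zero]
  | add x y hx hy => rw [mul_add, hx, hy]
  | smul c p =>
    obtain ⟨a, b, p⟩ := p
    rw [mul_smul_comm, one_def, Finset.sum_mul, Finset.sum_eq_single b,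
      ofPath_mul_ofPath_of_eq, Quiver.Path.comp_nil]
    · exact fun v _ hv => ofPath_mul_ofPath_of_ne (Ne.symm hv)
    · simp

lemma mul_one_aux (x : PathAlgebra k Γ) : x * 1 = x := by
  induction x using induction_on with
  | zero => rw [zero_mul]
  | add x y hx hy => rw [add_mul, hx, hy]
  | smul c p =>
    obtain ⟨a, b, p⟩ := p
    rw [smul_mul_assoc, one_def, Finset.mul_sum, Finset.sum_eq_single a,
      ofPath_mul_ofPath_of_eq, Quiver.Path.nil_comp]
    · exact fun v _ hv => ofPath_mul_ofPath_of_ne hv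
    · simp

instance : Ring (PathAlgebra k Γ) where
  __ := (inferInstance : NonUnitalNonAssocRing (PathAlgebra k Γ))
  mul_assoc := mul_assoc_aux
  one_mul := one_mul_aux
  mul_one := mul_one_aux

instance : Algebra k (PathAlgebra k Γ) := Algebra.ofModule smul_mul_assoc mul_smul_comm

end PathAlgebra

/-- The vertex set `0, 1, …, m - 1` of the linearly oriented quiver of type `A_m`. -/
structure LinearQuiver (m : ℕ) where
  /-- The label of a vertex. -/
  val : Fin m

instance (m : ℕ) : Fintype (LinearQuiver m) :=
  Fintype.ofEquiv (Fin m) ⟨LinearQuiver.mk, LinearQuiver.val, fun _ => rfl, fun _ => rfl⟩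

/-- The quiver `0 → 1 → ⋯ → m - 1`: exactly one arrow from `i` to `i + 1`, and no others. -/
instance (m : ℕ) : Quiver.{0} (LinearQuiver m) where
  Hom i j := PLift (i.val.val + 1 = j.val.val)

/-- The algebra `B_m`, the path algebra of `0 → 1 → ⋯ → m - 1`. -/
abbrev LinearPathAlgebra (k : Type u) [Field k] (m : ℕ) : Type u := PathAlgebra k (LinearQuiver m)

/-- A quiver is of the Dynkin type of a (simply laced) Cartan matrix `C` if, for a suitable
labelling of the vertices, the number of arrows between two distinct vertices, in either
direction, is the number `-C i j` of edges of the Dynkin diagram, and there are no loops.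
The orientation of the arrows is arbitrary. -/
def IsOfDynkinType {n : ℕ} (C : Matrix (Fin n) (Fin n) ℤ) (Γ : Type u₁) [Quiver.{v₁} Γ] : Prop :=
  ∃ e : Γ ≃ Fin n,
    (∀ a b : Γ, Finite (a ⟶ b)) ∧ (∀ a : Γ, IsEmpty (a ⟶ a)) ∧
    ∀ a b : Γ, a ≠ b → (Nat.card (a ⟶ b) + Nat.card (b ⟶ a) : ℤ) = -C (e a) (e b)

end PathAlgebra

/-! ### Perfect complexes and derived Morita equivalence -/

section Perf

variable (A : Type u) [Ring A]

/-- The category of right `A`-modules. -/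
abbrev RightMod := ModuleCat.{u} Aᵐᵒᵖ

instance RightMod.hasDerivedCategory : HasDerivedCategory.{u + 1} (RightMod A) :=
  HasDerivedCategory.standard _

/-- A bounded complex of finitely generated projective right `A`-modules. -/
structure IsStrictlyPerfect (K : CochainComplex (RightMod A) ℤ) : Prop where
  finite : ∀ n, Module.Finite Aᵐᵒᵖ (K.X n)
  projective : ∀ n, Module.Projective Aᵐᵒᵖ (K.X n)
  bounded : ∃ a b : ℤ, ∀ n, n < a ∨ b < n → IsZero (K.X n)

/-- Perfect complexes: the objects of `D(A)` isomorphic in `D(A)` to a bounded complex of finitely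
generated projective modules. -/
def isPerfect : ObjectProperty (DerivedCategory (RightMod A)) := fun X =>
  ∃ K : CochainComplex (RightMod A) ℤ, IsStrictlyPerfect A K ∧
    Nonempty (X ≅ DerivedCategory.Q.obj K)

variable {A}

lemma IsStrictlyPerfect.isKProjective {K : CochainComplex (RightMod A) ℤ}
    (hK : IsStrictlyPerfect A K) : K.IsKProjective := by
  obtain ⟨a, b, hab⟩ := hK.bounded
  have : K.IsStrictlyLE b := by
    rw [CochainComplex.isStrictlyLE_iff]
    exact fun i hi => hab i (Or.inr hi)
  have : ∀ n, Projective (K.X n) := fun n =>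
    (IsProjective.iff_projective (R := Aᵐᵒᵖ) (K.X n)).1 (hK.projective n)
  exact CochainComplex.isKProjective_of_projective K b

lemma IsStrictlyPerfect.shift {K : CochainComplex (RightMod A) ℤ}
    (hK : IsStrictlyPerfect A K) (m : ℤ) : IsStrictlyPerfect A (K⟦m⟧) where
  finite n := hK.finite (n + m)
  projective n := hK.projective (n + m)
  bounded := by
    obtain ⟨a, b, hab⟩ := hK.bounded
    exact ⟨a - m, b - m, fun n hn => hab (n + m) (by omega)⟩

lemma IsStrictlyPerfect.mappingCone {K L : CochainComplex (RightMod A) ℤ}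
    (hK : IsStrictlyPerfect A K) (hL : IsStrictlyPerfect A L) (φ : K ⟶ L) :
    IsStrictlyPerfect A (CochainComplex.mappingCone φ) := by
  have e (n : ℤ) : (CochainComplex.mappingCone φ).X n ≃ₗ[Aᵐᵒᵖ] K.X (n + 1) × L.X n :=
    (HomologicalComplex.homotopyCofiber.XIsoBiprod φ n (n + 1) rfl ≪≫
      ModuleCat.biprodIsoProd _ _).toLinearEquiv
  refine ⟨fun n => ?_, fun n => ?_, ?_⟩
  · have := hK.finite (n + 1)
    have := hL.finite n
    exact Module.Finite.equiv (e n).symm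
  · have := hK.projective (n + 1)
    have := hL.projective n
    exact Module.Projective.of_equiv (e n).symm
  · obtain ⟨a, b, hab⟩ := hK.bounded
    obtain ⟨a', b', hab'⟩ := hL.bounded
    refine ⟨min (a - 1) a', max b b', fun n hn => ?_⟩
    rw [CochainComplex.mappingCone.isZero_X_iff]
    exact ⟨hab _ (by grind), hab' _ (by grind)⟩

instance : (isPerfect A).IsClosedUnderIsomorphisms where
  of_iso e := by
    rintro ⟨K, hK, ⟨e'⟩⟩
    exact ⟨K, hK, ⟨e.symm ≪≫ e'⟩⟩

instance : (isPerfect A).IsStableUnderShift ℤ where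
  isStableUnderShiftBy m :=
    { le_shift := by
        rintro X ⟨K, hK, ⟨e⟩⟩
        exact ⟨K⟦m⟧, hK.shift m, ⟨(shiftFunctor _ m).mapIso e ≪≫
          ((DerivedCategory.Q.commShiftIso m).app K).symm⟩⟩ }

instance : (isPerfect A).ContainsZero where
  exists_zero := by
    have h0 : IsZero (0 : CochainComplex (RightMod A) ℤ) := isZero_zero _
    have hX (n : ℤ) : IsZero ((0 : CochainComplex (RightMod A) ℤ).X n) :=
      (HomologicalComplex.eval (RightMod A) (ComplexShape.up ℤ) n).map_isZero h0
    have hs (n : ℤ) : Subsingleton ((0 : CochainComplex (RightMod A) ℤ).X n) :=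
      ModuleCat.subsingleton_of_isZero (hX n)
    exact ⟨DerivedCategory.Q.obj 0, DerivedCategory.Q.map_isZero h0, 0,
      ⟨fun n => inferInstance, fun n => inferInstance, 0, 0, fun n _ => hX n⟩, ⟨Iso.refl _⟩⟩

instance : (isPerfect A).IsTriangulatedClosed₃ := .mk' fun T hT h₁ h₂ => by
  obtain ⟨K, hK, ⟨e⟩⟩ := h₁
  obtain ⟨L, hL, ⟨e'⟩⟩ := h₂
  have := hK.isKProjective
  obtain ⟨φ, hφ⟩ : ∃ φ : K ⟶ L, DerivedCategory.Q.map φ = e.inv ≫ T.mor₁ ≫ e'.hom := by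
    let c := DerivedCategory.quotientCompQhIso (RightMod A)
    obtain ⟨ψ, hψ⟩ := (CochainComplex.IsKProjective.Qh_map_bijective K
      ((HomotopyCategory.quotient _ _).obj L)).surjective
        (c.hom.app K ≫ (e.inv ≫ T.mor₁ ≫ e'.hom) ≫ c.inv.app L)
    obtain ⟨φ, rfl⟩ := (HomotopyCategory.quotient _ _).map_surjective ψ
    refine ⟨φ, ?_⟩
    have hn : DerivedCategory.Qh.map ((HomotopyCategory.quotient _ _).map φ) ≫ c.hom.app L =
      c.hom.app K ≫ DerivedCategory.Q.map φ := c.hom.naturality φ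
    rw [hψ] at hn
    simpa using hn.symm
  let i := isoTriangleOfIso₁₂ T _ hT (DerivedCategory.mappingCone_triangle_distinguished φ) e e'
    (by
      change T.mor₁ ≫ e'.hom = e.hom ≫ DerivedCategory.Q.map φ
      simp [hφ])
  exact ⟨_, hK.mappingCone hL φ, ⟨Triangle.π₃.mapIso i⟩⟩

instance : (isPerfect A).IsTriangulated where
  toIsTriangulatedClosed₂ := .of_isTriangulatedClosed₃

variable (A) in
/-- The triangulated category `Perf A` of perfect complexes of right `A`-modules. -/
abbrev Perf := (isPerfect A).FullSubcategory

end Perf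

/-- Two `k`-algebras are derived Morita-equivalent if there is a `k`-linear equivalence of
triangulated categories `Perf A ⥤ Perf B`. -/
def DerivedMoritaEquivalent (k : Type u) [Field k] (A B : Type u) [Ring A] [Algebra k A]
    [Ring B] [Algebra k B] : Prop :=
  ∃ (F : Perf A ⥤ Perf B) (_ : F.CommShift ℤ),
    F.IsTriangulated ∧ F.Additive ∧ F.Linear k ∧ F.IsEquivalence

/-! ### Differential graded categories and enhancements -/

/-- A dg category over `k`: the morphisms between two objects form a cochain complex of `k`-vector
spaces, and composition (written in diagrammatic order: `comp f g` is first `f`, then `g`) is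
bilinear, associative, unital, and satisfies the graded Leibniz rule
`d (g ∘ f) = d g ∘ f + (-1) ^ |g| g ∘ d f`. -/
structure DGCategory (k : Type u) [Field k] where
  /-- Objects. -/
  Obj : Type w
  /-- Morphisms of degree `n`. -/
  Hom : Obj → Obj → ℤ → Type v
  [addCommGroup : ∀ X Y n, AddCommGroup (Hom X Y n)]
  [module : ∀ X Y n, Module k (Hom X Y n)]
  /-- The differential. -/
  d : ∀ {X Y : Obj} (n m : ℤ), n + 1 = m → (Hom X Y n →ₗ[k] Hom X Y m)
  d_d : ∀ {X Y : Obj} (n m l : ℤ) (h : n + 1 = m) (h' : m + 1 = l) (f : Hom X Y n),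
    d m l h' (d n m h f) = 0
  /-- Identities. -/
  id : ∀ X : Obj, Hom X X 0
  /-- Composition. -/
  comp : ∀ {X Y Z : Obj} {a b c : ℤ}, a + b = c → (Hom X Y a →ₗ[k] Hom Y Z b →ₗ[k] Hom X Z c)
  id_comp : ∀ {X Y : Obj} {n : ℤ} (f : Hom X Y n), comp (zero_add n) (id X) f = f
  comp_id : ∀ {X Y : Obj} {n : ℤ} (f : Hom X Y n), comp (add_zero n) f (id Y) = f
  assoc : ∀ {X Y Z W : Obj} {a b c ab bc abc : ℤ} (hab : a + b = ab) (hbc : b + c = bc)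
    (h : ab + c = abc) (h' : a + bc = abc) (f : Hom X Y a) (g : Hom Y Z b) (e : Hom Z W c),
    comp h (comp hab f g) e = comp h' f (comp hbc g e)
  d_comp : ∀ {X Y Z : Obj} {a b c a' b' c' : ℤ} (h : a + b = c) (ha : a + 1 = a')
    (hb : b + 1 = b') (hc : c + 1 = c') (h₁ : a + b' = c') (h₂ : a' + b = c')
    (f : Hom X Y a) (g : Hom Y Z b),
    d c c' hc (comp h f g) = comp h₁ f (d b b' hb g) + b.negOnePow • comp h₂ (d a a' ha f) g

namespace DGCategory

attribute [instance] addCommGroup module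

variable {k : Type u} [Field k] (𝒜 : DGCategory.{u, w, v} k)

/-- The space of closed morphisms of degree `0`. -/
def closed (X Y : 𝒜.Obj) : Submodule k (𝒜.Hom X Y 0) := LinearMap.ker (𝒜.d 0 1 rfl)

variable {𝒜}

lemma d_comp_eq_zero {X Y Z : 𝒜.Obj} {a b c a' b' c' : ℤ} (h : a + b = c) (ha : a + 1 = a')
    (hb : b + 1 = b') (hc : c + 1 = c') {f : 𝒜.Hom X Y a} {g : 𝒜.Hom Y Z b}
    (hf : 𝒜.d a a' ha f = 0) (hg : 𝒜.d b b' hb g = 0) : 𝒜.d c c' hc (𝒜.comp h f g) = 0 := by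
  rw [𝒜.d_comp h ha hb hc (by omega) (by omega), hf, hg]
  simp

lemma d_id (X : 𝒜.Obj) : 𝒜.d 0 1 rfl (𝒜.id X) = 0 := by
  have h := 𝒜.d_comp (zero_add 0) rfl rfl rfl rfl rfl (𝒜.id X) (𝒜.id X)
  rw [𝒜.id_comp, 𝒜.id_comp, 𝒜.comp_id] at h
  simpa using h

/-- The identity as a closed morphism. -/
def closedId (X : 𝒜.Obj) : 𝒜.closed X X := ⟨𝒜.id X, d_id X⟩

/-- The composition of closed morphisms. -/
def closedComp {X Y Z : 𝒜.Obj} (f : 𝒜.closed X Y) (g : 𝒜.closed Y Z) : 𝒜.closed X Z :=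
  ⟨𝒜.comp (zero_add 0) f.1 g.1, d_comp_eq_zero _ rfl rfl rfl f.2 g.2⟩

/-- A closed invertible morphism of degree `n` from `X` to `Y`, with inverse of degree `m = -n`.
It exhibits `Y` as the shift `X[-n]` of `X`. -/
structure ShiftIso (𝒜 : DGCategory.{u, w, v} k) (n m : ℤ) (h : n + m = 0) (X Y : 𝒜.Obj) where
  /-- The morphism. -/
  hom : 𝒜.Hom X Y n
  /-- Its inverse. -/
  inv : 𝒜.Hom Y X m
  d_hom : 𝒜.d n (n + 1) rfl hom = 0
  d_inv : 𝒜.d m (m + 1) rfl inv = 0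
  hom_inv : 𝒜.comp h hom inv = 𝒜.id X
  inv_hom : 𝒜.comp ((add_comm m n).trans h) inv hom = 𝒜.id Y

/-- The morphism `X[1] ⟶ Y[1]` induced by a closed morphism `X ⟶ Y` of degree `0`. -/
def ShiftIso.map {X X' Y Y' : 𝒜.Obj} (s : 𝒜.ShiftIso (-1) 1 rfl X X')
    (t : 𝒜.ShiftIso (-1) 1 rfl Y Y') (f : 𝒜.closed X Y) : 𝒜.closed X' Y' :=
  ⟨𝒜.comp (add_neg_cancel 1) (𝒜.comp (add_zero 1) s.inv f.1) t.hom,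
    d_comp_eq_zero _ rfl rfl rfl (d_comp_eq_zero _ rfl rfl rfl s.d_inv f.2) t.d_hom⟩

/-- A cone of a closed morphism `f : X ⟶ Y` of degree `0`: an object which as a graded object is
the direct sum of `X[1]` and `Y`, with the differential twisted by `f`. -/
structure Cone {X Y : 𝒜.Obj} (f : 𝒜.closed X Y) where
  /-- The cone object. -/
  pt : 𝒜.Obj
  /-- The inclusion of `X[1]`. -/
  inl : 𝒜.Hom X pt (-1)
  /-- The inclusion of `Y`. -/
  inr : 𝒜.Hom Y pt 0
  /-- The projection to `X[1]`. -/
  fst : 𝒜.Hom pt X 1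
  /-- The projection to `Y`. -/
  snd : 𝒜.Hom pt Y 0
  inl_fst : 𝒜.comp (neg_add_cancel 1) inl fst = 𝒜.id X
  inl_snd : 𝒜.comp (add_zero (-1)) inl snd = 0
  inr_fst : 𝒜.comp (zero_add 1) inr fst = 0
  inr_snd : 𝒜.comp (zero_add 0) inr snd = 𝒜.id Y
  fst_inl_add_snd_inr :
    𝒜.comp (add_neg_cancel 1) fst inl + 𝒜.comp (zero_add 0) snd inr = 𝒜.id pt
  d_inl : 𝒜.d (-1) 0 rfl inl = 𝒜.comp (zero_add 0) f.1 inr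
  d_inr : 𝒜.d 0 1 rfl inr = 0
  d_fst : 𝒜.d 1 2 rfl fst = 0

/-- The closed morphism from `Y` to the cone of `f : X ⟶ Y`. -/
def Cone.closedInr {X Y : 𝒜.Obj} {f : 𝒜.closed X Y} (C : Cone f) : 𝒜.closed Y C.pt :=
  ⟨C.inr, C.d_inr⟩

/-- The closed morphism from the cone of `f : X ⟶ Y` to the shift `X' = X[1]`. -/
def Cone.closedFst {X X' Y : 𝒜.Obj} {f : 𝒜.closed X Y} (C : Cone f)
    (s : 𝒜.ShiftIso (-1) 1 rfl X X') : 𝒜.closed C.pt X' :=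
  ⟨𝒜.comp (add_neg_cancel 1) C.fst s.hom, d_comp_eq_zero _ rfl rfl rfl C.d_fst s.d_hom⟩

end DGCategory

section Triangulated

variable (k : Type u) [Field k] (T : Type w) [Category.{v} T] [Preadditive T] [Linear k T]
  [HasZeroObject T] [HasShift T ℤ] [∀ n : ℤ, (shiftFunctor T n).Additive] [Pretriangulated T]

/-- A dg enhancement of a `k`-linear triangulated category `T`: a pretriangulated dg category `𝒜`
(every object has all shifts, every closed morphism of degree zero has a cone), together with a
`k`-linear equivalence of triangulated categories from the homotopy category `H⁰(𝒜)` to `T`.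

The equivalence is spelled out: `map` is a functor on closed morphisms of degree `0` which is
surjective, kills exactly the exact morphisms (so that `H⁰(𝒜)(X, Y)` is identified with
`obj X ⟶ obj Y`), and is essentially surjective; it commutes with the shift by `1` up to a natural
isomorphism, and sends cone triangles to distinguished triangles. -/
structure DGEnhancement where
  /-- The dg category. -/
  𝒜 : DGCategory.{u, w, v} k
  exists_shift : ∀ (X : 𝒜.Obj) (n m : ℤ) (h : n + m = 0), ∃ Y, Nonempty (𝒜.ShiftIso n m h X Y)
  /-- The equivalence on objects. -/
  obj : 𝒜.Obj → T
  /-- The equivalence on closed morphisms of degree zero. -/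
  map : ∀ {X Y : 𝒜.Obj}, 𝒜.closed X Y →ₗ[k] (obj X ⟶ obj Y)
  map_id : ∀ X : 𝒜.Obj, map (DGCategory.closedId X) = 𝟙 (obj X)
  map_comp : ∀ {X Y Z : 𝒜.Obj} (f : 𝒜.closed X Y) (g : 𝒜.closed Y Z),
    map (DGCategory.closedComp f g) = map f ≫ map g
  map_surjective : ∀ {X Y : 𝒜.Obj}, Function.Surjective (map (X := X) (Y := Y))
  map_eq_zero_iff : ∀ {X Y : 𝒜.Obj} (f : 𝒜.closed X Y),
    map f = 0 ↔ ∃ h : 𝒜.Hom X Y (-1), 𝒜.d (-1) 0 rfl h = f.1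
  essSurj : ∀ t : T, ∃ X : 𝒜.Obj, Nonempty (obj X ≅ t)
  /-- A choice of the shift `X[1]` of every object. -/
  susp : 𝒜.Obj → 𝒜.Obj
  /-- The closed isomorphism of degree `-1` from `X` to `X[1]`. -/
  suspIso : ∀ X : 𝒜.Obj, 𝒜.ShiftIso (-1) 1 rfl X (susp X)
  /-- The equivalence commutes with the shift. -/
  objSuspIso : ∀ X : 𝒜.Obj, obj (susp X) ≅ (obj X)⟦(1 : ℤ)⟧
  objSuspIso_naturality : ∀ {X Y : 𝒜.Obj} (f : 𝒜.closed X Y),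
    map (DGCategory.ShiftIso.map (suspIso X) (suspIso Y) f) ≫ (objSuspIso Y).hom =
      (objSuspIso X).hom ≫ (map f)⟦(1 : ℤ)⟧'
  exists_cone : ∀ {X Y : 𝒜.Obj} (f : 𝒜.closed X Y), ∃ C : DGCategory.Cone f,
    Triangle.mk (map f) (map C.closedInr)
      (map (C.closedFst (suspIso X)) ≫ (objSuspIso X).hom) ∈ distTriang T

/-! ### Exceptional collections and mutations -/

/-- `T` is Ext-finite: `⨁ i, Hom(X, Y[i])` is finite-dimensional for all `X` and `Y`. -/
def IsExtFinite : Prop :=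
  ∀ X Y : T, (∀ i : ℤ, FiniteDimensional k (X ⟶ Y⟦i⟧)) ∧
    {i : ℤ | Nontrivial (X ⟶ Y⟦i⟧)}.Finite

variable {T}

/-- `E` is exceptional: `Hom(E, E) = k` and `Hom(E, E[i]) = 0` for `i ≠ 0`. -/
def IsExceptional (E : T) : Prop :=
  Function.Bijective (fun c : k => c • 𝟙 E) ∧ ∀ i : ℤ, i ≠ 0 → Subsingleton (E ⟶ E⟦i⟧)

/-- `(E_1, …, E_n)` is a strong exceptional collection. -/
structure IsStrongExceptional {n : ℕ} (E : Fin n → T) : Prop where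
  exceptional : ∀ a, IsExceptional k (E a)
  semiorthogonal : ∀ a b, b < a → ∀ i : ℤ, Subsingleton (E a ⟶ (E b)⟦i⟧)
  strong : ∀ a b, ∀ i : ℤ, i ≠ 0 → Subsingleton (E a ⟶ (E b)⟦i⟧)

/-- `L` is (isomorphic to) the left mutation `L_E(F) = Cone(Hom^•(E, F) ⊗ E ⟶ F)`.

Here `Hom^i(E, F) = Hom(E, F[i])` is written as `Hom(E[-i], F)`. After the choice of a homogeneous
basis `b` of `Hom^•(E, F)`, the object `Hom^•(E, F) ⊗ E` is the direct sum of one copy of `E[m]`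
for every basis vector `E[m] ⟶ F`, and the evaluation map is given by the basis vectors. -/
def IsLeftMutation (E F L : T) : Prop :=
  ∃ (ι : ℤ → Type) (_ : Finite (Σ m, ι m)) (b : ∀ m : ℤ, Module.Basis (ι m) k (E⟦m⟧ ⟶ F))
    (g : F ⟶ L) (h : L ⟶ (⨁ fun x : Σ m, ι m => E⟦x.1⟧)⟦(1 : ℤ)⟧),
    Triangle.mk (biproduct.desc fun x : Σ m, ι m => b x.1 x.2) g h ∈ distTriang T

/-- `R` is (isomorphic to) the right mutation `R_F(E) = Cone(E ⟶ Hom^•(E, F)^* ⊗ F)[-1]`.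

After the choice of a homogeneous basis `b` of `Hom^•(E, F)`, the object `Hom^•(E, F)^* ⊗ F` is the
direct sum of one copy of `F[m]` for every basis vector `E ⟶ F[m]`, and the coevaluation map is
given by the basis vectors. -/
def IsRightMutation (E F R : T) : Prop :=
  ∃ (ι : ℤ → Type) (_ : Finite (Σ m, ι m)) (b : ∀ m : ℤ, Module.Basis (ι m) k (E ⟶ F⟦m⟧))
    (C : T) (g : (⨁ fun x : Σ m, ι m => F⟦x.1⟧) ⟶ C) (h : C ⟶ E⟦(1 : ℤ)⟧),
    Triangle.mk (biproduct.lift fun x : Σ m, ι m => b x.1 x.2) g h ∈ distTriang T ∧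
      Nonempty (R ≅ C⟦(-1 : ℤ)⟧)

/-- One step from a collection of objects to another: replacing one object by a shift of it, or
a left mutation, or a right mutation of two neighbours. Collections are taken up to isomorphism
of their members. -/
inductive MutationStep {n : ℕ} (E E' : Fin n → T) : Prop
  /-- `E_i` is replaced by `E_i[m]`. -/
  | shift (i : Fin n) (m : ℤ) (hi : Nonempty (E' i ≅ (E i)⟦m⟧))
      (h : ∀ j, j ≠ i → Nonempty (E' j ≅ E j)) : MutationStep E E'
  /-- `(E_i, E_j)`, with `j = i + 1`, is replaced by `(L_{E_i}(E_j), E_i)`. -/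
  | left (i j : Fin n) (hij : i.val + 1 = j.val) (hi : IsLeftMutation k (E i) (E j) (E' i))
      (hj : Nonempty (E' j ≅ E i)) (h : ∀ l, l ≠ i → l ≠ j → Nonempty (E' l ≅ E l)) :
      MutationStep E E'
  /-- `(E_i, E_j)`, with `j = i + 1`, is replaced by `(E_j, R_{E_j}(E_i))`. -/
  | right (i j : Fin n) (hij : i.val + 1 = j.val) (hi : Nonempty (E' i ≅ E j))
      (hj : IsRightMutation k (E i) (E j) (E' j))
      (h : ∀ l, l ≠ i → l ≠ j → Nonempty (E' l ≅ E l)) :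
      MutationStep E E'

end Triangulated

/-- Two `k`-algebras `A` and `B` are mutation-equivalent if there are an Ext-finite `k`-linear
triangulated category `T` with a dg enhancement and strong exceptional collections
`(E_1, …, E_n)` and `(E'_1, …, E'_n)` in `T` such that `A ≅ End(⨁ E_i)`, `B ≅ End(⨁ E'_i)` and the
second collection is obtained from the first one by finitely many mutations and shifts. -/
def MutationEquivalent (k : Type u) [Field k] (A B : Type u) [Ring A] [Algebra k A]
    [Ring B] [Algebra k B] : Prop :=
  ∃ (T : Type (u + 1)) (_ : Category.{u} T) (_ : Preadditive T) (_ : Linear k T)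
    (_ : HasZeroObject T) (_ : HasShift T ℤ) (_ : ∀ n : ℤ, (shiftFunctor T n).Additive)
    (_ : ∀ n : ℤ, (shiftFunctor T n).Linear k) (_ : Pretriangulated T) (_ : IsTriangulated T),
    IsExtFinite k T ∧ Nonempty (DGEnhancement k T) ∧
    ∃ (n : ℕ) (E E' : Fin n → T), IsStrongExceptional k E ∧ IsStrongExceptional k E' ∧
      Nonempty (A ≃ₐ[k] End (⨁ E)) ∧ Nonempty (B ≃ₐ[k] End (⨁ E')) ∧
      Relation.ReflTransGen (MutationStep k) E E'

end

/-! The ambient category is the homotopy category of bounded complexes of finitely generated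
projective modules over the grid algebra `A`, that is `B₂ ⊗ B₂` or `B₃ ⊗ B₂`; complexes of cochains
provide its dg enhancement. `A` is the incidence algebra of a product of two chains, so its
projectives at the vertices form a thin collection (`IsThin`): no Ext in nonzero degrees, Hom a line
along the order and zero elsewhere, and nonzero morphisms with nonzero composites.

The engine is the flip. Let `N` be a set of elements above `v` and `Z` the cone of `X v → ⨁_{w ∈ N}
X w`. Long exact sequences present `Hom(X u, Z)` as a cokernel and `Hom(Z, X u)` as a kernel of maps
between sums of lines. `IsFlippable` is the combinatorial condition under which these are again
lines or zero; then replacing `X v` by `Z` gives a thin collection for the explicit relation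
`flipRel` (`IsThin.flip`). A flip is made of right mutations and a shift
(`IsThin.exists_mutations_flip`): while `v` slides to the right through a linear order, the object
at `v` is `Z_S[-1]`, with `Z_S` the cone for the set `S` collected so far. Passing an orthogonal
object changes nothing; passing an object to which there is exactly a line of morphisms adds a
summand to `S`, by the octahedral axiom.

The rest of the mutation statement is finite combinatorics. One flip turns the square into an
orientation of `D₄`, four flips turn the `3 × 2` grid into an orientation of `E₆`. A flip at a
source of a tree is a reflection, reversing all arrows at that vertex, and reflections reach every
orientation (`EdgeList.IsTreeLike.isReachable_of_rank`). Since a tree imposes no relations, any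
nonzero morphisms chosen along its arrows identify the endomorphism algebra of the final collection
with `C = kΓ`.

The same freedom lifts the final collection to a strict diagram `K` of complexes
(`IncidenceBasis.exists_representation`), so that `C` acts on `⨁ K` by chain maps and `Z ↦ Hom^•(⨁
K, Z)` is a triangulated functor to `D(C)`. It sends `K p` to the projective module `e_p C`
(`isIso_comparison`) and is bijective on morphisms out of `K p`. Objects with the latter property
form a triangulated subcategory (`homBijective`), and the `K p` generate: undoing the mutations
recovers the projectives of `A`. On the other side the modules `e_p C` generate `Perf C`, because
`C` is directed (`isStalkIn_of_supported`). Hence the functor is an equivalence onto `Perf C`. -/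

noncomputable section

universe w v u₁ v₁

set_option linter.unusedSectionVars false

/-! ### The homotopy category of strictly perfect complexes -/

section HomotopyPerf

variable (A : Type u) [Ring A]

/-- The objects of the homotopy category of right `A`-modules which are isomorphic to bounded
complexes of finitely generated projective modules. -/
def isHomotopyPerfect : ObjectProperty (HomotopyCategory (RightMod A) (ComplexShape.up ℤ)) :=
  fun X => ∃ K : CochainComplex (RightMod A) ℤ, IsStrictlyPerfect A K ∧
    Nonempty (X ≅ (HomotopyCategory.quotient _ _).obj K)

variable {A}

lemma isStrictlyPerfect_zero : IsStrictlyPerfect A (0 : CochainComplex (RightMod A) ℤ) := by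
  have hX (n : ℤ) : IsZero ((0 : CochainComplex (RightMod A) ℤ).X n) :=
    (HomologicalComplex.eval (RightMod A) (ComplexShape.up ℤ) n).map_isZero (isZero_zero _)
  have hs (n : ℤ) : Subsingleton ((0 : CochainComplex (RightMod A) ℤ).X n) :=
    ModuleCat.subsingleton_of_isZero (hX n)
  exact ⟨fun n => inferInstance, fun n => inferInstance, 0, 0, fun n _ => hX n⟩

instance : (isHomotopyPerfect A).IsClosedUnderIsomorphisms where
  of_iso e := by
    rintro ⟨K, hK, ⟨e'⟩⟩
    exact ⟨K, hK, ⟨e.symm ≪≫ e'⟩⟩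

instance : (isHomotopyPerfect A).IsStableUnderShift ℤ where
  isStableUnderShiftBy m :=
    { le_shift := by
        rintro X ⟨K, hK, ⟨e⟩⟩
        exact ⟨K⟦m⟧, hK.shift m, ⟨(shiftFunctor _ m).mapIso e ≪≫
          (((HomotopyCategory.quotient _ _).commShiftIso m).app K).symm⟩⟩ }

instance : (isHomotopyPerfect A).ContainsZero where
  exists_zero := ⟨(HomotopyCategory.quotient _ _).obj 0,
    (HomotopyCategory.quotient _ _).map_isZero (isZero_zero _), 0, isStrictlyPerfect_zero,
    ⟨Iso.refl _⟩⟩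

/-- The quotient functor is full, so the first morphism of the triangle lifts to a chain map; the
third object is then its mapping cone, which is strictly perfect. -/
instance : (isHomotopyPerfect A).IsTriangulatedClosed₃ := .mk' fun T hT h₁ h₂ => by
  obtain ⟨K, hK, ⟨e⟩⟩ := h₁
  obtain ⟨L, hL, ⟨e'⟩⟩ := h₂
  obtain ⟨φ, hφ⟩ := (HomotopyCategory.quotient (RightMod A) (ComplexShape.up ℤ)).map_surjective
    (e.inv ≫ T.mor₁ ≫ e'.hom)
  let i := isoTriangleOfIso₁₂ T _ hT
    (HomotopyCategory.mappingCone_triangleh_distinguished φ) e e'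
    (by
      change T.mor₁ ≫ e'.hom = e.hom ≫ (HomotopyCategory.quotient _ _).map φ
      simp [hφ])
  exact ⟨_, hK.mappingCone hL φ, ⟨Triangle.π₃.mapIso i⟩⟩

instance : (isHomotopyPerfect A).IsTriangulated where
  toIsTriangulatedClosed₂ := .of_isTriangulatedClosed₃

variable (A) in
/-- The homotopy category of bounded complexes of finitely generated projective right modules. -/
abbrev HomotopyPerf := (isHomotopyPerfect A).FullSubcategory

/-- The object of the homotopy category given by a strictly perfect complex. -/
abbrev IsStrictlyPerfect.toHomotopyPerf {K : CochainComplex (RightMod A) ℤ}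
    (hK : IsStrictlyPerfect A K) : HomotopyPerf A :=
  ⟨(HomotopyCategory.quotient _ _).obj K, K, hK, ⟨Iso.refl _⟩⟩

/-- The morphism in the homotopy category given by a morphism of strictly perfect complexes. -/
def toHomotopyPerfMap {K L : CochainComplex (RightMod A) ℤ} (hK : IsStrictlyPerfect A K)
    (hL : IsStrictlyPerfect A L) (φ : K ⟶ L) : hK.toHomotopyPerf ⟶ hL.toHomotopyPerf :=
  ObjectProperty.homMk ((HomotopyCategory.quotient _ _).map φ)

/-- The inclusion of the strictly perfect complexes commutes with the shift. -/
def suspHomotopyPerfIso {K : CochainComplex (RightMod A) ℤ} (hK : IsStrictlyPerfect A K) :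
    (hK.shift 1).toHomotopyPerf ≅ hK.toHomotopyPerf⟦(1 : ℤ)⟧ :=
  (isHomotopyPerfect A).fullyFaithfulι.preimageIso
    (((HomotopyCategory.quotient _ _).commShiftIso (1 : ℤ)).app K ≪≫
      (((isHomotopyPerfect A).ι.commShiftIso (1 : ℤ)).app hK.toHomotopyPerf).symm)

lemma toHomotopyPerfMap_shift {K L : CochainComplex (RightMod A) ℤ} (hK : IsStrictlyPerfect A K)
    (hL : IsStrictlyPerfect A L) (φ : K ⟶ L) :
    toHomotopyPerfMap (hK.shift 1) (hL.shift 1) (φ⟦(1 : ℤ)⟧') ≫ (suspHomotopyPerfIso hL).hom =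
      (suspHomotopyPerfIso hK).hom ≫ (toHomotopyPerfMap hK hL φ)⟦(1 : ℤ)⟧' := by
  apply (isHomotopyPerfect A).ι.map_injective
  have h₁ := (HomotopyCategory.quotient (RightMod A) (ComplexShape.up ℤ)).commShiftIso_hom_naturality
    φ (1 : ℤ)
  have h₂ := (isHomotopyPerfect A).ι.commShiftIso_inv_naturality (toHomotopyPerfMap hK hL φ) (1 : ℤ)
  have key : (HomotopyCategory.quotient (RightMod A) (ComplexShape.up ℤ)).map (φ⟦(1 : ℤ)⟧') ≫
      ((HomotopyCategory.quotient _ _).commShiftIso (1 : ℤ)).hom.app L ≫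
      ((isHomotopyPerfect A).ι.commShiftIso (1 : ℤ)).inv.app hL.toHomotopyPerf =
      (((HomotopyCategory.quotient _ _).commShiftIso (1 : ℤ)).hom.app K ≫
      ((isHomotopyPerfect A).ι.commShiftIso (1 : ℤ)).inv.app hK.toHomotopyPerf) ≫
      (isHomotopyPerfect A).ι.map ((toHomotopyPerfMap hK hL φ)⟦(1 : ℤ)⟧') := by
    refine ((Category.assoc _ _ _).symm.trans (congrArg (· ≫ _) h₁)).trans ?_
    rw [Category.assoc, Category.assoc]
    exact congrArg _ h₂
  exact key

lemma toHomotopyPerfMap_neg {K L : CochainComplex (RightMod A) ℤ} (hK : IsStrictlyPerfect A K)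
    (hL : IsStrictlyPerfect A L) (φ : K ⟶ L) :
    toHomotopyPerfMap hK hL (-φ) = -toHomotopyPerfMap hK hL φ := by
  ext
  exact (HomotopyCategory.quotient (RightMod A) (ComplexShape.up ℤ)).map_neg

lemma comp_comp_inv_comp_hom {C : Type*} [Category* C] {X Y Z W : C} (f : X ⟶ Y) (g : Y ⟶ Z)
    (e : W ≅ Z) : (f ≫ g ≫ e.inv) ≫ e.hom = f ≫ g := by
  simp

lemma toHomotopyPerf_distinguished {K L : CochainComplex (RightMod A) ℤ}
    (hK : IsStrictlyPerfect A K) (hL : IsStrictlyPerfect A L) (φ : K ⟶ L) :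
    Triangle.mk (toHomotopyPerfMap hK hL φ)
      (toHomotopyPerfMap hL (hK.mappingCone hL φ) (CochainComplex.mappingCone.inr φ))
      (toHomotopyPerfMap (hK.mappingCone hL φ) (hK.shift 1)
        (CochainComplex.mappingCone.triangle φ).mor₃ ≫ (suspHomotopyPerfIso hK).hom) ∈
      distTriang (HomotopyPerf A) := by
  refine isomorphic_distinguished _
    (HomotopyCategory.mappingCone_triangleh_distinguished φ) _
    (Triangle.isoMk _ _ (Iso.refl _) (Iso.refl _) (Iso.refl _) ?_ ?_ ?_)
  · exact (Category.comp_id _).trans (Category.id_comp _).symm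
  · exact (Category.comp_id _).trans (Category.id_comp _).symm
  · refine Eq.trans ?_ (Category.id_comp _).symm
    refine (congrArg (_ ≫ ·) ((shiftFunctor (HomotopyCategory (RightMod A) (ComplexShape.up ℤ))
      (1 : ℤ)).map_id _)).trans ((Category.comp_id _).trans ?_)
    exact comp_comp_inv_comp_hom _ _
      (((isHomotopyPerfect A).ι.commShiftIso (1 : ℤ)).app hK.toHomotopyPerf)

end HomotopyPerf

/-! ### The dg enhancement by complexes of cochains -/

section Enhancement

open CochainComplex HomComplex

variable (k : Type u) [Field k] (A : Type u) [Ring A] [Algebra k A]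

/-- The dg category of strictly perfect complexes of right `A`-modules. -/
def perfDGCategory : DGCategory.{u, u + 1, u} k where
  Obj := { K : CochainComplex (RightMod A) ℤ // IsStrictlyPerfect A K }
  Hom K L n := Cochain K.1 L.1 n
  addCommGroup _ _ _ := inferInstance
  module _ _ _ := inferInstance
  d {K L} n m _ := δ_hom k K.1 L.1 n m
  d_d n m l _ _ f := δ_δ n m l f
  id K := Cochain.ofHom (𝟙 K.1)
  comp h := LinearMap.mk₂ k (fun f g => f.comp g h)
    (fun f f' g => Cochain.add_comp f f' g h) (fun c f g => Cochain.smul_comp c f g h)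
    (fun f g g' => Cochain.comp_add f g g' h) (fun c f g => Cochain.comp_smul f c g h)
  id_comp f := Cochain.id_comp f
  comp_id f := Cochain.comp_id f
  assoc hab hbc h h' f g e := Cochain.comp_assoc f g e hab hbc (by lia)
  d_comp h ha hb hc h₁ h₂ f g := δ_comp f g h _ _ _ hc ha hb

variable {k A}

/-! ### Shifted identity cochains -/

section

variable {C : Type*} [Category* C] [Preadditive C] (K : CochainComplex C ℤ)

lemma δ_rightShift_id (n m : ℤ) (h : n + m = 0) :
    δ n (n + 1) ((Cochain.ofHom (𝟙 K)).rightShift m n h) = 0 := by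
  rw [Cochain.δ_rightShift _ m n (n + 1) h 1 (by lia)]
  simp

lemma δ_rightUnshift_id (m : ℤ) :
    δ m (m + 1) ((Cochain.ofHom (𝟙 (K⟦m⟧))).rightUnshift m (zero_add m)) = 0 := by
  rw [Cochain.δ_rightUnshift _ m _ (m + 1) 1 (by lia)]
  simp

/-- Right shifts only reindex the target and carry no sign, so composing with a shifted identity is
itself a shift. This reduces the computations below to shift and unshift identities. -/
lemma comp_rightShift_id {L : CochainComplex C ℤ} {n' l : ℤ} (γ : Cochain L K l) (n m : ℤ)
    (h : n + m = 0) (h' : l + n = n') :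
    γ.comp ((Cochain.ofHom (𝟙 K)).rightShift m n h) h' = γ.rightShift m n' (by lia) := by
  apply (Cochain.rightShiftAddEquiv L K l m n' (by lia)).symm.injective
  change Cochain.rightUnshift _ l (by lia) = Cochain.rightUnshift _ l (by lia)
  rw [Cochain.rightUnshift_comp _ _ _ l (by lia) 0 h, Cochain.rightUnshift_rightShift,
    Cochain.rightUnshift_rightShift, Cochain.comp_id]

variable {K} in
lemma rightUnshift_id_comp_comp_rightShift_id {L : CochainComplex C ℤ} (φ : K ⟶ L) :
    (((Cochain.ofHom (𝟙 (K⟦(1 : ℤ)⟧))).rightUnshift 1 (zero_add 1)).comp (Cochain.ofHom φ)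
      (add_zero 1)).comp ((Cochain.ofHom (𝟙 L)).rightShift 1 (-1) rfl) (add_neg_cancel 1) =
        Cochain.ofHom (φ⟦(1 : ℤ)⟧') := by
  rw [comp_rightShift_id]
  ext p
  rw [Cochain.rightShift_v _ 1 0 _ p p _ (p + 1) rfl, Cochain.comp_zero_cochain_v,
    Cochain.rightUnshift_v _ 1 _ p (p + 1) _ p (add_zero p)]
  simp only [Cochain.ofHom_v]
  simp
  exact Category.comp_id _

lemma rightShift_id_comp_rightUnshift_id (n m : ℤ) (h : n + m = 0) :
    ((Cochain.ofHom (𝟙 K)).rightShift m n h).comp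
      ((Cochain.ofHom (𝟙 (K⟦m⟧))).rightUnshift m (zero_add m)) h = Cochain.ofHom (𝟙 K) := by
  rw [← Cochain.rightUnshift_comp _ _ (add_zero n) 0 h, Cochain.comp_id,
    Cochain.rightUnshift_rightShift]

lemma rightUnshift_id_comp_rightShift_id (n m : ℤ) (h : n + m = 0) :
    ((Cochain.ofHom (𝟙 (K⟦m⟧))).rightUnshift m (zero_add m)).comp
      ((Cochain.ofHom (𝟙 K)).rightShift m n h) ((add_comm m n).trans h) =
        Cochain.ofHom (𝟙 (K⟦m⟧)) := by
  apply (Cochain.rightShiftAddEquiv (K⟦m⟧) K m m 0 (zero_add m)).symm.injective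
  change Cochain.rightUnshift _ m (zero_add m) = Cochain.rightUnshift _ m (zero_add m)
  rw [Cochain.rightUnshift_comp _ _ _ m (zero_add m) 0 h, Cochain.rightUnshift_rightShift,
    Cochain.comp_id]

end

/-- The isomorphism of degree `n` from a complex to its shift by `-n`. -/
def perfShiftIso (K : (perfDGCategory k A).Obj) (n m : ℤ) (h : n + m = 0) :
    (perfDGCategory k A).ShiftIso n m h K ⟨K.1⟦m⟧, K.2.shift m⟩ where
  hom := (Cochain.ofHom (𝟙 K.1)).rightShift m n h
  inv := (Cochain.ofHom (𝟙 (K.1⟦m⟧))).rightUnshift m (zero_add m)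
  d_hom := δ_rightShift_id K.1 n m h
  d_inv := δ_rightUnshift_id K.1 m
  hom_inv := rightShift_id_comp_rightUnshift_id K.1 n m h
  inv_hom := rightUnshift_id_comp_rightShift_id K.1 n m h

/-- The cone of a closed morphism is given by the mapping cone. -/
def perfCone {K L : (perfDGCategory k A).Obj} (f : (perfDGCategory k A).closed K L) :
    DGCategory.Cone f :=
  let φ : K.1 ⟶ L.1 := Cocycle.homOf (Cocycle.mk f.1 1 rfl f.2)
  { pt := ⟨mappingCone φ, K.2.mappingCone L.2 φ⟩
    inl := mappingCone.inl φ
    inr := Cochain.ofHom (mappingCone.inr φ)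
    fst := (mappingCone.fst φ).1
    snd := mappingCone.snd φ
    inl_fst := mappingCone.inl_fst φ
    inl_snd := mappingCone.inl_snd φ
    inr_fst := mappingCone.inr_fst φ
    inr_snd := mappingCone.inr_snd φ
    fst_inl_add_snd_inr := mappingCone.id φ
    d_inl := by
      have := mappingCone.δ_inl φ
      rw [Cochain.ofHom_comp, Cocycle.cochain_ofHom_homOf_eq_coe] at this
      exact this
    d_inr := δ_ofHom _
    d_fst := (mappingCone.fst φ).δ_eq_zero 2 }

/-- The standard mapping cone triangle uses `-fst` as connecting morphism, whereas a dg cone uses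
`fst`. This is the origin of the sign in `perfEnhancement`. -/
lemma comp_rightShift_mappingCone_fst {C : Type*} [Category* C] [Preadditive C]
    {K L : CochainComplex C ℤ} [HasBinaryBiproducts C] (φ : K ⟶ L) :
    (mappingCone.fst φ).1.comp ((Cochain.ofHom (𝟙 K)).rightShift 1 (-1) rfl)
      (add_neg_cancel 1) = Cochain.ofHom (-(mappingCone.triangle φ).mor₃) := by
  have h : Cochain.ofHom (mappingCone.triangle φ).mor₃ =
      ((-mappingCone.fst φ).rightShift 1 0 (zero_add 1)).1 :=
    Cocycle.cochain_ofHom_homOf_eq_coe _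
  rw [comp_rightShift_id, Cochain.ofHom_neg, h, Cocycle.rightShift_coe, Cocycle.coe_neg,
    Cochain.rightShift_neg]
  exact (neg_neg _).symm

/-- The morphism of strictly perfect complexes given by a closed morphism of degree `0`. -/
def closedHom {K L : (perfDGCategory k A).Obj} (f : (perfDGCategory k A).closed K L) :
    K.1 ⟶ L.1 :=
  Cocycle.homOf (Cocycle.mk f.1 1 rfl f.2)

lemma ofHom_closedHom {K L : (perfDGCategory k A).Obj} (f : (perfDGCategory k A).closed K L) :
    Cochain.ofHom (closedHom f) = f.1 :=
  Cocycle.cochain_ofHom_homOf_eq_coe _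

/-- The morphism in the homotopy category given by a closed morphism of degree `0`. -/
def perfEnhancementMap (K L : (perfDGCategory k A).Obj) :
    (perfDGCategory k A).closed K L →ₗ[k] (K.2.toHomotopyPerf ⟶ L.2.toHomotopyPerf) where
  toFun f := toHomotopyPerfMap K.2 L.2 (closedHom f)
  map_add' f g := by
    ext
    exact (HomotopyCategory.quotient (RightMod A) (ComplexShape.up ℤ)).map_add
      (f := Cocycle.homOf (Cocycle.mk f.1 1 rfl f.2))
      (g := Cocycle.homOf (Cocycle.mk g.1 1 rfl g.2))
  map_smul' c f := by
    ext
    exact (HomotopyCategory.quotient (RightMod A) (ComplexShape.up ℤ)).map_smul c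
      (Cocycle.homOf (Cocycle.mk f.1 1 rfl f.2))

lemma perfEnhancementMap_surjective (K L : (perfDGCategory k A).Obj) :
    Function.Surjective (perfEnhancementMap K L) := fun f => by
  obtain ⟨φ, hφ⟩ := (HomotopyCategory.quotient _ _).map_surjective f.hom
  refine ⟨⟨Cochain.ofHom φ, δ_ofHom φ⟩, ?_⟩
  ext
  refine Eq.trans ?_ hφ
  exact congrArg (HomotopyCategory.quotient _ _).map (Cocycle.homOf_ofHom_eq_self φ)

lemma perfEnhancementMap_eq_zero_iff {K L : (perfDGCategory k A).Obj}
    (f : (perfDGCategory k A).closed K L) :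
    perfEnhancementMap K L f = 0 ↔
      ∃ h : (perfDGCategory k A).Hom K L (-1), (perfDGCategory k A).d (-1) 0 rfl h = f.1 := by
  let φ : K.1 ⟶ L.1 := Cocycle.homOf (Cocycle.mk f.1 1 rfl f.2)
  have hφ : Cochain.ofHom φ = f.1 := Cocycle.cochain_ofHom_homOf_eq_coe _
  have h₁ : perfEnhancementMap K L f = 0 ↔
      (HomotopyCategory.quotient (RightMod A) (ComplexShape.up ℤ)).map φ = 0 :=
    ⟨fun h => congrArg (fun g => g.hom) h, fun h => by ext; exact h⟩
  rw [h₁, HomotopyCategory.quotient_map_eq_zero_iff,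
    (Cochain.equivHomotopy φ 0).nonempty_congr, nonempty_subtype, hφ]
  simp only [Cochain.ofHom_zero, add_zero]
  exact exists_congr fun z => eq_comm

variable (k A) in
/-- The dg enhancement of the homotopy category of strictly perfect complexes. -/
def perfEnhancement : DGEnhancement.{u, u + 1, u} k (HomotopyPerf A) where
  𝒜 := perfDGCategory k A
  exists_shift K n m h := ⟨_, ⟨perfShiftIso K n m h⟩⟩
  obj K := K.2.toHomotopyPerf
  map := perfEnhancementMap _ _
  map_id K := by
    ext
    refine Eq.trans (congrArg (HomotopyCategory.quotient _ _).map
      (Cocycle.homOf_ofHom_eq_self (𝟙 K.1))) ?_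
    exact (HomotopyCategory.quotient _ _).map_id _
  map_comp f g := by
    ext
    refine Eq.trans (congrArg (HomotopyCategory.quotient _ _).map ?_)
      ((HomotopyCategory.quotient _ _).map_comp _ _)
    refine Cochain.ofHom_injective ((ofHom_closedHom _).trans ?_)
    exact ((Cochain.ofHom_comp (closedHom f) (closedHom g)).trans
      (congrArg₂ (fun x y => Cochain.comp x y (zero_add 0)) (ofHom_closedHom f)
        (ofHom_closedHom g))).symm
  map_surjective := perfEnhancementMap_surjective _ _
  map_eq_zero_iff := perfEnhancementMap_eq_zero_iff
  essSurj := by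
    rintro ⟨X, K, hK, ⟨e⟩⟩
    exact ⟨⟨K, hK⟩, ⟨ObjectProperty.isoMk _ e.symm⟩⟩
  susp K := ⟨K.1⟦(1 : ℤ)⟧, K.2.shift 1⟩
  suspIso K := perfShiftIso K (-1) 1 rfl
  -- The minus sign cancels the one in the connecting morphism of the standard triangle, so that
  -- cone triangles become distinguished on the nose.
  objSuspIso K := -suspHomotopyPerfIso K.2
  objSuspIso_naturality {K L} f := by
    have h : closedHom (DGCategory.ShiftIso.map (perfShiftIso K (-1) 1 rfl)
        (perfShiftIso L (-1) 1 rfl) f) = (closedHom f)⟦(1 : ℤ)⟧' :=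
      Cochain.ofHom_injective ((ofHom_closedHom _).trans ((congrArg (fun z => Cochain.comp
        (Cochain.comp _ z (add_zero 1)) _ (add_neg_cancel 1)) (ofHom_closedHom f).symm).trans
          (rightUnshift_id_comp_comp_rightShift_id (closedHom f))))
    refine (Preadditive.comp_neg _ _).trans (Eq.trans ?_ (Preadditive.neg_comp _ _).symm)
    refine congrArg _ (Eq.trans (congrArg (· ≫ _) ?_)
      (toHomotopyPerfMap_shift K.2 L.2 (closedHom f)))
    exact congrArg (toHomotopyPerfMap _ _) h
  exists_cone {K L} f := ⟨perfCone f, by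
    have h₁ : closedHom (perfCone f).closedInr = mappingCone.inr (closedHom f) :=
      Cochain.ofHom_injective (ofHom_closedHom _)
    have h₂ : closedHom ((perfCone f).closedFst (perfShiftIso K (-1) 1 rfl)) =
        -(mappingCone.triangle (closedHom f)).mor₃ :=
      Cochain.ofHom_injective ((ofHom_closedHom _).trans (comp_rightShift_mappingCone_fst (closedHom f)))
    refine (congrArg₂ (fun b c => Triangle.mk (perfEnhancementMap K L f) b c ∈
      distTriang (HomotopyPerf A)) (congrArg (toHomotopyPerfMap _ _) h₁) ?_).mpr
      (toHomotopyPerf_distinguished K.2 L.2 (closedHom f))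
    have h₃ : perfEnhancementMap _ _ ((perfCone f).closedFst (perfShiftIso K (-1) 1 rfl)) =
        -toHomotopyPerfMap (K.2.mappingCone L.2 (closedHom f)) (K.2.shift 1)
          (mappingCone.triangle (closedHom f)).mor₃ :=
      (congrArg (toHomotopyPerfMap _ _) h₂).trans (toHomotopyPerfMap_neg _ _ _)
    refine (congrArg (fun g => g ≫ (-(suspHomotopyPerfIso K.2).hom)) h₃).trans ?_
    exact (Preadditive.neg_comp_neg _ _)⟩

end Enhancement

/-! ### Finiteness of morphism spaces -/

section ExtFinite

variable (k : Type u) [Field k] {A : Type u} [Ring A] [Algebra k A]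

lemma finiteDimensional_rightMod_hom [Module.Finite k A] (M N : RightMod A)
    [Module.Finite Aᵐᵒᵖ M] [Module.Finite Aᵐᵒᵖ N] : FiniteDimensional k (M ⟶ N) := by
  have : Module.Finite k Aᵐᵒᵖ := Module.Finite.equiv (MulOpposite.opLinearEquiv k)
  have : Module.Finite k M := Module.Finite.trans Aᵐᵒᵖ M
  have : Module.Finite k N := Module.Finite.trans Aᵐᵒᵖ N
  let f : (M ⟶ N) →ₗ[k] (M →ₗ[k] N) :=
    { toFun := fun g => g.hom.restrictScalars k
      map_add' := fun _ _ => rfl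
      map_smul' := fun c g => by
        ext x
        rfl }
  refine Module.Finite.of_injective f fun g h hgh => ?_
  ext x
  exact LinearMap.congr_fun hgh x

variable {k}

lemma finiteDimensional_complex_hom [Module.Finite k A] {K L : CochainComplex (RightMod A) ℤ}
    (hK : IsStrictlyPerfect A K) (hL : IsStrictlyPerfect A L) : FiniteDimensional k (K ⟶ L) := by
  obtain ⟨a, b, hab⟩ := hK.bounded
  have := hK.finite
  have := hL.finite
  have (n : ℤ) : FiniteDimensional k (K.X n ⟶ L.X n) := finiteDimensional_rightMod_hom k _ _
  let f : (K ⟶ L) →ₗ[k] (∀ n : Finset.Icc a b, K.X n ⟶ L.X n) :=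
    { toFun := fun φ n => φ.f n
      map_add' := fun _ _ => rfl
      map_smul' := fun _ _ => rfl }
  refine Module.Finite.of_injective f fun φ ψ h => ?_
  ext1 n
  by_cases hn : n ∈ Finset.Icc a b
  · exact congrFun h ⟨n, hn⟩
  · refine (hab n ?_).eq_of_src _ _
    rw [Finset.mem_Icc] at hn
    omega

lemma finiteDimensional_homotopyPerf_hom [Module.Finite k A] (X Y : HomotopyPerf A) :
    FiniteDimensional k (X ⟶ Y) := by
  obtain ⟨K, hK, ⟨e⟩⟩ := X.property
  obtain ⟨L, hL, ⟨e'⟩⟩ := Y.property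
  have := finiteDimensional_complex_hom (k := k) hK hL
  let Q := HomotopyCategory.quotient (RightMod A) (ComplexShape.up ℤ)
  let f : (K ⟶ L) →ₗ[k] (X ⟶ Y) :=
    { toFun := fun φ => ObjectProperty.homMk (e.hom ≫ Q.map φ ≫ e'.inv)
      map_add' := fun φ ψ => by
        ext
        exact (congrArg (fun g => e.hom ≫ g ≫ e'.inv) Q.map_add).trans (by simp; rfl)
      map_smul' := fun c φ => by
        ext
        exact (congrArg (fun g => e.hom ≫ g ≫ e'.inv) (Q.map_smul c φ)).trans (by simp; rfl) }
  refine Module.Finite.of_surjective f fun g => ?_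
  obtain ⟨φ, hφ⟩ := Q.map_surjective (e.inv ≫ g.hom ≫ e'.hom)
  refine ⟨φ, ?_⟩
  ext
  change e.hom ≫ Q.map φ ≫ e'.inv = g.hom
  simp [hφ]

lemma finite_nontrivial_homotopyPerf_hom (X Y : HomotopyPerf A) :
    {i : ℤ | Nontrivial (X ⟶ Y⟦i⟧)}.Finite := by
  obtain ⟨K, hK, ⟨e⟩⟩ := X.property
  obtain ⟨L, hL, ⟨e'⟩⟩ := Y.property
  obtain ⟨a, b, hab⟩ := hK.bounded
  obtain ⟨a', b', hab'⟩ := hL.bounded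
  -- `K` lives in degrees `[a, b]` and `L⟦i⟧` in `[a' - i, b' - i]`; these intervals meet only for
  -- `i` between `a' - b` and `b' - a`.
  refine (Set.finite_Icc (a' - b) (b' - a)).subset fun i hi => ?_
  by_contra hi'
  rw [Set.mem_Icc] at hi'
  obtain ⟨f, hf⟩ := @exists_ne _ hi 0
  apply hf
  let Q := HomotopyCategory.quotient (RightMod A) (ComplexShape.up ℤ)
  have h0 (φ : K ⟶ L⟦i⟧) : φ = 0 := by
    ext1 n
    by_cases hn : n < a ∨ b < n
    · exact (hab n hn).eq_of_src _ _
    · exact (hab' (n + i) (by omega)).eq_of_tgt _ _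
  let e'' : (Y⟦i⟧).obj ≅ Q.obj (L⟦i⟧) :=
    ((isHomotopyPerfect A).ι.commShiftIso i).app Y ≪≫ (shiftFunctor _ i).mapIso e' ≪≫
      ((Q.commShiftIso i).app L).symm
  obtain ⟨φ, hφ⟩ := Q.map_surjective (e.inv ≫ f.hom ≫ e''.hom)
  rw [h0 φ] at hφ
  ext
  change f.hom = 0
  rw [← cancel_epi e.inv, ← cancel_mono e''.hom, Category.assoc]
  refine hφ.symm.trans ?_
  simp

lemma isExtFinite_homotopyPerf [Module.Finite k A] : IsExtFinite k (HomotopyPerf A) :=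
  fun X Y => ⟨fun _ => finiteDimensional_homotopyPerf_hom _ _,
    finite_nontrivial_homotopyPerf_hom X Y⟩

end ExtFinite

/-! ### Thin collections -/

section ShiftedHom

variable {T : Type w} [Category.{v} T] [Preadditive T] [HasShift T ℤ]
  [∀ n : ℤ, (shiftFunctor T n).Additive]

lemma shiftedHom_eq_zero_of_sub {U W : T} {i j l : ℤ} (hl : l + i = j)
    (h : ∀ f : U ⟶ W⟦l⟧, f = 0) (f : U⟦i⟧ ⟶ W⟦j⟧) : f = 0 := by
  obtain ⟨g, hg⟩ := (shiftFunctor T i).map_surjective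
    (f ≫ (shiftFunctorAdd' T l i j hl).hom.app W)
  rw [h g, Functor.map_zero] at hg
  rw [← cancel_mono ((shiftFunctorAdd' T l i j hl).hom.app W), ← hg, zero_comp]

lemma hom_shift_eq_zero_of_shift_hom {U W : T} {i j : ℤ} (hij : i + j = 0)
    (h : ∀ f : U⟦j⟧ ⟶ W, f = 0) (f : U ⟶ W⟦i⟧) : f = 0 := by
  apply (shiftFunctor T j).map_injective
  rw [← cancel_mono ((shiftFunctorCompIsoId T i j hij).hom.app W), h (_ ≫ _), Functor.map_zero,
    zero_comp]

lemma shift_hom_eq_zero_of_hom_shift {U W : T} {i j : ℤ} (hij : i + j = 0)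
    (h : ∀ f : U ⟶ W⟦i⟧, f = 0) (f : U⟦j⟧ ⟶ W) : f = 0 := by
  apply (shiftFunctor T i).map_injective
  rw [← cancel_epi ((shiftFunctorCompIsoId T j i ((add_comm j i).trans hij)).inv.app U),
    h (_ ≫ _), Functor.map_zero, comp_zero]

end ShiftedHom

section Thin

variable (k : Type u) [Field k] {T : Type w} [Category.{v} T] [Preadditive T] [Linear k T]
  [HasZeroObject T] [HasShift T ℤ] [∀ n : ℤ, (shiftFunctor T n).Additive]

/-- A family of objects `X` is thin for a relation `R` if there are no morphisms of nonzero degree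
between its members, the morphisms from `X u` to `X v` form a line if `R u v` holds and vanish
otherwise, and compositions of nonzero morphisms are nonzero. -/
structure IsThin {V : Type} (R : V → V → Prop) (X : V → T) : Prop where
  ext_eq_zero : ∀ {u v : V} {i : ℤ}, i ≠ 0 → ∀ f : X u ⟶ (X v)⟦i⟧, f = 0
  hom_eq_zero : ∀ {u v : V}, ¬ R u v → ∀ f : X u ⟶ X v, f = 0
  finrank_hom : ∀ {u v : V}, R u v → Module.finrank k (X u ⟶ X v) = 1
  comp_ne_zero : ∀ {u v w : V}, R u v → R v w → ∀ {f : X u ⟶ X v} {g : X v ⟶ X w},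
    f ≠ 0 → g ≠ 0 → f ≫ g ≠ 0

variable {k}

lemma exists_smul_of_finrank_hom {U W : T} (h : Module.finrank k (U ⟶ W) = 1) {f : U ⟶ W}
    (hf : f ≠ 0) (g : U ⟶ W) : ∃ c : k, g = c • f := by
  obtain ⟨c, hc⟩ := (finrank_eq_one_iff_of_nonzero' f hf).1 h g
  exact ⟨c, hc.symm⟩

lemma exists_ne_zero_of_finrank_hom {U W : T} (h : Module.finrank k (U ⟶ W) = 1) :
    ∃ f : U ⟶ W, f ≠ 0 := by
  have : Nontrivial (U ⟶ W) := Module.nontrivial_of_finrank_pos (R := k) (by omega)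
  exact exists_ne 0

namespace IsThin

variable {V : Type} {R : V → V → Prop} {X : V → T} (hX : IsThin k R X)

include hX

lemma shifted_hom_eq_zero {u v : V} {i j : ℤ} (hij : i ≠ j) (f : (X u)⟦i⟧ ⟶ (X v)⟦j⟧) : f = 0 :=
  shiftedHom_eq_zero_of_sub (l := j - i) (by omega) (hX.ext_eq_zero (by omega)) f

lemma shift_hom_eq_zero {u v : V} {i : ℤ} (hi : i ≠ 0) (f : (X u)⟦i⟧ ⟶ X v) : f = 0 :=
  shift_hom_eq_zero_of_hom_shift (i := -i) (by omega) (hX.ext_eq_zero (by omega)) f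

lemma exists_smul {u v : V} {f : X u ⟶ X v} (hf : f ≠ 0) (g : X u ⟶ X v) :
    ∃ c : k, g = c • f := by
  by_cases h : R u v
  · exact exists_smul_of_finrank_hom (hX.finrank_hom h) hf g
  · exact absurd (hX.hom_eq_zero h f) hf

lemma rel_of_ne_zero {u v : V} {f : X u ⟶ X v} (hf : f ≠ 0) : R u v := by
  by_contra h
  exact hf (hX.hom_eq_zero h f)

lemma exists_ne_zero {u v : V} (h : R u v) : ∃ f : X u ⟶ X v, f ≠ 0 :=
  exists_ne_zero_of_finrank_hom (hX.finrank_hom h)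

lemma comp_eq_zero_iff {u v w : V} {f : X u ⟶ X v} {g : X v ⟶ X w} :
    f ≫ g = 0 ↔ f = 0 ∨ g = 0 := by
  constructor
  · intro h
    by_contra! h'
    exact hX.comp_ne_zero (hX.rel_of_ne_zero h'.1) (hX.rel_of_ne_zero h'.2) h'.1 h'.2 h
  · rintro (rfl | rfl) <;> simp

end IsThin

variable [Pretriangulated T] {V : Type}

/-- The direct sum of the members of a family of objects over a finite set of indices. -/
abbrev sumObj (X : V → T) (S : Finset V) : T := ⨁ fun w : S => X w

/-- The morphism to a direct sum with prescribed components. -/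
abbrev sumLift {X : V → T} {U : T} (a : ∀ w, U ⟶ X w) (S : Finset V) : U ⟶ sumObj X S :=
  biproduct.lift fun w : S => a w

namespace IsThin

section Cone

variable {R : V → V → Prop} {X : V → T} (hX : IsThin k R X)

include hX

lemma shift_hom_sum_eq_zero {u : V} {i : ℤ} (hi : i ≠ 0) (S : Finset V)
    (f : (X u)⟦i⟧ ⟶ sumObj X S) : f = 0 :=
  biproduct.hom_ext _ _ fun w => by
    rw [hX.shift_hom_eq_zero hi (f ≫ biproduct.π _ w), zero_comp]

lemma sum_hom_shift_eq_zero {u : V} {i : ℤ} (hi : i ≠ 0) (S : Finset V)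
    (f : sumObj X S ⟶ (X u)⟦i⟧) : f = 0 :=
  biproduct.hom_ext' _ _ fun w => by
    rw [hX.ext_eq_zero hi (biproduct.ι (fun w : S => X w) w ≫ f), comp_zero]

variable {v : V} {S : Finset V} {a : ∀ w, X v ⟶ X w} {Z : T} {p : sumObj X S ⟶ Z}
  {d : Z ⟶ (X v)⟦(1 : ℤ)⟧} (ha : ∀ w ∈ S, a w ≠ 0)
  (hT : Triangle.mk (sumLift a S) p d ∈ distTriang T)

include ha hT

/-- In the long exact sequence, a morphism `X u[i] ⟶ Z` is controlled by its composite with `d`,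
which can survive only for `i = 1`. There it is the shift of some `g` with `g ≫ a w = 0`, and
composing with the nonzero `a w` is injective by thinness. -/
lemma shift_hom_cone_eq_zero (hS : S.Nonempty) {u : V} {i : ℤ} (hi : i ≠ 0)
    (f : (X u)⟦i⟧ ⟶ Z) : f = 0 := by
  have hfd : f ≫ d = 0 := by
    by_cases h1 : i = 1
    · subst h1
      obtain ⟨g, hg⟩ := (shiftFunctor T (1 : ℤ)).map_surjective (f ≫ d)
      have h31 : d ≫ (sumLift a S)⟦(1 : ℤ)⟧' = 0 := comp_distTriang_mor_zero₃₁ _ hT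
      have h0 : g ≫ sumLift a S = 0 := by
        apply (shiftFunctor T (1 : ℤ)).map_injective
        rw [Functor.map_comp, hg, Category.assoc, h31, comp_zero, Functor.map_zero]
      obtain ⟨w, hw⟩ := hS
      have h1 : g ≫ a w = 0 := by
        have := congrArg (· ≫ biproduct.π _ (⟨w, hw⟩ : S)) h0
        simpa using this
      rcases hX.comp_eq_zero_iff.1 h1 with h | h
      · rw [← hg, h, Functor.map_zero]
      · exact absurd h (ha w hw)
    · exact hX.shifted_hom_eq_zero h1 _
  obtain ⟨g, hg⟩ : ∃ g : (X u)⟦i⟧ ⟶ sumObj X S, f = g ≫ p := Triangle.coyoneda_exact₃ _ hT f hfd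
  rw [hg, hX.shift_hom_sum_eq_zero hi S g, zero_comp]

lemma hom_cone_shift_eq_zero (hS : S.Nonempty) {u : V} {i : ℤ} (hi : i ≠ 0)
    (f : X u ⟶ Z⟦i⟧) : f = 0 :=
  hom_shift_eq_zero_of_shift_hom (add_neg_cancel i)
    (hX.shift_hom_cone_eq_zero ha hT hS (by omega)) f

omit ha in
lemma exists_lift_hom_cone {u : V} (f : X u ⟶ Z) : ∃ g : X u ⟶ sumObj X S, f = g ≫ p :=
  Triangle.coyoneda_exact₃ _ hT f (hX.ext_eq_zero one_ne_zero _)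

/-- If the composite vanished, `f` placed in the summand `w` would come from some `g : X u ⟶ X v`.
Its component at a second index `w'` is zero, which forces `g = 0` and then `f = 0`. A second index
is needed only when `g` has a chance to be nonzero. -/
lemma hom_ι_cone_ne_zero {u : V} {w : V} (hw : w ∈ S) {f : X u ⟶ X w} (hf : f ≠ 0)
    (h : R u v → ∃ w' ∈ S, w' ≠ w) : f ≫ biproduct.ι (fun w : S => X w) ⟨w, hw⟩ ≫ p ≠ 0 := by
  intro h0
  obtain ⟨g, hg⟩ : ∃ g : X u ⟶ X v,
      f ≫ biproduct.ι (fun w : S => X w) ⟨w, hw⟩ = g ≫ sumLift a S :=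
    Triangle.coyoneda_exact₂ _ hT _ ((Category.assoc _ _ _).trans h0)
  have hg0 : g = 0 := by
    by_cases huv : R u v
    · obtain ⟨w', hw', hne⟩ := h huv
      have h1 := congrArg (· ≫ biproduct.π _ (⟨w', hw'⟩ : S)) hg
      have hne' : (⟨w, hw⟩ : S) ≠ ⟨w', hw'⟩ := fun h => hne (congrArg Subtype.val h).symm
      simp only [Category.assoc, biproduct.lift_π, biproduct.ι_π_ne _ hne', comp_zero] at h1
      rcases hX.comp_eq_zero_iff.1 h1.symm with h | h
      · exact h
      · exact absurd h (ha w' hw')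
    · exact hX.hom_eq_zero huv g
  have h1 := congrArg (· ≫ biproduct.π _ (⟨w, hw⟩ : S)) hg
  simp only [Category.assoc, biproduct.ι_π_self, hg0, zero_comp] at h1
  exact hf (by simpa using h1)

/-- Only degree one matters, where the group is the cokernel of `Hom(⨁ X w, X u) → Hom(X v, X u)`.
The target is at most a line, and a nonzero composite `X v ⟶ X w ⟶ X u` spans it. -/
lemma cone_hom_shift_eq_zero {u : V} (hvu : R v u → ∃ w ∈ S, R w u) {i : ℤ} (hi : i ≠ 0)
    (f : Z ⟶ (X u)⟦i⟧) : f = 0 := by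
  obtain ⟨g, hg⟩ : ∃ g : (X v)⟦(1 : ℤ)⟧ ⟶ (X u)⟦i⟧, f = d ≫ g :=
    Triangle.yoneda_exact₃ _ hT f (hX.sum_hom_shift_eq_zero hi S _)
  by_cases h1 : i = 1
  · subst h1
    obtain ⟨g', rfl⟩ := (shiftFunctor T (1 : ℤ)).map_surjective g
    by_cases h : R v u
    · obtain ⟨w, hw, hwu⟩ := hvu h
      obtain ⟨b, hb⟩ := hX.exists_ne_zero hwu
      have hab : a w ≫ b ≠ 0 := fun h0 => by
        rcases hX.comp_eq_zero_iff.1 h0 with h | h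
        · exact ha w hw h
        · exact hb h
      obtain ⟨c, hc⟩ := hX.exists_smul hab g'
      have : g' = sumLift a S ≫ (c • (biproduct.π _ (⟨w, hw⟩ : S) ≫ b)) := by
        rw [hc, Linear.comp_smul, biproduct.lift_π_assoc]
      have h31 : d ≫ (sumLift a S)⟦(1 : ℤ)⟧' = 0 := comp_distTriang_mor_zero₃₁ _ hT
      rw [hg, this, Functor.map_comp, reassoc_of% h31, zero_comp]
    · rw [hg, hX.hom_eq_zero h g', Functor.map_zero, comp_zero]
  · rw [hg, hX.shifted_hom_eq_zero (Ne.symm h1) g, comp_zero]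

omit ha in
lemma cone_hom_eq_zero_of_comp {u : V} {f : Z ⟶ X u} (h : p ≫ f = 0) : f = 0 := by
  obtain ⟨g, hg⟩ : ∃ g : (X v)⟦(1 : ℤ)⟧ ⟶ X u, f = d ≫ g := Triangle.yoneda_exact₃ _ hT f h
  rw [hg, hX.shift_hom_eq_zero one_ne_zero g, comp_zero]

/-- The components `f_w` of `p ≫ f` satisfy `∑ a_w ≫ f_w = 0`. With at most two of them possibly
nonzero, vanishing of one forces vanishing of the other, hence of `f`. -/
lemma cone_hom_component_ne_zero {u : V} {f : Z ⟶ X u} (hf : f ≠ 0) {w₁ w₂ : V} (h₁ : w₁ ∈ S)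
    (h₂ : w₂ ∈ S) (hS : ∀ w ∈ S, R w u → w = w₁ ∨ w = w₂) :
    biproduct.ι (fun w : S => X w) ⟨w₁, h₁⟩ ≫ p ≫ f ≠ 0 := by
  intro h0
  apply hf
  apply hX.cone_hom_eq_zero_of_comp hT
  have hz : ∀ w (hw : w ∈ S), w ≠ w₂ → biproduct.ι (fun w : S => X w) ⟨w, hw⟩ ≫ p ≫ f = 0 := by
    intro w hw hne
    by_cases hwu : R w u
    · rcases hS w hw hwu with rfl | rfl
      · exact h0
      · exact absurd rfl hne
    · exact hX.hom_eq_zero hwu _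
  have h12 : sumLift a S ≫ p = 0 := comp_distTriang_mor_zero₁₂ _ hT
  have key : a w₂ ≫ biproduct.ι (fun w : S => X w) ⟨w₂, h₂⟩ ≫ p ≫ f = 0 := by
    have h := congrArg (· ≫ f) h12
    simp only [Category.assoc, zero_comp, biproduct.lift_eq, Preadditive.sum_comp] at h
    rw [Finset.sum_eq_single (⟨w₂, h₂⟩ : S)] at h
    · exact h
    · rintro ⟨w, hw⟩ - hne
      rw [hz w hw (fun h => hne (Subtype.ext h)), comp_zero]
    · simp
  refine biproduct.hom_ext' _ _ fun w => ?_
  rw [comp_zero]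
  by_cases hw : w.1 = w₂
  · obtain ⟨w, hw'⟩ := w
    obtain rfl : w = w₂ := hw
    exact (hX.comp_eq_zero_iff.1 key).resolve_left (ha w hw')
  · exact hz w.1 w.2 hw

/-- With a single possibly nonzero component, the relation `∑ a_w ≫ f_w = 0` reads `a_w ≫ f_w = 0`,
which thinness excludes unless `f_w = 0`. -/
lemma cone_hom_eq_zero {u : V}
    (hS : ∀ w₁ ∈ S, ∀ w₂ ∈ S, R w₁ u → R w₂ u → w₁ = w₂) (f : Z ⟶ X u) : f = 0 := by
  by_contra hf
  have : p ≫ f ≠ 0 := fun h => hf (hX.cone_hom_eq_zero_of_comp hT h)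
  obtain ⟨w, hw⟩ : ∃ w : S, biproduct.ι (fun w : S => X w) w ≫ p ≫ f ≠ 0 := by
    by_contra! h
    exact this (biproduct.hom_ext' _ _ fun w => (h w).trans comp_zero.symm)
  have hwu := hX.rel_of_ne_zero hw
  have h12 : sumLift a S ≫ p = 0 := comp_distTriang_mor_zero₁₂ _ hT
  have key : a w ≫ biproduct.ι (fun w : S => X w) w ≫ p ≫ f = 0 := by
    have h := congrArg (· ≫ f) h12
    simp only [Category.assoc, zero_comp, biproduct.lift_eq, Preadditive.sum_comp] at h
    rw [Finset.sum_eq_single w] at h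
    · exact h
    · rintro w' - hne
      rw [hX.hom_eq_zero (fun h' => hne (Subtype.ext (hS _ w'.2 _ w.2 h' hwu)))
        (biproduct.ι (fun w : S => X w) w' ≫ p ≫ f), comp_zero]
    · simp
  exact (hX.comp_eq_zero_iff.1 key).elim (ha w w.2) hw

end Cone

end IsThin

end Thin

/-! ### Flips of thin collections -/

/-- Conditions on a set `N` of elements above `v` under which the object `X v` of a thin collection
can be replaced by the cone of the morphism from `X v` to the direct sum of the `X w`, `w ∈ N`. -/
structure IsFlippable {V : Type} (R : V → V → Prop) (v : V) (N : Finset V) : Prop where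
  nonempty : N.Nonempty
  rel : ∀ w ∈ N, R v w
  antichain : ∀ w₁ ∈ N, ∀ w₂ ∈ N, R w₁ w₂ → w₁ = w₂
  -- `Hom(X u, Z)` is the cokernel of `Hom(X u, X v) → ⨁ Hom(X u, X w)`. If the source is a line,
  -- two summands leave exactly a line.
  exists_eq_pair : ∀ u, u ≠ v → R u v → ∃ w₁ w₂, w₁ ≠ w₂ ∧ w₁ ∈ N ∧ w₂ ∈ N ∧
    ∀ w ∈ N, w = w₁ ∨ w = w₂
  -- If the source of that map is zero, at most one summand may survive.
  subsingleton_above : ∀ u, u ≠ v → ¬ R u v → ∀ w₁ ∈ N, ∀ w₂ ∈ N, R u w₁ → R u w₂ → w₁ = w₂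
  -- This makes `⨁ Hom(X w, X u) → Hom(X v, X u)` surjective, so that `Z` has no first Ext to `X u`.
  exists_below : ∀ u, u ≠ v → R v u → ∃ w ∈ N, R w u
  -- `Hom(Z, X u)` is the kernel of the previous map; at most two summands keep it at most a line.
  eq_or_eq_below : ∀ u, u ≠ v → ∀ w₁ ∈ N, ∀ w₂ ∈ N, ∀ w ∈ N, w₁ ≠ w₂ → R w₁ u → R w₂ u → R w u →
    w = w₁ ∨ w = w₂
  -- A composite `X a ⟶ Z ⟶ X b` is tested on the summand `X w` through which its first factor
  -- passes, so that summand must map to `X b`.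
  rel_of_above_of_below : ∀ a, a ≠ v → ¬ R a v → ∀ b, b ≠ v → ∀ w ∈ N, R a w → ∀ w₁ ∈ N, ∀ w₂ ∈ N,
    w₁ ≠ w₂ → R w₁ b → R w₂ b → R w b

/-- The relation for which a flipped thin collection is thin. -/
def flipRel {V : Type} (R : V → V → Prop) (v : V) (N : Finset V) (a b : V) : Prop :=
  (a = v ∧ b = v) ∨ (a = v ∧ b ≠ v ∧ ∃ w₁ ∈ N, ∃ w₂ ∈ N, w₁ ≠ w₂ ∧ R w₁ b ∧ R w₂ b) ∨
    (a ≠ v ∧ b = v ∧ ∃ w ∈ N, R a w) ∨ (a ≠ v ∧ b ≠ v ∧ R a b)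

section Flip

variable (k : Type u) [Field k] {T : Type w} [Category.{v} T] [Preadditive T] [Linear k T]
  [HasZeroObject T] [HasShift T ℤ] [∀ n : ℤ, (shiftFunctor T n).Additive] [Pretriangulated T]

/-- The morphisms from `U` to `W` in degree zero form a line if `r` holds and vanish otherwise, and
there are no morphisms in other degrees. -/
structure HasThinHom (r : Prop) (U W : T) : Prop where
  ext_eq_zero : ∀ {i : ℤ}, i ≠ 0 → ∀ f : U ⟶ W⟦i⟧, f = 0
  hom_eq_zero : ¬ r → ∀ f : U ⟶ W, f = 0
  finrank_hom : r → Module.finrank k (U ⟶ W) = 1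

omit [HasZeroObject T] [HasShift T ℤ] [∀ n : ℤ, (shiftFunctor T n).Additive] [Pretriangulated T] in
lemma finrank_hom_eq_one {U W : T} {f : U ⟶ W} (hf : f ≠ 0) (h : ∀ g : U ⟶ W, ∃ c : k, g = c • f) :
    Module.finrank k (U ⟶ W) = 1 :=
  (finrank_eq_one_iff_of_nonzero' f hf).2 fun g => (h g).imp fun _ hc => hc.symm

variable {k}

/-- Compositions of nonzero morphisms between three objects are nonzero. -/
abbrev HasNonzeroComp (U V W : T) : Prop :=
  ∀ ⦃f : U ⟶ V⦄ ⦃g : V ⟶ W⦄, f ≠ 0 → g ≠ 0 → f ≫ g ≠ 0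

namespace IsThin

variable {V : Type} {R : V → V → Prop} {X : V → T} (hX : IsThin k R X)

variable {v : V} {S : Finset V} {a : ∀ w, X v ⟶ X w} {Z : T} {p : sumObj X S ⟶ Z}
  {d : Z ⟶ (X v)⟦(1 : ℤ)⟧} (hF : IsFlippable R v S) (ha : ∀ w ∈ S, a w ≠ 0)
  (hT : Triangle.mk (sumLift a S) p d ∈ distTriang T)

include hX hF ha hT

lemma hom_ι_cone_ne_zero_of_ne {u : V} (hu : u ≠ v) {w : V} (hw : w ∈ S) {f : X u ⟶ X w}
    (hf : f ≠ 0) : f ≫ biproduct.ι (fun w : S => X w) ⟨w, hw⟩ ≫ p ≠ 0 := by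
  refine hX.hom_ι_cone_ne_zero ha hT hw hf fun h => ?_
  obtain ⟨w₁, w₂, hne, h₁, h₂, -⟩ := hF.exists_eq_pair u hu h
  by_cases hw1 : w₁ = w
  · exact ⟨w₂, h₂, fun h => hne (hw1.trans h.symm)⟩
  · exact ⟨w₁, h₁, hw1⟩

/-- Every component of a lift of `g` can be moved into the summand `w`. If `R u v` holds, there are
only two summands, and `φ ≫ sumLift a S ≫ p = 0` for a nonzero `φ : X u ⟶ X v` exchanges them;
otherwise only the summand `w` contributes. -/
lemma exists_smul_hom_cone {u : V} (hu : u ≠ v) {w : V} (hw : w ∈ S) {f : X u ⟶ X w}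
    (hf : f ≠ 0) (g : X u ⟶ Z) :
    ∃ c : k, g = c • (f ≫ biproduct.ι (fun w : S => X w) ⟨w, hw⟩ ≫ p) := by
  obtain ⟨g, rfl⟩ := hX.exists_lift_hom_cone hT g
  have hg : g = ∑ w' : S, (g ≫ biproduct.π _ w') ≫ biproduct.ι (fun w : S => X w) w' := by
    simp only [Category.assoc, ← Preadditive.comp_sum, biproduct.total, Category.comp_id]
  have hw0 (w' : S) (hne : w'.1 ≠ w) : ∃ c : k,
      (g ≫ biproduct.π _ w') ≫ biproduct.ι (fun w : S => X w) w' ≫ p =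
        c • (f ≫ biproduct.ι (fun w : S => X w) ⟨w, hw⟩ ≫ p) := by
    by_cases huv : R u v
    · obtain ⟨w₁, w₂, hne', h₁, h₂, hS⟩ := hF.exists_eq_pair u hu huv
      obtain ⟨φ, hφ⟩ := hX.exists_ne_zero huv
      have hφw : ∀ w ∈ S, φ ≫ a w ≠ 0 := fun w hw h =>
        (hX.comp_eq_zero_iff.1 h).elim hφ (ha w hw)
      obtain ⟨c, hc⟩ := hX.exists_smul (hφw _ w'.2) (g ≫ biproduct.π _ w')
      obtain ⟨c', hc'⟩ := hX.exists_smul hf (φ ≫ a w)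
      have h12 : sumLift a S ≫ p = 0 := comp_distTriang_mor_zero₁₂ _ hT
      have h : φ ≫ a w' ≫ biproduct.ι (fun w : S => X w) w' ≫ p +
          φ ≫ a w ≫ biproduct.ι (fun w : S => X w) ⟨w, hw⟩ ≫ p = 0 := by
        have h := congrArg (φ ≫ ·) h12
        simp only [comp_zero, biproduct.lift_eq, Preadditive.sum_comp, Preadditive.comp_sum,
          Category.assoc] at h
        rw [← h]
        symm
        refine Fintype.sum_eq_add w' (⟨w, hw⟩ : S) (fun h => hne (congrArg Subtype.val h)) ?_
        rintro ⟨x, hx⟩ ⟨hx₁, hx₂⟩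
        have hx₁' : x ≠ w' := fun h => hx₁ (Subtype.ext h)
        have hx₂' : x ≠ w := fun h => hx₂ (Subtype.ext h)
        have e₁ := hS x hx
        have e₂ := hS w' w'.2
        have e₃ := hS w hw
        grind
      -- `c` expresses the component at `w'` through `φ ≫ a w'`, the relation `h` replaces this by
      -- `-(φ ≫ a w)`, and `c'` expresses `φ ≫ a w` through `f`.
      refine ⟨-(c * c'), ?_⟩
      rw [hc, Linear.smul_comp, Category.assoc, eq_neg_of_add_eq_zero_left h, neg_smul, smul_neg,
        mul_smul]
      congr 2
      rw [← Category.assoc φ, hc', Linear.smul_comp]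
    · refine ⟨0, ?_⟩
      rw [hX.hom_eq_zero (fun h => hne (hF.subsingleton_above u hu huv _ w'.2 _ hw h
        (hX.rel_of_ne_zero hf))) (g ≫ biproduct.π _ w'), zero_comp, zero_smul]
  have hw1 (w' : S) : ∃ c : k,
      (g ≫ biproduct.π _ w') ≫ biproduct.ι (fun w : S => X w) w' ≫ p =
        c • (f ≫ biproduct.ι (fun w : S => X w) ⟨w, hw⟩ ≫ p) := by
    by_cases h : w'.1 = w
    · obtain ⟨w', hw'⟩ := w'
      obtain rfl : w' = w := h
      obtain ⟨c, hc⟩ := hX.exists_smul hf (g ≫ biproduct.π (fun w : S => X w) ⟨w', hw'⟩)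
      exact ⟨c, by rw [hc, Linear.smul_comp]⟩
    · exact hw0 w' h
  choose c hc using hw1
  refine ⟨∑ w', c w', ?_⟩
  rw [Finset.sum_smul, ← Finset.sum_congr rfl fun w' _ => hc w']
  conv_lhs => rw [hg]
  rw [Preadditive.sum_comp]
  simp only [Category.assoc]

lemma hasThinHom_to_cone {u : V} (hu : u ≠ v) :
    HasThinHom k (∃ w ∈ S, R u w) (X u) Z where
  ext_eq_zero hi f := hX.hom_cone_shift_eq_zero ha hT hF.nonempty hi f
  hom_eq_zero h f := by
    obtain ⟨g, rfl⟩ := hX.exists_lift_hom_cone hT f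
    have : g = 0 := biproduct.hom_ext _ _ fun w => by
      rw [hX.hom_eq_zero (fun h' => h ⟨w, w.2, h'⟩) (g ≫ biproduct.π _ w), zero_comp]
    rw [this, zero_comp]
  finrank_hom := by
    rintro ⟨w, hw, h⟩
    obtain ⟨f, hf⟩ := hX.exists_ne_zero h
    exact finrank_hom_eq_one k (hX.hom_ι_cone_ne_zero_of_ne hF ha hT hu hw hf)
      (hX.exists_smul_hom_cone hF ha hT hu hw hf)

lemma exists_rel_of_cone_hom_ne_zero {u : V} {f : Z ⟶ X u} (hf : f ≠ 0) :
    ∃ w₁ ∈ S, ∃ w₂ ∈ S, w₁ ≠ w₂ ∧ R w₁ u ∧ R w₂ u := by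
  by_contra! h
  refine hf (hX.cone_hom_eq_zero ha hT (fun w₁ h₁ w₂ h₂ r₁ r₂ => ?_) f)
  by_contra hne
  exact h w₁ h₁ w₂ h₂ hne r₁ r₂

lemma hasThinHom_from_cone {u : V} (hu : u ≠ v) :
    HasThinHom k (∃ w₁ ∈ S, ∃ w₂ ∈ S, w₁ ≠ w₂ ∧ R w₁ u ∧ R w₂ u) Z (X u) where
  ext_eq_zero hi f := hX.cone_hom_shift_eq_zero ha hT (hF.exists_below u hu) hi f
  hom_eq_zero h f := by
    by_contra hf
    exact h (hX.exists_rel_of_cone_hom_ne_zero hF ha hT hf)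
  finrank_hom := by
    rintro ⟨w₁, h₁, w₂, h₂, hne, r₁, r₂⟩
    obtain ⟨b₁, hb₁⟩ := hX.exists_ne_zero r₁
    obtain ⟨b₂, hb₂⟩ := hX.exists_ne_zero r₂
    have h2 : a w₂ ≫ b₂ ≠ 0 := fun h => (hX.comp_eq_zero_iff.1 h).elim (ha w₂ h₂) hb₂
    obtain ⟨c, hc⟩ := hX.exists_smul h2 (a w₁ ≫ b₁)
    -- The kernel vector `(b₁, -c b₂)` of `⨁ Hom(X w, X u) → Hom(X v, X u)`; it descends to the
    -- cone.
    let h₀ : sumObj X S ⟶ X u :=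
      biproduct.π (fun w : S => X w) ⟨w₁, h₁⟩ ≫ b₁ -
        c • (biproduct.π (fun w : S => X w) ⟨w₂, h₂⟩ ≫ b₂)
    have hh₀ : sumLift a S ≫ h₀ = 0 := by
      simp only [h₀, Preadditive.comp_sub, Linear.comp_smul, biproduct.lift_π_assoc, hc, sub_self]
    obtain ⟨f, hf⟩ : ∃ f : Z ⟶ X u, h₀ = p ≫ f := Triangle.yoneda_exact₂ _ hT h₀ hh₀
    have hne' : (⟨w₁, h₁⟩ : S) ≠ ⟨w₂, h₂⟩ := fun h => hne (congrArg Subtype.val h)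
    have hf₁ : biproduct.ι (fun w : S => X w) ⟨w₁, h₁⟩ ≫ p ≫ f = b₁ := by
      simp only [← hf, h₀, Preadditive.comp_sub, Linear.comp_smul, biproduct.ι_π_self_assoc,
        biproduct.ι_π_ne_assoc _ hne', zero_comp, smul_zero, sub_zero]
    have hf0 : f ≠ 0 := by
      rintro rfl
      rw [comp_zero, comp_zero] at hf₁
      exact hb₁ hf₁.symm
    refine finrank_hom_eq_one k hf0 fun g => ?_
    obtain ⟨c', hc'⟩ := hX.exists_smul hb₁ (biproduct.ι (fun w : S => X w) ⟨w₁, h₁⟩ ≫ p ≫ g)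
    refine ⟨c', ?_⟩
    -- The difference `g - c' • f` has zero component at `w₁`, which is impossible for a nonzero
    -- morphism out of the cone.
    by_contra hg
    refine hX.cone_hom_component_ne_zero ha hT (sub_ne_zero.2 hg) h₁ h₂
      (fun w hw r => hF.eq_or_eq_below u hu w₁ h₁ w₂ h₂ w hw hne r₁ r₂ r) ?_
    rw [Preadditive.comp_sub, Preadditive.comp_sub, hc', Linear.comp_smul, Linear.comp_smul, hf₁,
      sub_self]

lemma cone_hom_component_ne_zero_of_rel {u : V} (hu : u ≠ v) {f : Z ⟶ X u} (hf : f ≠ 0) {w : V}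
    (hw : w ∈ S) (r : R w u) : biproduct.ι (fun w : S => X w) ⟨w, hw⟩ ≫ p ≫ f ≠ 0 := by
  obtain ⟨w₁, h₁, w₂, h₂, hne, r₁, r₂⟩ := hX.exists_rel_of_cone_hom_ne_zero hF ha hT hf
  have hS := fun w hw r => hF.eq_or_eq_below u hu w₁ h₁ w₂ h₂ w hw hne r₁ r₂ r
  rcases hS w hw r with rfl | rfl
  · exact hX.cone_hom_component_ne_zero ha hT hf hw h₂ hS
  · exact hX.cone_hom_component_ne_zero ha hT hf hw h₁ fun w' hw' r' => (hS w' hw' r').symm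

lemma hasNonzeroComp_hom_cone {x y : V} (hx : x ≠ v) (hy : y ≠ v) :
    HasNonzeroComp (X x) (X y) Z := by
  intro f g hf hg
  obtain ⟨w, hw, r⟩ : ∃ w ∈ S, R y w := by
    by_contra h
    exact hg ((hX.hasThinHom_to_cone hF ha hT hy).hom_eq_zero h g)
  obtain ⟨b, hb⟩ := hX.exists_ne_zero r
  obtain ⟨c, rfl⟩ := hX.exists_smul_hom_cone hF ha hT hy hw hb g
  have hc : c ≠ 0 := fun h => hg (by rw [h, zero_smul])
  rw [Linear.comp_smul, ← Category.assoc]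
  exact smul_ne_zero hc (hX.hom_ι_cone_ne_zero_of_ne hF ha hT hx hw fun h =>
    (hX.comp_eq_zero_iff.1 h).elim hf hb)

lemma hasNonzeroComp_cone_hom {x y : V} (hx : x ≠ v) : HasNonzeroComp Z (X x) (X y) := by
  intro f g hf hg h
  obtain ⟨w₁, h₁, w₂, h₂, hne, r₁, r₂⟩ := hX.exists_rel_of_cone_hom_ne_zero hF ha hT hf
  refine (hX.comp_eq_zero_iff (f := biproduct.ι (fun w : S => X w) ⟨w₁, h₁⟩ ≫ p ≫ f)).1 ?_ |>.elim
    (hX.cone_hom_component_ne_zero_of_rel hF ha hT hx hf h₁ r₁) hg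
  rw [Category.assoc, Category.assoc, h, comp_zero, comp_zero]

lemma hasNonzeroComp_hom_cone_hom {x y : V} (hx : x ≠ v) (hy : y ≠ v) :
    HasNonzeroComp (X x) Z (X y) := by
  intro f g hf hg
  obtain ⟨w, hw, r⟩ : ∃ w ∈ S, R x w := by
    by_contra h
    exact hf ((hX.hasThinHom_to_cone hF ha hT hx).hom_eq_zero h f)
  obtain ⟨b, hb⟩ := hX.exists_ne_zero r
  obtain ⟨c, rfl⟩ := hX.exists_smul_hom_cone hF ha hT hx hw hb f
  have hc : c ≠ 0 := fun h => hf (by rw [h, zero_smul])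
  obtain ⟨w₁, h₁, w₂, h₂, hne, r₁, r₂⟩ := hX.exists_rel_of_cone_hom_ne_zero hF ha hT hg
  -- If `x` lies above `v`, then `S` is a pair, hence equal to `{w₁, w₂}`, and `w` is one of the
  -- two. Otherwise flippability supplies the relation.
  have hwy : R w y := by
    by_cases hxv : R x v
    · obtain ⟨x₁, x₂, hx12, hx₁, hx₂, hS⟩ := hF.exists_eq_pair x hx hxv
      have e₁ := hS w hw
      have e₂ := hS w₁ h₁
      have e₃ := hS w₂ h₂
      grind
    · exact hF.rel_of_above_of_below x hx hxv y hy w hw r w₁ h₁ w₂ h₂ hne r₁ r₂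
  rw [Linear.smul_comp, Category.assoc, Category.assoc]
  exact smul_ne_zero hc fun h => (hX.comp_eq_zero_iff.1 h).elim hb
    (hX.cone_hom_component_ne_zero_of_rel hF ha hT hy hg hw hwy)

/-- An endomorphism of `Z` lifts to a diagonal matrix of scalars on `⨁ X w`, since each `Hom(X w,
Z)` is a line. Compatibility with `X v`, whose endomorphisms are scalars, makes the entries equal,
and what is left factors through `Hom(X v[1], Z) = 0`. The true proposition `r` is left free in
order to match `flipRel`. -/
lemma hasThinHom_cone_cone (hv : ∀ w ∈ S, w ≠ v) (r : Prop) (hr : r) :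
    HasThinHom k r Z Z where
  ext_eq_zero := by
    intro j hj f
    have hpf : p ≫ f = 0 := biproduct.hom_ext' _ _ fun w => by
      rw [comp_zero]
      exact hX.hom_cone_shift_eq_zero ha hT hF.nonempty hj
        (biproduct.ι (fun w : S => X w) w ≫ p ≫ f)
    obtain ⟨g, rfl⟩ : ∃ g : (X v)⟦(1 : ℤ)⟧ ⟶ Z⟦j⟧, f = d ≫ g := Triangle.yoneda_exact₃ _ hT f hpf
    by_cases h1 : j = 1
    · subst h1
      obtain ⟨g, rfl⟩ := (shiftFunctor T (1 : ℤ)).map_surjective g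
      obtain ⟨h, rfl⟩ := hX.exists_lift_hom_cone hT g
      -- Each component `X v ⟶ X w` of `h` is a multiple of `a w`, so a diagonal `φ` works; then `d`
      -- kills the composite.
      obtain ⟨φ, hφ⟩ : ∃ φ : sumObj X S ⟶ sumObj X S, h = sumLift a S ≫ φ := by
        choose c hc using fun w : S => hX.exists_smul (ha w w.2) (h ≫ biproduct.π _ w)
        refine ⟨biproduct.map fun w => c w • 𝟙 _, biproduct.hom_ext _ _ fun w => ?_⟩
        rw [hc, Category.assoc, biproduct.map_π, Linear.comp_smul, Category.comp_id,
          Linear.comp_smul, biproduct.lift_π]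
      have h31 : d ≫ (sumLift a S)⟦(1 : ℤ)⟧' = 0 := comp_distTriang_mor_zero₃₁ _ hT
      rw [hφ, Category.assoc, Functor.map_comp, reassoc_of% h31, zero_comp]
    · rw [shiftedHom_eq_zero_of_sub (l := j - 1) (by omega)
        (hX.hom_cone_shift_eq_zero ha hT hF.nonempty (by omega)) g, comp_zero]
  hom_eq_zero h := absurd hr h
  finrank_hom _ := by
    have hZ : 𝟙 Z ≠ 0 := by
      intro h
      have hp : p = 0 := by rw [← Category.comp_id p, h, comp_zero]
      obtain ⟨w, hw⟩ := hF.nonempty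
      obtain ⟨f, hf⟩ : ∃ f : X w ⟶ X w, f ≠ 0 := by
        by_contra! h0
        exact ha w hw (by rw [← Category.comp_id (a w), h0 (𝟙 _), comp_zero])
      refine hX.hom_ι_cone_ne_zero_of_ne hF ha hT (hv w hw) hw hf ?_
      rw [hp, comp_zero, comp_zero]
    refine finrank_hom_eq_one k hZ fun f => ?_
    have hw (w : S) : ∃ c : k, biproduct.ι (fun w : S => X w) w ≫ p ≫ f =
        c • biproduct.ι (fun w : S => X w) w ≫ p := by
      have h0 : 𝟙 (X w.1) ≠ 0 := fun h => ha w w.2 (by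
        rw [← Category.comp_id (a w), h, comp_zero])
      obtain ⟨c, hc⟩ := hX.exists_smul_hom_cone hF ha hT (hv w w.2) w.2 h0
        (biproduct.ι (fun w : S => X w) w ≫ p ≫ f)
      exact ⟨c, by rw [hc, Category.id_comp]⟩
    choose c hc using hw
    let φ : sumObj X S ⟶ sumObj X S := biproduct.map fun w => c w • 𝟙 _
    have hφ : p ≫ f = φ ≫ p := biproduct.hom_ext' _ _ fun w => by
      rw [hc, biproduct.ι_map_assoc, Linear.smul_comp, Category.id_comp]
    have h12 : sumLift a S ≫ p = 0 := comp_distTriang_mor_zero₁₂ _ hT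
    obtain ⟨g, hg⟩ : ∃ g : X v ⟶ X v, sumLift a S ≫ φ = g ≫ sumLift a S :=
      Triangle.coyoneda_exact₂ _ hT (sumLift a S ≫ φ) (by
        change (sumLift a S ≫ φ) ≫ p = 0
        rw [Category.assoc, ← hφ, reassoc_of% h12, zero_comp])
    have h0 : 𝟙 (X v) ≠ 0 := fun h => by
      obtain ⟨w, hw⟩ := hF.nonempty
      exact ha w hw (by rw [← Category.id_comp (a w), h, zero_comp])
    obtain ⟨c₀, rfl⟩ := hX.exists_smul h0 g
    have hcc (w : S) : c w = c₀ := by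
      have h := congrArg (· ≫ biproduct.π _ w) hg
      simp only [Category.assoc, biproduct.lift_π, Linear.smul_comp, Category.id_comp, φ,
        biproduct.map_π, Linear.comp_smul, Category.comp_id] at h
      exact smul_left_injective k (ha w w.2) h
    refine ⟨c₀, sub_eq_zero.1 ?_⟩
    have hp : p ≫ (f - c₀ • 𝟙 Z) = 0 := biproduct.hom_ext' _ _ fun w => by
      rw [Preadditive.comp_sub, Preadditive.comp_sub, hc, hcc, Linear.comp_smul, Linear.comp_smul,
        Category.comp_id, sub_self, comp_zero]
    obtain ⟨g, hg⟩ : ∃ g : (X v)⟦(1 : ℤ)⟧ ⟶ Z, f - c₀ • 𝟙 Z = d ≫ g :=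
      Triangle.yoneda_exact₃ _ hT _ hp
    rw [hg, hX.shift_hom_cone_eq_zero ha hT hF.nonempty one_ne_zero g, comp_zero]

variable [DecidableEq V]

/-- Flipping a thin collection yields a thin collection. -/
theorem flip (hv : ∀ w ∈ S, w ≠ v)
    (htrans : ∀ x y z, R x y → R y z → R x z) :
    IsThin k (flipRel R v S) (Function.update X v Z) := by
  have key (x y : V) : HasThinHom k (flipRel R v S x y) (Function.update X v Z x)
      (Function.update X v Z y) := by
    by_cases hx : x = v <;> by_cases hy : y = v
    · subst hx hy
      rw [Function.update_self]
      exact hX.hasThinHom_cone_cone hF ha hT hv _ (Or.inl ⟨rfl, rfl⟩)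
    · subst hx
      rw [Function.update_self, Function.update_of_ne hy]
      convert hX.hasThinHom_from_cone hF ha hT hy using 1
      simp [flipRel, hy]
    · subst hy
      rw [Function.update_self, Function.update_of_ne hx]
      convert hX.hasThinHom_to_cone hF ha hT hx using 1
      simp [flipRel, hx]
    · rw [Function.update_of_ne hx, Function.update_of_ne hy]
      have : flipRel R v S x y ↔ R x y := by simp [flipRel, hx, hy]
      exact ⟨fun hi => hX.ext_eq_zero hi, fun h => hX.hom_eq_zero fun h' => h (this.2 h'),
        fun h => hX.finrank_hom (this.1 h)⟩
  have hZZ : ∀ g : Z ⟶ Z, ∃ c : k, g = c • 𝟙 Z := fun g => by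
    have h1 := (hX.hasThinHom_cone_cone hF ha hT hv True trivial).finrank_hom trivial
    by_cases hZ : 𝟙 Z = 0
    · exact ⟨0, by rw [← Category.comp_id g, hZ, comp_zero, smul_zero]⟩
    · exact exists_smul_of_finrank_hom h1 hZ g
  have comp_aux {U W : T} {f : U ⟶ W} {c : k} (hc : c • 𝟙 W ≠ 0) (hf : f ≠ 0) :
      f ≫ (c • 𝟙 W) ≠ 0 := by
    rw [Linear.comp_smul, Category.comp_id]
    exact smul_ne_zero (fun h => hc (by rw [h, zero_smul])) hf
  have comp_aux' {U W : T} {f : U ⟶ W} {c : k} (hc : c • 𝟙 U ≠ 0) (hf : f ≠ 0) :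
      (c • 𝟙 U) ≫ f ≠ 0 := by
    rw [Linear.smul_comp, Category.id_comp]
    exact smul_ne_zero (fun h => hc (by rw [h, zero_smul])) hf
  have comp (x y z : V) (hxy : flipRel R v S x y) (hyz : flipRel R v S y z) :
      HasNonzeroComp (Function.update X v Z x) (Function.update X v Z y)
        (Function.update X v Z z) := by
    by_cases hx : x = v
    · subst hx
      by_cases hy : y = x
      · subst hy
        rw [Function.update_self]
        intro f g hf hg
        obtain ⟨c, rfl⟩ := hZZ f
        exact comp_aux' hf hg
      · by_cases hz : z = x
        · subst hz
          -- Nonzero morphisms `Z ⟶ X y ⟶ Z` would put `y` above two distinct elements of `S` and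
          -- below a third one, which the antichain condition rules out.
          exfalso
          obtain ⟨w₁, h₁, w₂, h₂, hne, r₁, r₂⟩ :
            ∃ w₁ ∈ S, ∃ w₂ ∈ S, w₁ ≠ w₂ ∧ R w₁ y ∧ R w₂ y := by simpa [flipRel, hy] using hxy
          obtain ⟨w, hw, r⟩ : ∃ w ∈ S, R y w := by simpa [flipRel, hy] using hyz
          exact hne ((hF.antichain _ h₁ _ hw (htrans _ _ _ r₁ r)).trans
            (hF.antichain _ h₂ _ hw (htrans _ _ _ r₂ r)).symm)
        · rw [Function.update_self, Function.update_of_ne hy, Function.update_of_ne hz]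
          exact hX.hasNonzeroComp_cone_hom hF ha hT hy
    · by_cases hy : y = v
      · subst hy
        by_cases hz : z = y
        · subst hz
          rw [Function.update_self]
          intro f g hf hg
          obtain ⟨c, rfl⟩ := hZZ g
          exact comp_aux hg hf
        · rw [Function.update_self, Function.update_of_ne hx, Function.update_of_ne hz]
          exact hX.hasNonzeroComp_hom_cone_hom hF ha hT hx hz
      · by_cases hz : z = v
        · subst hz
          rw [Function.update_self, Function.update_of_ne hx, Function.update_of_ne hy]
          exact hX.hasNonzeroComp_hom_cone hF ha hT hx hy
        · rw [Function.update_of_ne hx, Function.update_of_ne hy, Function.update_of_ne hz]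
          intro f g hf hg h
          exact (hX.comp_eq_zero_iff.1 h).elim hf hg
  exact ⟨(key _ _).ext_eq_zero, (key _ _).hom_eq_zero, (key _ _).finrank_hom,
    fun hxy hyz f g hf hg => comp _ _ _ hxy hyz hf hg⟩

end IsThin

end Flip

/-! ### Mutations -/

section Mutation

variable (k : Type u) [Field k] {T : Type w} [Category.{v} T] [Preadditive T] [Linear k T]
  [HasZeroObject T] [HasShift T ℤ] [∀ n : ℤ, (shiftFunctor T n).Additive] [Pretriangulated T]

omit [Linear k T] in
lemma prop_biproduct_of_isTriangulated (P : ObjectProperty T) [P.IsTriangulated]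
    [P.IsClosedUnderIsomorphisms] {J : Type} [Finite J] (F : J → T) (h : ∀ j, P (F j)) :
    P (⨁ F) := by
  have := Fintype.ofFinite J
  exact P.prop_of_iso (biproduct.isoProduct F).symm
    (P.prop_of_isLimit (limit.isLimit (Discrete.functor F)) fun j => h j.as)

variable {k}

/-- A triangulated subcategory which contains the members of a collection contains the members of
any collection of which it is a mutation. -/
lemma MutationStep.prop_of_prop {n : ℕ} {E E' : Fin n → T} (h : MutationStep k E E')
    (P : ObjectProperty T) [P.IsTriangulated] [P.IsClosedUnderIsomorphisms]
    (hP : ∀ i, P (E' i)) (i : Fin n) : P (E i) := by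
  have of_iso {U W : T} (e : Nonempty (U ≅ W)) (hU : P U) : P W := P.prop_of_iso e.some hU
  cases h with
  | shift j m hj h =>
    by_cases hij : i = j
    · subst hij
      exact (P.prop_shift_iff_of_isStableUnderShift _ m).1 (of_iso hj (hP i))
    · exact of_iso (h i hij) (hP i)
  | left j l hjl hj hl h =>
    have hEj : P (E j) := of_iso hl (hP l)
    by_cases hil : i = l
    · subst hil
      obtain ⟨ι, _, b, g, h, hT⟩ := hj
      -- The mutated object is the third term of a triangle whose first term is a sum of shifts of
      -- the unchanged neighbour, so the original object is recovered as the middle term.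
      refine P.ext_of_isTriangulatedClosed₂ _ hT ?_ (hP j)
      exact prop_biproduct_of_isTriangulated P _ fun x =>
        (P.prop_shift_iff_of_isStableUnderShift _ _).2 hEj
    · by_cases hij : i = j
      · exact hij ▸ hEj
      · exact of_iso (h i hij hil) (hP i)
  | right j l hjl hj hl h =>
    have hEl : P (E l) := of_iso hj (hP j)
    by_cases hij : i = j
    · subst hij
      obtain ⟨ι, _, b, C, g, h, hT, e⟩ := hl
      refine P.ext_of_isTriangulatedClosed₁ _ hT ?_ ?_
      · exact prop_biproduct_of_isTriangulated P _ fun x =>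
          (P.prop_shift_iff_of_isStableUnderShift _ _).2 hEl
      · exact (P.prop_shift_iff_of_isStableUnderShift _ (-1 : ℤ)).1 (of_iso e (hP l))
    · by_cases hil : i = l
      · exact hil ▸ hEl
      · exact of_iso (h i hij hil) (hP i)

lemma prop_of_prop_of_mutations {n : ℕ} {E E' : Fin n → T}
    (h : Relation.ReflTransGen (MutationStep k) E E')
    (P : ObjectProperty T) [P.IsTriangulated] [P.IsClosedUnderIsomorphisms]
    (hP : ∀ i, P (E' i)) (i : Fin n) : P (E i) := by
  induction h using Relation.ReflTransGen.head_induction_on generalizing i with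
  | refl => exact hP i
  | head h _ ih => exact h.prop_of_prop P ih i

/-- A right mutation computed by a triangle isomorphic in its first two terms. -/
lemma isRightMutation_of_triangle {E F R : T} {ι : ℤ → Type} [Finite (Σ m, ι m)]
    (b : ∀ m : ℤ, Module.Basis (ι m) k (E ⟶ F⟦m⟧)) (t : Triangle T) (ht : t ∈ distTriang T)
    (e₁ : E ≅ t.obj₁) (e₂ : (⨁ fun x : Σ m, ι m => F⟦x.1⟧) ≅ t.obj₂)
    (comm : (biproduct.lift fun x : Σ m, ι m => b x.1 x.2) ≫ e₂.hom = e₁.hom ≫ t.mor₁)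
    (e : R ≅ t.obj₃⟦(-1 : ℤ)⟧) : IsRightMutation k E F R := by
  obtain ⟨C, g, h, hT⟩ :=
    distinguished_cocone_triangle (biproduct.lift fun x : Σ m, ι m => b x.1 x.2)
  let i := isoTriangleOfIso₁₂ _ _ hT ht e₁ e₂ comm
  exact ⟨ι, inferInstance, b, C, g, h, hT,
    ⟨e ≪≫ (shiftFunctor T (-1 : ℤ)).mapIso (Triangle.π₃.mapIso i).symm⟩⟩

/-- Right mutation of an orthogonal pair exchanges the two objects. -/
lemma isRightMutation_of_orthogonal {E F R : T} (h : ∀ (m : ℤ) (f : E ⟶ F⟦m⟧), f = 0)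
    (e : R ≅ E) : IsRightMutation k E F R := by
  have hs (m : ℤ) : Subsingleton (E ⟶ F⟦m⟧) := ⟨fun f g => (h m f).trans (h m g).symm⟩
  have : IsEmpty (Σ _ : ℤ, Empty) := ⟨fun x => x.2.elim⟩
  have hZ : IsZero (⨁ fun x : Σ _ : ℤ, Empty => F⟦x.1⟧) := by
    rw [IsZero.iff_id_eq_zero]
    exact biproduct.hom_ext _ _ fun x => isEmptyElim x
  -- The graded Hom vanishes, so the coevaluation goes to the empty sum, and its cone shifted back
  -- by one is the object itself.
  refine isRightMutation_of_triangle (ι := fun _ => Empty) (fun m => Module.Basis.empty _)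
    (contractibleTriangle E).rotate (rot_of_distTriang _ (contractible_distinguished E))
    (Iso.refl E) (hZ.iso (isZero_zero T)) ((isZero_zero T).eq_of_tgt _ _)
    (e ≪≫ (shiftFunctorCompIsoId T (1 : ℤ) (-1) (by simp)).symm.app E)

/-- Right mutation of a pair with a single morphism in degree zero. -/
lemma isRightMutation_of_line {E F R : T} (h : ∀ (m : ℤ), m ≠ 0 → ∀ f : E ⟶ F⟦m⟧, f = 0)
    {A B C : T} {α : A ⟶ B} {β : B ⟶ C} {γ : C ⟶ A⟦(1 : ℤ)⟧}
    (ht : Triangle.mk α β γ ∈ distTriang T) (e₁ : E ≅ A) (e₂ : F ≅ B)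
    (h0 : α ≠ 0) (h1 : ∀ f : A ⟶ B, ∃ c : k, f = c • α)
    (e : R ≅ C⟦(-1 : ℤ)⟧) : IsRightMutation k E F R := by
  let f : E ⟶ F⟦(0 : ℤ)⟧ := e₁.hom ≫ α ≫ e₂.inv ≫ (shiftFunctorZero T ℤ).inv.app F
  have hf : f ≠ 0 := by
    intro hf
    apply h0
    rw [← cancel_epi e₁.hom, ← cancel_mono (e₂.inv ≫ (shiftFunctorZero T ℤ).inv.app F),
      comp_zero, zero_comp, Category.assoc]
    exact hf
  have hspan (g : E ⟶ F⟦(0 : ℤ)⟧) : ∃ c : k, g = c • f := by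
    obtain ⟨c, hc⟩ := h1 (e₁.inv ≫ g ≫ (shiftFunctorZero T ℤ).hom.app F ≫ e₂.hom)
    refine ⟨c, ?_⟩
    rw [← cancel_epi e₁.inv, ← cancel_mono ((shiftFunctorZero T ℤ).hom.app F ≫ e₂.hom),
      Category.assoc, hc]
    simp [f]
  -- The index type `PLift (m = 0)` gives one basis vector in degree zero and none elsewhere, so the
  -- sum consists of a single copy of `F`. The extra clause records that this basis vector is `f`.
  have hb (m : ℤ) : Nonempty {b : Module.Basis (PLift (m = 0)) k (E ⟶ F⟦m⟧) //
      ∀ x : PLift (m = 0), ∀ hm : 0 = m, b x = hm ▸ f} := by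
    by_cases hm : m = 0
    · subst hm
      have : Unique (PLift ((0 : ℤ) = 0)) := ⟨⟨⟨rfl⟩⟩, fun _ => rfl⟩
      refine ⟨⟨Module.Basis.mk (v := fun _ => f) ?_ ?_, ?_⟩⟩
      · exact LinearIndependent.of_subsingleton default hf
      · rintro g -
        obtain ⟨c, rfl⟩ := hspan g
        exact Submodule.smul_mem _ _ (Submodule.subset_span ⟨default, rfl⟩)
      · intro x _
        exact Module.Basis.mk_apply _ _ _
    · have : IsEmpty (PLift (m = 0)) := ⟨fun x => hm x.down⟩
      have : Subsingleton (E ⟶ F⟦m⟧) := ⟨fun f g => (h m hm f).trans (h m hm g).symm⟩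
      exact ⟨⟨Module.Basis.empty _, fun x => isEmptyElim x⟩⟩
  have hbf (x : PLift ((0 : ℤ) = 0)) : (hb 0).some.1 x = f := (hb 0).some.2 x rfl
  let U : Unique (Σ m : ℤ, PLift (m = 0)) :=
    ⟨⟨⟨0, ⟨rfl⟩⟩⟩, fun ⟨m, hm⟩ => by obtain ⟨rfl⟩ := hm; rfl⟩
  let G := fun x : Σ m : ℤ, PLift (m = 0) => F⟦x.1⟧
  let e' : ⨁ G ≅ F⟦(0 : ℤ)⟧ :=
    { hom := biproduct.π G default
      inv := biproduct.ι G default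
      hom_inv_id := biproduct.hom_ext' _ _ fun j => by
        obtain rfl : j = default := Subsingleton.elim _ _
        exact (biproduct.ι_π_self_assoc G _ _).trans (Category.comp_id _).symm
      inv_hom_id := biproduct.ι_π_self G _ }
  refine isRightMutation_of_triangle (ι := fun m => PLift (m = 0)) (fun m => (hb m).some.1)
    _ ht e₁ (e' ≪≫ (shiftFunctorZero T ℤ).app F ≪≫ e₂) ?_ e
  change biproduct.lift _ ≫ biproduct.π G default ≫ (shiftFunctorZero T ℤ).hom.app F ≫ e₂.hom =
    e₁.hom ≫ α
  rw [biproduct.lift_π_assoc]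
  refine (congrArg (· ≫ _) (hbf ⟨rfl⟩)).trans ?_
  simp [f]

end Mutation

/-! ### Sliding an object through a thin collection -/

section Slide

/-- The elementary steps by which `v` moves to the right through a sequence `f`, collecting a set
`S` of elements above `v`. -/
inductive SlideStep {V : Type} [DecidableEq V] {n : ℕ} (R : V → V → Prop) (v : V) :
    Finset V × (Fin n → V) → Finset V × (Fin n → V) → Prop
  /-- The element `f j` is passed. -/
  | skip (S : Finset V) (f f' : Fin n → V) (i j : Fin n) (hij : i.val + 1 = j.val) (hi : f i = v)
      (hf' : ∀ l, f' l = f (Equiv.swap i j l)) (h₁ : R v (f j) → ∃ w ∈ S, R w (f j))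
      (h₂ : ∀ w₁ ∈ S, ∀ w₂ ∈ S, R w₁ (f j) → R w₂ (f j) → w₁ = w₂) : SlideStep R v (S, f) (S, f')
  /-- The element `f j` is passed and added to `S`. -/
  | absorb (S S' : Finset V) (f f' : Fin n → V) (i j : Fin n) (hij : i.val + 1 = j.val)
      (hi : f i = v) (hf' : ∀ l, f' l = f (Equiv.swap i j l)) (hS' : S' = insert (f j) S)
      (h₁ : R v (f j)) (h₂ : f j ∉ S) (h₃ : ∀ w ∈ S, ¬ R w (f j)) : SlideStep R v (S, f) (S', f')

lemma SlideStep.injective {V : Type} [DecidableEq V] {n : ℕ} {R : V → V → Prop} {v : V}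
    {s s' : Finset V × (Fin n → V)} (h : SlideStep R v s s') (hs : Function.Injective s.2) :
    Function.Injective s'.2 := by
  cases h with
  | skip S f f' i j hij hi hf' =>
    obtain rfl : f' = f ∘ Equiv.swap i j := funext hf'
    exact hs.comp (Equiv.injective _)
  | absorb S S' f f' i j hij hi hf' =>
    obtain rfl : f' = f ∘ Equiv.swap i j := funext hf'
    exact hs.comp (Equiv.injective _)

variable {k : Type u} [Field k] {T : Type w} [Category.{v} T] [Preadditive T] [Linear k T]
  [HasZeroObject T] [HasShift T ℤ] [∀ n : ℤ, (shiftFunctor T n).Additive] [Pretriangulated T]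
  {V : Type} [DecidableEq V]

omit [Linear k T] in
/-- The projection from a direct sum to the direct sum over a smaller index set. -/
abbrev sumProj (X : V → T) (u : V) (S : Finset V) : sumObj X (insert u S) ⟶ sumObj X S :=
  biproduct.lift fun w : S =>
    biproduct.π (fun w : ↥(insert u S) => X w) ⟨w, Finset.mem_insert_of_mem w.2⟩

-- This is a split triangle; it serves as the middle triangle of the octahedron when one more
-- summand is absorbed.
omit [Linear k T] in
lemma sumProj_distinguished (X : V → T) {u : V} {S : Finset V} (hu : u ∉ S) :
    Triangle.mk (biproduct.ι (fun w : ↥(insert u S) => X w) ⟨u, Finset.mem_insert_self u S⟩)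
      (sumProj X u S) 0 ∈ distTriang T := by
  let F := fun w : ↥(insert u S) => X w
  have hne (w : S) : (⟨u, Finset.mem_insert_self u S⟩ : ↥(insert u S)) ≠
      ⟨w, Finset.mem_insert_of_mem w.2⟩ := fun h => hu (by
    rw [show u = w.1 from congrArg Subtype.val h]
    exact w.2)
  have hιp : biproduct.ι F ⟨u, Finset.mem_insert_self u S⟩ ≫ sumProj X u S = 0 :=
    biproduct.hom_ext _ _ fun w => by
      rw [Category.assoc, biproduct.lift_π, zero_comp]
      exact biproduct.ι_π_ne F (hne w)
  have hdp : biproduct.desc (fun w : S =>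
      biproduct.ι F ⟨w, Finset.mem_insert_of_mem w.2⟩) ≫ sumProj X u S = 𝟙 _ :=
    biproduct.hom_ext' _ _ fun w => biproduct.hom_ext _ _ fun w' => by
      rw [Category.assoc, Category.assoc, biproduct.lift_π, biproduct.ι_desc_assoc,
        Category.comp_id]
      by_cases h : w = w'
      · subst h
        exact (biproduct.ι_π_self F _).trans (biproduct.ι_π_self (fun w : S => X w) w).symm
      · rw [biproduct.ι_π_ne _ h]
        exact biproduct.ι_π_ne F fun h' => h (Subtype.ext (by
          simpa using h'))
  have hdπ : biproduct.desc (fun w : S => biproduct.ι F ⟨w, Finset.mem_insert_of_mem w.2⟩) ≫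
      biproduct.π F ⟨u, Finset.mem_insert_self u S⟩ = 0 :=
    biproduct.hom_ext' _ _ fun w => by
      rw [biproduct.ι_desc_assoc, comp_zero]
      exact biproduct.ι_π_ne F (hne w).symm
  let e : sumObj X (insert u S) ≅ X u ⊞ sumObj X S :=
    { hom := biprod.lift (biproduct.π F ⟨u, Finset.mem_insert_self u S⟩) (sumProj X u S)
      inv := biprod.desc (biproduct.ι F ⟨u, Finset.mem_insert_self u S⟩)
        (biproduct.desc fun w : S => biproduct.ι F ⟨w, Finset.mem_insert_of_mem w.2⟩)
      hom_inv_id := by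
        rw [biprod.lift_desc]
        refine biproduct.hom_ext' _ _ fun ⟨w, hw⟩ => ?_
        rw [Preadditive.comp_add, Category.comp_id]
        rcases Finset.mem_insert.1 hw with rfl | hw'
        · refine (congrArg₂ (· + ·) (biproduct.ι_π_self_assoc F _ _)
            ((Category.assoc _ _ _).symm.trans ((congrArg (· ≫ _) hιp).trans zero_comp))).trans ?_
          exact add_zero _
        · have h1 : biproduct.ι F ⟨w, hw⟩ =
              biproduct.ι (fun w : S => X w) ⟨w, hw'⟩ ≫ biproduct.desc (fun w : S =>
                biproduct.ι F ⟨w, Finset.mem_insert_of_mem w.2⟩) := by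
            rw [biproduct.ι_desc]
          change biproduct.ι F ⟨w, hw⟩ ≫ _ + biproduct.ι F ⟨w, hw⟩ ≫ _ = biproduct.ι F ⟨w, hw⟩
          rw [h1, Category.assoc, Category.assoc, reassoc_of% hdp, reassoc_of% hdπ, zero_comp,
            comp_zero, zero_add]
      inv_hom_id := by
        apply biprod.hom_ext'
        · rw [biprod.inl_desc_assoc, Category.comp_id]
          apply biprod.hom_ext
          · rw [Category.assoc, biprod.lift_fst, biprod.inl_fst]
            exact biproduct.ι_π_self F _
          · rw [Category.assoc, biprod.lift_snd, biprod.inl_snd]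
            exact hιp
        · rw [biprod.inr_desc_assoc, Category.comp_id]
          apply biprod.hom_ext
          · rw [Category.assoc, biprod.lift_fst, biprod.inr_fst]
            exact hdπ
          · rw [Category.assoc, biprod.lift_snd, biprod.inr_snd]
            exact hdp }
  refine isomorphic_distinguished _ (binaryBiproductTriangle_distinguished (X u) (sumObj X S)) _
    (Triangle.isoMk _ _ (Iso.refl _) e (Iso.refl _) ?_ ?_ ?_)
  · refine Eq.trans ?_ (Category.id_comp (biprod.inl : X u ⟶ X u ⊞ sumObj X S)).symm
    change biproduct.ι F ⟨u, Finset.mem_insert_self u S⟩ ≫ e.hom = biprod.inl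
    apply biprod.hom_ext
    · rw [Category.assoc, biprod.lift_fst, biprod.inl_fst]
      exact biproduct.ι_π_self F _
    · rw [Category.assoc, biprod.lift_snd, biprod.inl_snd]
      exact hιp
  · change sumProj X u S ≫ 𝟙 _ = e.hom ≫ biprod.snd
    rw [Category.comp_id]
    exact (biprod.lift_snd _ _).symm
  · exact zero_comp.trans comp_zero.symm

namespace IsThin

variable {R : V → V → Prop} {X : V → T} (hX : IsThin k R X)

include hX

lemma hom_shift_eq_zero_of_not_rel {x y : V} (h : ¬ R x y) (i : ℤ) (f : X x ⟶ (X y)⟦i⟧) :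
    f = 0 := by
  by_cases hi : i = 0
  · subst hi
    rw [← cancel_mono ((shiftFunctorZero T ℤ).hom.app (X y)), zero_comp]
    exact hX.hom_eq_zero h _
  · exact hX.ext_eq_zero hi f

lemma id_ne_zero {x : V} (h : R x x) : 𝟙 (X x) ≠ 0 := by
  obtain ⟨f, hf⟩ := hX.exists_ne_zero h
  exact fun h => hf (by rw [← Category.id_comp f, h, zero_comp])

variable {v : V} {S : Finset V} {a : ∀ w, X v ⟶ X w} {Z : T} {p : sumObj X S ⟶ Z}
  {d : Z ⟶ (X v)⟦(1 : ℤ)⟧} (ha : ∀ w ∈ S, a w ≠ 0)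
  (hT : Triangle.mk (sumLift a S) p d ∈ distTriang T)

include hT

/-- `h₁` kills the first Ext from the cone to `X u` and `h₂` kills the degree-zero morphisms, so the
pair is orthogonal and mutation merely swaps it. -/
lemma isRightMutation_skip (ha : ∀ w ∈ S, a w ≠ 0) {u : V} (h₁ : R v u → ∃ w ∈ S, R w u)
    (h₂ : ∀ w₁ ∈ S, ∀ w₂ ∈ S, R w₁ u → R w₂ u → w₁ = w₂) {E F Q : T} (eE : E ≅ Z⟦(-1 : ℤ)⟧)
    (eF : F ≅ X u) (eQ : Q ≅ Z⟦(-1 : ℤ)⟧) : IsRightMutation k E F Q := by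
  have h0 (m : ℤ) (f : Z ⟶ (X u)⟦m⟧) : f = 0 := by
    by_cases hm : m = 0
    · subst hm
      rw [← cancel_mono ((shiftFunctorZero T ℤ).hom.app (X u)), zero_comp]
      exact hX.cone_hom_eq_zero ha hT h₂ _
    · exact hX.cone_hom_shift_eq_zero ha hT h₁ hm f
  refine isRightMutation_of_orthogonal (fun m f => ?_) (eQ ≪≫ eE.symm)
  rw [← cancel_epi eE.inv, ← cancel_mono ((shiftFunctor T m).map eF.hom), comp_zero, zero_comp]
  exact shiftedHom_eq_zero_of_sub (l := m + 1) (by omega) (h0 (m + 1)) _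

/-- No `X w` with `w ∈ S` maps to `X u`, so the graded Hom from `Z[-1]` to `X u` is the line spanned
by `d` followed by `a u`, in degree zero. The octahedral axiom identifies the cone of a nonzero such
morphism with the cone `Z'` for the enlarged set. -/
lemma isRightMutation_absorb [IsTriangulated T] [∀ n : ℤ, (shiftFunctor T n).Linear k]
    (hrefl : ∀ x, R x x) {u : V} (hu : u ∉ S) (hau : a u ≠ 0) (ha : ∀ w ∈ S, a w ≠ 0)
    (h : ∀ w ∈ S, ¬ R w u) {Z' : T} {p' : sumObj X (insert u S) ⟶ Z'} {d' : Z' ⟶ (X v)⟦(1 : ℤ)⟧}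
    (hT' : Triangle.mk (sumLift a (insert u S)) p' d' ∈ distTriang T) {E F Q : T}
    (eE : E ≅ Z⟦(-1 : ℤ)⟧) (eF : F ≅ X u) (eQ : Q ≅ Z'⟦(-1 : ℤ)⟧) : IsRightMutation k E F Q := by
  have comm : sumLift a (insert u S) ≫ sumProj X u S = sumLift a S :=
    biproduct.hom_ext _ _ fun w => by
      rw [Category.assoc, biproduct.lift_π, biproduct.lift_π, biproduct.lift_π]
  -- The octahedron on `X v → ⨁_{insert u S} X w → ⨁_S X w` gives a triangle `Z' → Z → X u[1]`.
  let O := Triangulated.someOctahedron comm hT' (rot_of_distTriang _ (sumProj_distinguished X hu))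
    hT
  have hfac (m : ℤ) (f : Z ⟶ (X u)⟦m⟧) : ∃ g : (X v)⟦(1 : ℤ)⟧ ⟶ (X u)⟦m⟧, f = d ≫ g :=
    Triangle.yoneda_exact₃ _ hT f (biproduct.hom_ext' _ _ fun w =>
      (hX.hom_shift_eq_zero_of_not_rel (h w w.2) m
        (biproduct.ι (fun w : S => X w) w ≫ p ≫ f)).trans comp_zero.symm)
  have h0 (m : ℤ) (hm : m ≠ 1) (f : Z ⟶ (X u)⟦m⟧) : f = 0 := by
    obtain ⟨g, rfl⟩ := hfac m f
    rw [hX.shifted_hom_eq_zero hm.symm g, comp_zero]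
  -- Two inverse rotations turn it into `Z[-1] → X u → Z'`, up to the identification of `X u[1][-1]`
  -- with `X u`.
  obtain ⟨α, β, γ, ht⟩ : ∃ (α : Z⟦(-1 : ℤ)⟧ ⟶ (X u)⟦(1 : ℤ)⟧⟦(-1 : ℤ)⟧)
      (β : (X u)⟦(1 : ℤ)⟧⟦(-1 : ℤ)⟧ ⟶ Z') (γ : Z' ⟶ Z⟦(-1 : ℤ)⟧⟦(1 : ℤ)⟧),
      Triangle.mk α β γ ∈ distTriang T :=
    ⟨_, _, _, inv_rot_of_distTriang _ (inv_rot_of_distTriang _ O.mem)⟩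
  let e : X u ≅ (X u)⟦(1 : ℤ)⟧⟦(-1 : ℤ)⟧ :=
    (shiftFunctorCompIsoId T (1 : ℤ) (-1) (by simp)).symm.app (X u)
  have ha' : ∀ w ∈ insert u S, a w ≠ 0 := fun w hw => by
    rcases Finset.mem_insert.1 hw with rfl | hw
    exacts [hau, ha w hw]
  -- If `α` vanished, the identity of `X u` would factor through `Z'`. But `u` is the only index in
  -- `insert u S` related to `u`, so `Hom(Z', X u) = 0`.
  have ht0 : α ≠ 0 := by
    intro h0
    obtain ⟨r, hr⟩ : ∃ r : Z' ⟶ (X u)⟦(1 : ℤ)⟧⟦(-1 : ℤ)⟧, 𝟙 _ = β ≫ r :=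
      Triangle.yoneda_exact₂ _ ht (𝟙 _) ((Category.comp_id α).trans h0)
    have hr0 : r = 0 := by
      rw [← cancel_mono e.inv, zero_comp]
      refine hX.cone_hom_eq_zero ha' hT' (fun w₁ h₁ w₂ h₂ r₁ r₂ => ?_) (r ≫ e.inv)
      have key : ∀ w ∈ insert u S, R w u → w = u := fun w hw r => by
        rcases Finset.mem_insert.1 hw with rfl | hw
        exacts [rfl, absurd r (h w hw)]
      rw [key w₁ h₁ r₁, key w₂ h₂ r₂]
    have h1 : 𝟙 ((X u)⟦(1 : ℤ)⟧⟦(-1 : ℤ)⟧) = 0 := hr.trans (by rw [hr0, comp_zero])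
    apply hX.id_ne_zero (hrefl u)
    rw [← e.hom_inv_id, ← Category.id_comp e.inv, h1, zero_comp, comp_zero]
  have hspan (f : Z⟦(-1 : ℤ)⟧ ⟶ (X u)⟦(1 : ℤ)⟧⟦(-1 : ℤ)⟧) :
      ∃ c : k, f = c • (d ≫ (a u)⟦(1 : ℤ)⟧')⟦(-1 : ℤ)⟧' := by
    obtain ⟨f, rfl⟩ := (shiftFunctor T (-1 : ℤ)).map_surjective f
    obtain ⟨g, rfl⟩ := hfac 1 f
    obtain ⟨g, rfl⟩ := (shiftFunctor T (1 : ℤ)).map_surjective g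
    obtain ⟨c, rfl⟩ := hX.exists_smul hau g
    exact ⟨c, by rw [Functor.map_smul, Linear.comp_smul, Functor.map_smul]⟩
  refine isRightMutation_of_line (fun m hm f => ?_) ht eE (eF ≪≫ e) ht0 (fun f => ?_) eQ
  · rw [← cancel_epi eE.inv, ← cancel_mono ((shiftFunctor T m).map eF.hom), comp_zero, zero_comp]
    exact shiftedHom_eq_zero_of_sub (l := m + 1) (by omega) (h0 (m + 1) (by omega)) _
  · obtain ⟨c, hc⟩ := hspan f
    obtain ⟨c₀, hc₀⟩ := hspan α
    have hc₀' : c₀ ≠ 0 := fun h => ht0 (by rw [hc₀, h, zero_smul])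
    exact ⟨c * c₀⁻¹, by rw [hc, hc₀, smul_smul, mul_assoc, inv_mul_cancel₀ hc₀', mul_one]⟩

end IsThin

/-- The collection obtained from a thin collection when `v` has moved through the sequence `f` and
has collected `S`. -/
def IsSlid {n : ℕ} (X : V → T) {v : V} (a : ∀ w, X v ⟶ X w) (S : Finset V) (f : Fin n → V)
    (E : Fin n → T) : Prop :=
  ∃ (Z : T) (p : sumObj X S ⟶ Z) (d : Z ⟶ (X v)⟦(1 : ℤ)⟧),
    Triangle.mk (sumLift a S) p d ∈ distTriang T ∧
    (∀ l, f l ≠ v → Nonempty (E l ≅ X (f l))) ∧ ∀ l, f l = v → Nonempty (E l ≅ Z⟦(-1 : ℤ)⟧)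

section

variable [IsTriangulated T] [∀ n : ℤ, (shiftFunctor T n).Linear k]
  {R : V → V → Prop} {X : V → T} (hX : IsThin k R X) {v : V} {n : ℕ}

include hX

/-- The invariant `IsSlid` says that the moving position carries the cone for the collected set,
shifted by `-1`. Each slide step is one right mutation preserving this invariant. -/
lemma IsThin.exists_mutationStep_of_slideStep (hrefl : ∀ x, R x x) {a : ∀ w, X v ⟶ X w}
    (ha : ∀ w, R v w → a w ≠ 0) {s s' : Finset V × (Fin n → V)} (h : SlideStep R v s s')
    (hs : Function.Injective s.2) (hS : ∀ w ∈ s.1, R v w) {E : Fin n → T}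
    (hE : IsSlid X a s.1 s.2 E) :
    ∃ E', MutationStep k E E' ∧ IsSlid X a s'.1 s'.2 E' ∧ ∀ w ∈ s'.1, R v w := by
  obtain ⟨Z, p, d, hT, hE₁, hE₂⟩ := hE
  -- Bookkeeping shared by both kinds of steps: once the mutated object is known to be `Z'[-1]`, the
  -- new collection is the old one with two neighbouring places exchanged.
  have swap_aux {f f' : Fin n → V} {i j : Fin n} (hij : i.val + 1 = j.val) (hi : f i = v)
      (hf : Function.Injective f) (hf' : ∀ l, f' l = f (Equiv.swap i j l)) {Z' : T}
      (hE₁ : ∀ l, f l ≠ v → Nonempty (E l ≅ X (f l)))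
      (hmut : ∀ Q : T, Nonempty (Q ≅ Z'⟦(-1 : ℤ)⟧) → IsRightMutation k (E i) (E j) Q) :
      ∃ E', MutationStep k E E' ∧ (∀ l, f' l ≠ v → Nonempty (E' l ≅ X (f' l))) ∧
        ∀ l, f' l = v → Nonempty (E' l ≅ Z'⟦(-1 : ℤ)⟧) := by
    have hne : j ≠ i := fun h => by rw [h] at hij; omega
    have hji : f j ≠ v := fun h => hne (hf (h.trans hi.symm))
    refine ⟨fun l => if l = i then X (f j) else if l = j then Z'⟦(-1 : ℤ)⟧ else E l,
      .right i j hij ?_ ?_ ?_, ?_, ?_⟩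
    · simpa using ⟨(hE₁ j hji).some.symm⟩
    · simpa [hne] using hmut _ ⟨Iso.refl _⟩
    · intro l hi hj
      simpa [hi, hj] using ⟨Iso.refl _⟩
    · intro l hl
      rw [hf'] at hl ⊢
      by_cases hli : l = i
      · subst hli
        simpa using ⟨Iso.refl _⟩
      · by_cases hlj : l = j
        · subst hlj
          rw [Equiv.swap_apply_right] at hl
          exact absurd hi hl
        · rw [Equiv.swap_apply_of_ne_of_ne hli hlj] at hl ⊢
          simpa [hli, hlj] using hE₁ l hl
    · intro l hl
      rw [hf', ← hi] at hl
      obtain rfl : l = j := by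
        have := congrArg (Equiv.swap i j) (hf hl)
        rwa [Equiv.swap_apply_self, Equiv.swap_apply_left] at this
      simpa [hne] using ⟨Iso.refl _⟩
  cases h with
  | skip S f f' i j hij hi hf' h₁ h₂ =>
    have hne : j ≠ i := fun h => by rw [h] at hij; omega
    have hji : f j ≠ v := fun h => hne (hs (h.trans hi.symm))
    obtain ⟨E', hm, h⟩ := swap_aux hij hi hs hf' hE₁ fun Q ⟨e⟩ =>
      hX.isRightMutation_skip hT (fun w hw => ha w (hS w hw)) h₁ h₂ (hE₂ i hi).some
        (hE₁ j hji).some e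
    exact ⟨E', hm, ⟨Z, p, d, hT, h⟩, hS⟩
  | absorb S S' f f' i j hij hi hf' hS' h₁ h₂ h₃ =>
    subst hS'
    have hne : j ≠ i := fun h => by rw [h] at hij; omega
    have hji : f j ≠ v := fun h => hne (hs (h.trans hi.symm))
    obtain ⟨Z', p', d', hT'⟩ := distinguished_cocone_triangle (sumLift a (insert (f j) S))
    obtain ⟨E', hm, h⟩ := swap_aux hij hi hs hf' hE₁ fun Q ⟨e⟩ =>
      hX.isRightMutation_absorb hT hrefl h₂ (ha _ h₁) (fun w hw => ha w (hS w hw)) h₃ hT'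
        (hE₂ i hi).some (hE₁ j hji).some e
    refine ⟨E', hm, ⟨Z', p', d', hT', h⟩, fun w hw => ?_⟩
    rcases Finset.mem_insert.1 hw with rfl | hw
    exacts [h₁, hS w hw]

/-- A flip of a thin collection is obtained by mutations. -/
theorem IsThin.exists_mutations_flip (hrefl : ∀ x, R x x)
    (htrans : ∀ x y z, R x y → R y z → R x z) {N : Finset V} (hN : IsFlippable R v N)
    (hv : ∀ w ∈ N, w ≠ v) {f f' : Fin n → V} (hf : Function.Injective f)
    (hs : Relation.ReflTransGen (SlideStep R v) (∅, f) (N, f')) {E : Fin n → T}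
    (hE : ∀ i, Nonempty (E i ≅ X (f i))) :
    ∃ (X' : V → T) (E' : Fin n → T), IsThin k (flipRel R v N) X' ∧
      Relation.ReflTransGen (MutationStep k) E E' ∧ ∀ i, Nonempty (E' i ≅ X' (f' i)) := by
  obtain ⟨a, ha⟩ : ∃ a : ∀ w, X v ⟶ X w, ∀ w, R v w → a w ≠ 0 := by
    have (w : V) : ∃ a : X v ⟶ X w, R v w → a ≠ 0 := by
      by_cases h : R v w
      · exact (hX.exists_ne_zero h).imp fun _ h _ => h
      · exact ⟨0, fun h' => absurd h' h⟩
    choose a ha using this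
    exact ⟨a, ha⟩
  have key {s : Finset V × (Fin n → V)} (hs : Relation.ReflTransGen (SlideStep R v) (∅, f) s) :
      Function.Injective s.2 ∧ (∀ w ∈ s.1, R v w) ∧
      ∃ E', Relation.ReflTransGen (MutationStep k) E E' ∧ IsSlid X a s.1 s.2 E' := by
    induction hs with
    | refl =>
      refine ⟨hf, by simp, E, .refl, ?_⟩
      -- At the start nothing has been collected: the cone of `X v → 0` is `X v[1]`, and its shift
      -- by `-1` is the original object.
      obtain ⟨Z, p, d, hT⟩ := distinguished_cocone_triangle (sumLift a (∅ : Finset V))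
      refine ⟨Z, p, d, hT, fun l _ => hE l, fun l hl => ?_⟩
      have hZ : IsZero (sumObj X (∅ : Finset V)) := by
        rw [IsZero.iff_id_eq_zero]
        exact biproduct.hom_ext _ _ fun x => isEmptyElim x
      have : IsIso d := (Triangle.isZero₂_iff_isIso₃ _ hT).1 hZ
      have hl' : f l = v := hl
      exact ⟨(hE l).some ≪≫ eqToIso (congrArg X hl') ≪≫
        (shiftFunctorCompIsoId T (1 : ℤ) (-1) (by simp)).symm.app (X v) ≪≫
        (shiftFunctor T (-1 : ℤ)).mapIso (asIso d).symm⟩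
    | tail _ h ih =>
      obtain ⟨hinj, hS, E₁, hE₁, hE₁'⟩ := ih
      obtain ⟨E₂, h₂, hE₂, hS₂⟩ := hX.exists_mutationStep_of_slideStep hrefl ha h hinj hS hE₁'
      exact ⟨h.injective hinj, hS₂, E₂, hE₁.tail h₂, hE₂⟩
  obtain ⟨hf', -, E₁, hE₁, Z, p, d, hT, h₁, h₂⟩ := key hs
  refine ⟨Function.update X v Z, fun l => Function.update X v Z (f' l),
    hX.flip hN (fun w hw => ha w (hN.rel w hw)) hT hv htrans, ?_, fun i => ⟨Iso.refl _⟩⟩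
  -- The slide ends with `Z[-1]` at the place of `v`; a single shift replaces it by `Z`.
  by_cases hl : ∃ l, f' l = v
  · obtain ⟨l, hl⟩ := hl
    refine hE₁.tail (.shift l 1 ?_ fun j hj => ?_)
    · rw [hl, Function.update_self]
      exact ⟨(shiftFunctorCompIsoId T (-1 : ℤ) 1 (by simp)).symm.app Z ≪≫
        (shiftFunctor T (1 : ℤ)).mapIso (h₂ l hl).some.symm⟩
    · have hne : f' j ≠ v := fun h => hj (hf' (h.trans hl.symm))
      rw [Function.update_of_ne hne]
      exact ⟨(h₁ j hne).some.symm⟩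
  -- If `v` does not occur in the list, the shift by zero is used only to pass to isomorphic
  -- objects.
  · by_cases hn : Nonempty (Fin n)
    · obtain ⟨l⟩ := hn
      refine hE₁.tail (.shift l 0 ?_ fun j hj => ?_)
      · have hne : f' l ≠ v := fun h => hl ⟨l, h⟩
        rw [Function.update_of_ne hne]
        exact ⟨(h₁ l hne).some.symm ≪≫ ((shiftFunctorZero T ℤ).app _).symm⟩
      · have hne : f' j ≠ v := fun h => hl ⟨j, h⟩
        rw [Function.update_of_ne hne]
        exact ⟨(h₁ j hne).some.symm⟩
    · convert hE₁ using 1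
      exact funext fun i => absurd ⟨i⟩ hn

end

end Slide

/-! ### Orientations of a tree -/

/-- A finite graph with vertices `Fin n` and edges `Fin m`, with a reference orientation. -/
structure EdgeList (n m : ℕ) where
  /-- The source of an edge in the reference orientation. -/
  src : Fin m → Fin n
  /-- The target of an edge in the reference orientation. -/
  tgt : Fin m → Fin n

namespace EdgeList

variable {n m : ℕ} (t : EdgeList n m)

/-- There is an arrow from `a` to `b` in the orientation encoded by the binary digits of `o`. -/
def arrow (o : ℕ) (a b : Fin n) : Bool :=
  (List.finRange m).any fun e =>
    bif o.testBit e then t.src e == a && t.tgt e == b else t.src e == b && t.tgt e == a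

/-- There is a path of length at most `l` from `a` to `b`. -/
def reach (o : ℕ) : ℕ → Fin n → Fin n → Bool
  | 0, a, b => a == b
  | l + 1, a, b => a == b || (List.finRange n).any fun c => t.arrow o c b && reach o l a c

/-- There is a path from `a` to `b`. -/
def Rel (o : ℕ) (a b : Fin n) : Prop := t.reach o (n - 1) a b = true

instance (o : ℕ) : DecidableRel (t.Rel o) := fun _ _ => inferInstanceAs (Decidable (_ = true))

/-- The vertices to which there is an arrow from `v`. -/
def next (o : ℕ) (v : Fin n) : Finset (Fin n) := {w | t.arrow o v w = true}

/-- No arrow ends at `v`. -/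
def IsSource (o : ℕ) (v : Fin n) : Prop := ∀ a, t.arrow o a v = false

instance (o : ℕ) : DecidablePred (t.IsSource o) := fun _ => Nat.decidableForallFin _

/-- Reverse all arrows at `v`. -/
def reverseAt (o : ℕ) (v : Fin n) : ℕ :=
  o ^^^ ((List.finRange m).map fun e => bif t.src e == v || t.tgt e == v then 2 ^ e.val else 0).sum

end EdgeList

instance {V : Type} [DecidableEq V] (R : V → V → Prop) [DecidableRel R] (v : V) (N : Finset V) :
    DecidableRel (flipRel R v N) := fun a b => by unfold flipRel; infer_instance

/-- The Dynkin diagram of type `D₄`. -/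
def edgeListD4 : EdgeList 4 3 := ⟨![0, 2, 1], ![1, 1, 3]⟩

/-- The Dynkin diagram of type `E₆`. -/
def edgeListE6 : EdgeList 6 5 := ⟨![0, 1, 2, 3, 4], ![2, 3, 3, 4, 5]⟩

/-- The combinatorial properties of orientations of a tree which are used. -/
structure EdgeList.IsTreeLike {n m : ℕ} (t : EdgeList n m) : Prop where
  trans : ∀ o < 2 ^ m, ∀ a b c, t.Rel o a b → t.Rel o b c → t.Rel o a c
  rel_of_arrow : ∀ o < 2 ^ m, ∀ a b, t.arrow o a b = true → t.Rel o a b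
  eq_of_arrow : ∀ o < 2 ^ m, ∀ a b c c', t.Rel o a c → t.arrow o c b = true → t.Rel o a c' →
    t.arrow o c' b = true → c = c'
  not_rel_of_arrow : ∀ o < 2 ^ m, ∀ a b, t.arrow o a b = true → ¬ t.Rel o b a
  next_nonempty : ∀ o < 2 ^ m, ∀ v, t.IsSource o v → (t.next o v).Nonempty
  eq_of_rel_next : ∀ o < 2 ^ m, ∀ v, t.IsSource o v → ∀ u w₁ w₂, u ≠ v → t.arrow o v w₁ = true →
    t.arrow o v w₂ = true → t.Rel o u w₁ → t.Rel o u w₂ → w₁ = w₂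
  eq_of_next_rel : ∀ o < 2 ^ m, ∀ v, t.IsSource o v → ∀ u w₁ w₂, t.arrow o v w₁ = true →
    t.arrow o v w₂ = true → t.Rel o w₁ u → t.Rel o w₂ u → w₁ = w₂
  -- At a source with its set of direct successors, the flip is a reflection: the source becomes a
  -- sink.
  flipRel_iff : ∀ o < 2 ^ m, ∀ v, t.IsSource o v → ∀ a b,
    flipRel (t.Rel o) v (t.next o v) a b ↔ t.Rel (t.reverseAt o v) a b
  reverseAt_reverseAt : ∀ o < 2 ^ m, ∀ v, t.reverseAt (t.reverseAt o v) v = o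
  reverseAt_lt : ∀ o < 2 ^ m, ∀ v, t.reverseAt o v < 2 ^ m

set_option synthInstance.maxSize 1000 in
set_option synthInstance.maxHeartbeats 200000 in
lemma edgeListD4_isTreeLike : edgeListD4.IsTreeLike := by
  constructor <;> decide +kernel

set_option synthInstance.maxSize 1000 in
set_option synthInstance.maxHeartbeats 200000 in
lemma edgeListE6_isTreeLike : edgeListE6.IsTreeLike := by
  constructor <;> decide +kernel

/-- The number of reversals at sources which lead to an orientation of the diagram `D₄` from the
reference orientation. -/
def rankD4 (o : ℕ) : ℕ := ([5, 4, 4, 3, 2, 1, 1, 0] : List ℕ).getD o 0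

/-- The number of reversals at sources which lead to an orientation of the diagram `E₆` from the
reference orientation. -/
def rankE6 (o : ℕ) : ℕ :=
  ([13, 12, 12, 11, 11, 10, 10, 9, 9, 8, 8, 7, 7, 6, 6, 5, 8, 7, 7, 6, 6, 5, 5, 4, 4, 3, 3, 2, 2, 1, 1, 0] :
    List ℕ).getD o 0

/-- In `7` all bits are set, which is the reference orientation. Every other orientation arises by
reversing the arrows at a source of an orientation of smaller rank, so induction on the rank reaches
all of them. -/
lemma edgeListD4_rank : ∀ o < 2 ^ 3, o = 7 ∨ ∃ v, edgeListD4.IsSource (edgeListD4.reverseAt o v) v ∧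
    rankD4 (edgeListD4.reverseAt o v) < rankD4 o := by
  decide +kernel

lemma edgeListE6_rank : ∀ o < 2 ^ 5, o = 31 ∨
    ∃ v, edgeListE6.IsSource (edgeListE6.reverseAt o v) v ∧
      rankE6 (edgeListE6.reverseAt o v) < rankE6 o := by
  decide +kernel

/-! ### From grids to trees -/

section SourceSlide

variable {V : Type} [DecidableEq V] {R : V → V → Prop} {v : V} {N : Finset V} {n : ℕ}

/-- Nothing else lies above a source, and by `h₃` no element lies below two members of `N`, so the
conditions that speak of pairs are vacuous. -/
lemma IsFlippable.of_source (hrefl : ∀ x, R x x) (hsource : ∀ u, u ≠ v → ¬ R u v)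
    (hN : N.Nonempty) (hvN : ∀ w ∈ N, R v w)
    (h₁ : ∀ u, u ≠ v → ∀ w₁ ∈ N, ∀ w₂ ∈ N, R u w₁ → R u w₂ → w₁ = w₂)
    (h₂ : ∀ u, u ≠ v → R v u → ∃ w ∈ N, R w u)
    (h₃ : ∀ u, ∀ w₁ ∈ N, ∀ w₂ ∈ N, R w₁ u → R w₂ u → w₁ = w₂) : IsFlippable R v N where
  nonempty := hN
  rel := hvN
  antichain w₁ hw₁ w₂ hw₂ h := h₃ w₂ w₁ hw₁ w₂ hw₂ h (hrefl w₂)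
  exists_eq_pair u hu h := absurd h (hsource u hu)
  subsingleton_above u hu _ := h₁ u hu
  exists_below := h₂
  eq_or_eq_below u _ w₁ hw₁ w₂ hw₂ _ _ hne r₁ r₂ _ := absurd (h₃ u w₁ hw₁ w₂ hw₂ r₁ r₂) hne
  rel_of_above_of_below _ _ _ b _ _ _ _ w₁ hw₁ w₂ hw₂ hne r₁ r₂ :=
    absurd (h₃ b w₁ hw₁ w₂ hw₂ r₁ r₂) hne

/-- A source can be moved to the end of a sequence. -/
lemma exists_slide_to_end (hrefl : ∀ x, R x x) (hvN : ∀ w ∈ N, R v w ∧ w ≠ v)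
    (h₂ : ∀ u, u ≠ v → R v u → ∃ w ∈ N, R w u)
    (h₃ : ∀ u, ∀ w₁ ∈ N, ∀ w₂ ∈ N, R w₁ u → R w₂ u → w₁ = w₂) (l : ℕ) :
    ∀ (i : Fin n) (S : Finset V) (f : Fin n → V), i.val + l + 1 = n → Function.Bijective f →
      f i = v → (∀ a b, a < b → f a ≠ v → f b ≠ v → ¬ R (f b) (f a)) →
      (∀ w, w ∈ S ↔ w ∈ N ∧ ∃ a, a < i ∧ f a = w) →
      ∃ f' : Fin n → V, Relation.ReflTransGen (SlideStep R v) (S, f) (N, f') ∧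
        Function.Bijective f' ∧ (∀ a, f' a = v → a.val + 1 = n) ∧
        ∀ a b, a < b → f' a ≠ v → f' b ≠ v → ¬ R (f' b) (f' a) := by
  -- `l` counts the places to the right of `v`; at `l = 0` it has passed everything, so all of `N`
  -- has been collected.
  induction l with
  | zero =>
    intro i S f hi hf hfi hlin hS
    obtain rfl : S = N := by
      ext w
      rw [hS w]
      refine ⟨fun h => h.1, fun hw => ⟨hw, ?_⟩⟩
      obtain ⟨a, rfl⟩ := hf.2 w
      have : a ≠ i := fun h => (hvN _ hw).2 (h ▸ hfi)
      exact ⟨a, by omega, rfl⟩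
    exact ⟨f, .refl, hf, fun a ha => by rw [hf.1 (ha.trans hfi.symm)]; omega, hlin⟩
  | succ l ih =>
    intro i S f hi hf hfi hlin hS
    have hj : i.val + 1 < n := by omega
    obtain ⟨j, hij⟩ : ∃ j : Fin n, i.val + 1 = j.val := ⟨⟨i.val + 1, hj⟩, rfl⟩
    have hji : j ≠ i := fun h => by rw [h] at hij; omega
    have hjv : f j ≠ v := fun h => hji (hf.1 (h.trans hfi.symm))
    let f' : Fin n → V := f ∘ Equiv.swap i j
    have hf'i : f' i = f j := by simp [f']
    have hf'j : f' j = v := by simp [f', hfi]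
    have hf'a : ∀ a, a ≠ i → a ≠ j → f' a = f a := fun a h h' => by
      simp [f', Equiv.swap_apply_of_ne_of_ne h h']
    have hf' : Function.Bijective f' := hf.comp (Equiv.bijective _)
    have hlin' : ∀ a b, a < b → f' a ≠ v → f' b ≠ v → ¬ R (f' b) (f' a) := by
      intro a b hab ha hb
      have haj : a ≠ j := fun h => ha (h ▸ hf'j)
      have hbj : b ≠ j := fun h => hb (h ▸ hf'j)
      by_cases hai : a = i
      · have hbi : b ≠ i := fun h => by omega
        rw [hai, hf'i, hf'a b hbi hbj]
        rw [hf'a b hbi hbj] at hb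
        exact hlin j b (by omega) hjv hb
      · rw [hf'a a hai haj] at ha ⊢
        by_cases hbi : b = i
        · rw [hbi, hf'i]
          exact hlin a j (by omega) ha hjv
        · rw [hf'a b hbi hbj] at hb ⊢
          exact hlin a b hab ha hb
    have hmem : ∀ w, (∃ a, a < j ∧ f' a = w) ↔ w = f j ∨ ∃ a, a < i ∧ f a = w := by
      intro w
      constructor
      · rintro ⟨a, ha, rfl⟩
        by_cases hai : a = i
        · exact Or.inl (hai ▸ hf'i)
        · exact Or.inr ⟨a, by omega, (hf'a a hai (by omega)).symm⟩
      · rintro (rfl | ⟨a, ha, rfl⟩)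
        · exact ⟨i, by omega, hf'i⟩
        · exact ⟨a, by omega, hf'a a (by omega) (by omega)⟩
    -- Members of `N` are absorbed, all other elements are skipped.
    by_cases hu : f j ∈ N
    · have hjS : f j ∉ S := fun h => by
        obtain ⟨-, a, ha, h'⟩ := (hS _).1 h
        have := hf.1 h'
        omega
      obtain ⟨g, hg, hg'⟩ := ih j (insert (f j) S) f' (by omega) hf' hf'j hlin' fun w => by
        rw [Finset.mem_insert, hS, hmem]
        constructor
        · rintro (rfl | h)
          exacts [⟨hu, Or.inl rfl⟩, ⟨h.1, Or.inr h.2⟩]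
        · rintro ⟨hw, rfl | h⟩
          exacts [Or.inl rfl, Or.inr ⟨hw, h⟩]
      refine ⟨g, .head (.absorb S _ f f' i j hij hfi (fun _ => rfl) rfl (hvN _ hu).1 hjS ?_) hg, hg'⟩
      intro w hw hr
      have := h₃ _ w ((hS w).1 hw).1 (f j) hu hr (hrefl _)
      exact hjS (this ▸ hw)
    · obtain ⟨g, hg, hg'⟩ := ih j S f' (by omega) hf' hf'j hlin' fun w => by
        rw [hS, hmem]
        constructor
        · exact fun h => ⟨h.1, Or.inr h.2⟩
        · rintro ⟨hw, rfl | h⟩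
          exacts [absurd hw hu, ⟨hw, h⟩]
      refine ⟨g, .head (.skip S f f' i j hij hfi (fun _ => rfl) (fun hr => ?_) ?_) hg, hg'⟩
      -- The member of `N` with a relation to `f j` precedes it in the linear extension, hence has
      -- already been collected.
      · obtain ⟨w, hw, hwr⟩ := h₂ _ hjv hr
        refine ⟨w, (hS w).2 ⟨hw, ?_⟩, hwr⟩
        obtain ⟨a, rfl⟩ := hf.2 w
        refine ⟨a, ?_, rfl⟩
        have hai : a ≠ i := fun h => (hvN _ hw).2 (h ▸ hfi)
        have haj : a ≠ j := fun h => hu (h ▸ hw)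
        by_contra hlt
        exact hlin j a (by omega) hjv (hvN _ hw).2 hwr
      · exact fun w₁ hw₁ w₂ hw₂ => h₃ _ _ ((hS _).1 hw₁).1 _ ((hS _).1 hw₂).1

end SourceSlide

/-! ### Reachability of orientations by mutations -/

section Stage

variable (k : Type u) [Field k] {T : Type w} [Category.{v} T] [Preadditive T] [Linear k T]
  [HasZeroObject T] [HasShift T ℤ] [∀ n : ℤ, (shiftFunctor T n).Additive] [Pretriangulated T]
  [IsTriangulated T] [∀ n : ℤ, (shiftFunctor T n).Linear k] {n : ℕ}

/-- A thin collection for the relation `R`, listed in the order `f`, is obtained from the collection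
`E₀` by mutations. -/
def IsReachable {V : Type} (E₀ : Fin n → T) (R : V → V → Prop) (f : Fin n → V) : Prop :=
  ∃ (X : V → T) (E : Fin n → T), IsThin k R X ∧ Relation.ReflTransGen (MutationStep k) E₀ E ∧
    ∀ i, Nonempty (E i ≅ X (f i))

variable {k} {V : Type} [DecidableEq V] {E₀ : Fin n → T} {R : V → V → Prop} {f f' : Fin n → V}

omit [IsTriangulated T] [∀ n : ℤ, (shiftFunctor T n).Linear k] [DecidableEq V] in
lemma IsReachable.congr (h : IsReachable k E₀ R f) {R' : V → V → Prop}
    (h' : ∀ a b, R a b ↔ R' a b) : IsReachable k E₀ R' f := by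
  obtain rfl : R = R' := funext fun a => funext fun b => propext (h' a b)
  exact h

lemma IsReachable.flip (h : IsReachable k E₀ R f) (hrefl : ∀ x, R x x)
    (htrans : ∀ x y z, R x y → R y z → R x z) {v : V} {N : Finset V} (hN : IsFlippable R v N)
    (hv : ∀ w ∈ N, w ≠ v) (hf : Function.Injective f)
    (hs : Relation.ReflTransGen (SlideStep R v) (∅, f) (N, f')) :
    IsReachable k E₀ (flipRel R v N) f' := by
  obtain ⟨X, E, hX, hE, hE'⟩ := h
  obtain ⟨X', E', hX', hm, hE''⟩ := hX.exists_mutations_flip hrefl htrans hN hv hf hs hE'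
  exact ⟨X', E', hX', hE.trans hm, hE''⟩

lemma EdgeList.rel_refl {n m : ℕ} (t : EdgeList n m) (o : ℕ) (a : Fin n) : t.Rel o a a := by
  unfold EdgeList.Rel
  cases n - 1 <;> simp [EdgeList.reach]

/-- Sliding the source to the end of a linear extension flips it along its direct successors. The
flipped relation belongs to the reflected orientation, and the new order is a linear extension of
it, so the procedure can be iterated. -/
lemma EdgeList.IsTreeLike.isReachable_reverseAt {m : ℕ} {t : EdgeList n m} (ht : t.IsTreeLike)
    {E₀ : Fin n → T} {o : ℕ} (ho : o < 2 ^ m) {v : Fin n} (hv : t.IsSource o v)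
    (h : ∃ f : Fin n → Fin n, Function.Bijective f ∧ (∀ i j, i < j → ¬ t.Rel o (f j) (f i)) ∧
      IsReachable k E₀ (t.Rel o) f) :
    ∃ f : Fin n → Fin n, Function.Bijective f ∧
      (∀ i j, i < j → ¬ t.Rel (t.reverseAt o v) (f j) (f i)) ∧
      IsReachable k E₀ (t.Rel (t.reverseAt o v)) f := by
  obtain ⟨f, hf, hlin, h⟩ := h
  have mem_next (w : Fin n) : w ∈ t.next o v ↔ t.arrow o v w = true := by simp [EdgeList.next]
  have last {l : ℕ} {a b : Fin n} (h : t.reach o l a b = true) : a = b ∨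
      ∃ c, t.arrow o c b = true := by
    cases l with
    | zero => exact Or.inl (by simpa [EdgeList.reach] using h)
    | succ l =>
      simp only [EdgeList.reach, Bool.or_eq_true, beq_iff_eq, List.any_eq_true,
        Bool.and_eq_true] at h
      exact h.imp id fun ⟨c, _, h, _⟩ => ⟨c, h⟩
  -- `reach` peels off the last arrow of a path; what is needed here is the first arrow, through a
  -- direct successor of `v`.
  have first {l : ℕ} : ∀ {b : Fin n}, t.reach o l v b = true → v = b ∨
      ∃ c ∈ t.next o v, t.Rel o c b := by
    induction l with
    | zero => exact fun h => Or.inl (by simpa [EdgeList.reach] using h)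
    | succ l ih =>
      intro b h
      simp only [EdgeList.reach, Bool.or_eq_true, beq_iff_eq, List.any_eq_true,
        Bool.and_eq_true] at h
      rcases h with h | ⟨c, -, hc, h⟩
      · exact Or.inl h
      · right
        rcases ih h with rfl | ⟨d, hd, hr⟩
        · exact ⟨b, (mem_next b).2 hc, t.rel_refl o b⟩
        · exact ⟨d, hd, ht.trans o ho _ _ _ hr (ht.rel_of_arrow o ho _ _ hc)⟩
  have hsource : ∀ u, u ≠ v → ¬ t.Rel o u v := fun u hu h => by
    rcases last h with h | ⟨c, hc⟩
    · exact hu h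
    · rw [hv c] at hc
      exact Bool.false_ne_true hc
  have hvN : ∀ w ∈ t.next o v, t.Rel o v w ∧ w ≠ v := fun w hw => by
    refine ⟨ht.rel_of_arrow o ho _ _ ((mem_next w).1 hw), fun h => ?_⟩
    have := (mem_next w).1 hw
    rw [h, hv v] at this
    exact Bool.false_ne_true this
  have h₂ : ∀ u, u ≠ v → t.Rel o v u → ∃ w ∈ t.next o v, t.Rel o w u := fun u hu h =>
    (first h).resolve_left hu.symm
  have h₃ : ∀ u, ∀ w₁ ∈ t.next o v, ∀ w₂ ∈ t.next o v, t.Rel o w₁ u → t.Rel o w₂ u → w₁ = w₂ :=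
    fun u w₁ hw₁ w₂ hw₂ => ht.eq_of_next_rel o ho v hv u w₁ w₂ ((mem_next _).1 hw₁)
      ((mem_next _).1 hw₂)
  obtain ⟨i, hi⟩ := hf.2 v
  obtain ⟨f', hs, hf', hlast, hlin'⟩ := exists_slide_to_end (t.rel_refl o) hvN h₂ h₃
    (n - 1 - i.val) i ∅ f (by omega) hf hi (fun a b hab _ _ => hlin a b hab) fun w => by
      simp only [Finset.notMem_empty, false_iff, not_and, not_exists]
      rintro hw a hai rfl
      exact hlin a i hai (hi ▸ (hvN _ hw).1)
  refine ⟨f', hf', fun a b hab => ?_, ?_⟩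
  -- After the flip `v` is a sink and stands last, so the order is again a linear extension.
  · rw [← ht.flipRel_iff o ho v hv]
    rintro (⟨h, h'⟩ | ⟨h, h', w₁, hw₁, w₂, hw₂, hne, r₁, r₂⟩ | ⟨h, h', -⟩ | ⟨h, h', hr⟩)
    · have := hf'.1 (h.trans h'.symm)
      omega
    · exact hne (h₃ _ w₁ hw₁ w₂ hw₂ r₁ r₂)
    · have := hlast a h'
      omega
    · exact hlin' a b hab h' h hr
  · refine (h.flip (t.rel_refl o) (ht.trans o ho) (.of_source (t.rel_refl o) hsource
      (ht.next_nonempty o ho v hv) (fun w hw => (hvN w hw).1) (fun u hu w₁ hw₁ w₂ hw₂ =>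
        ht.eq_of_rel_next o ho v hv u w₁ w₂ hu ((mem_next _).1 hw₁) ((mem_next _).1 hw₂)) h₂ h₃)
      (fun w hw => (hvN w hw).2) hf.1 hs).congr (ht.flipRel_iff o ho v hv)

/-- All orientations of a tree are reachable from one of them. -/
lemma EdgeList.IsTreeLike.isReachable_of_rank {m : ℕ} {t : EdgeList n m} (ht : t.IsTreeLike)
    {E₀ : Fin n → T} {o₀ : ℕ} (rank : ℕ → ℕ) (hrank : ∀ o < 2 ^ m, o = o₀ ∨
      ∃ v, t.IsSource (t.reverseAt o v) v ∧ rank (t.reverseAt o v) < rank o)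
    (h : ∃ f : Fin n → Fin n, Function.Bijective f ∧ (∀ i j, i < j → ¬ t.Rel o₀ (f j) (f i)) ∧
      IsReachable k E₀ (t.Rel o₀) f) (o : ℕ) (ho : o < 2 ^ m) :
    ∃ f : Fin n → Fin n, Function.Bijective f ∧ (∀ i j, i < j → ¬ t.Rel o (f j) (f i)) ∧
      IsReachable k E₀ (t.Rel o) f := by
  induction hr : rank o using Nat.strong_induction_on generalizing o with
  | _ r ih =>
    rcases hrank o ho with rfl | ⟨v, hv, hlt⟩
    · exact h
    -- The step is applied to the orientation of smaller rank; reversing twice at `v` gives back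
    -- `o`.
    · have := ht.isReachable_reverseAt (ht.reverseAt_lt o ho v) hv
        (ih _ (hr ▸ hlt) _ (ht.reverseAt_lt o ho v) rfl)
      rwa [ht.reverseAt_reverseAt o ho v] at this

end Stage

/-! ### The flips which turn the two grids into trees -/

/-- The componentwise order on the positions of points of a grid. -/
def gridRel {n : ℕ} (pos : Fin n → ℕ × ℕ) (a b : Fin n) : Prop :=
  (pos a).1 ≤ (pos b).1 ∧ (pos a).2 ≤ (pos b).2

instance {n : ℕ} (pos : Fin n → ℕ × ℕ) : DecidableRel (gridRel pos) := fun _ _ =>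
  inferInstanceAs (Decidable (_ ∧ _))

/-- A labelling of the points of the square, for which it is transformed into a tree. -/
def squarePos : Fin 4 → ℕ × ℕ := ![(1, 0), (0, 0), (0, 1), (1, 1)]

/-- A labelling of the points of the `3 × 2` grid, for which it is transformed into a tree. -/
def gridPos : Fin 6 → ℕ × ℕ := ![(2, 0), (1, 1), (1, 0), (0, 1), (0, 0), (2, 1)]

lemma gridRel_refl {n : ℕ} (pos : Fin n → ℕ × ℕ) (a : Fin n) : gridRel pos a a :=
  ⟨le_rfl, le_rfl⟩

lemma gridRel_trans {n : ℕ} (pos : Fin n → ℕ × ℕ) (a b c : Fin n) (h : gridRel pos a b)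
    (h' : gridRel pos b c) : gridRel pos a c :=
  ⟨h.1.trans h'.1, h.2.trans h'.2⟩

set_option synthInstance.maxSize 1000 in
set_option synthInstance.maxHeartbeats 200000 in
lemma squareRel_isFlippable : IsFlippable (gridRel squarePos) 1 {0, 2} := by
  constructor <;> decide

lemma squareRel_slide : Relation.ReflTransGen (SlideStep (gridRel squarePos) 1)
    (∅, ![1, 0, 2, 3]) ({0, 2}, ![0, 2, 1, 3]) :=
  .head (.absorb ∅ {0} _ ![0, 1, 2, 3] 0 1 rfl rfl (by decide) (by decide) (by decide) (by decide)
    (by decide)) <|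
  .head (.absorb {0} {0, 2} _ ![0, 2, 1, 3] 1 2 rfl rfl (by decide) (by decide) (by decide)
    (by decide) (by decide)) .refl

/-- The minimum `1` of the square is replaced by the cone of the map to its two covers `0` and `2`.
It moves to the centre: the arrows become `0 → 1`, `2 → 1`, `1 → 3`. -/
lemma flipRel_square : ∀ a b,
    flipRel (gridRel squarePos) 1 {0, 2} a b ↔ edgeListD4.Rel 7 a b := by
  decide +kernel

/-- The relation obtained from the grid by the first flip. -/
abbrev gridRel₁ : Fin 6 → Fin 6 → Prop := flipRel (gridRel gridPos) 4 {2, 3}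

/-- The relation obtained from the grid by the first two flips. -/
abbrev gridRel₂ : Fin 6 → Fin 6 → Prop := flipRel gridRel₁ 2 {0, 4}

/-- The relation obtained from the grid by the first three flips. -/
abbrev gridRel₃ : Fin 6 → Fin 6 → Prop := flipRel gridRel₂ 4 {1, 2}

set_option synthInstance.maxSize 1000 in
set_option synthInstance.maxHeartbeats 200000 in
lemma gridRel_isFlippable : IsFlippable (gridRel gridPos) 4 {2, 3} := by
  constructor <;> decide +kernel

set_option synthInstance.maxSize 1000 in
set_option synthInstance.maxHeartbeats 200000 in
lemma gridRel₁_isFlippable : IsFlippable gridRel₁ 2 {0, 4} := by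
  constructor <;> decide +kernel

-- This is the only flip at a vertex that is not a source: `3` lies above `4`, and the condition for
-- such a vertex holds because exactly two elements are collected.
set_option synthInstance.maxSize 1000 in
set_option synthInstance.maxHeartbeats 200000 in
lemma gridRel₂_isFlippable : IsFlippable gridRel₂ 4 {1, 2} := by
  constructor <;> decide +kernel

set_option synthInstance.maxSize 1000 in
set_option synthInstance.maxHeartbeats 200000 in
lemma gridRel₃_isFlippable : IsFlippable gridRel₃ 3 {1, 2} := by
  constructor <;> decide +kernel

lemma gridRel_slide : Relation.ReflTransGen (SlideStep (gridRel gridPos) 4)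
    (∅, ![4, 3, 2, 0, 1, 5]) ({2, 3}, ![3, 2, 4, 0, 1, 5]) :=
  .head (.absorb ∅ {3} _ ![3, 4, 2, 0, 1, 5] 0 1 rfl rfl (by decide) (by decide) (by decide)
    (by decide) (by decide)) <|
  .head (.absorb {3} {2, 3} _ _ 1 2 rfl rfl (by decide) (by decide) (by decide)
    (by decide) (by decide)) .refl

lemma gridRel₁_slide : Relation.ReflTransGen (SlideStep gridRel₁ 2)
    (∅, ![3, 2, 4, 0, 1, 5]) ({0, 4}, ![3, 4, 0, 2, 1, 5]) :=
  .head (.absorb ∅ {4} _ ![3, 4, 2, 0, 1, 5] 1 2 rfl rfl (by decide) (by decide) (by decide +kernel)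
    (by decide) (by decide)) <|
  .head (.absorb {4} {0, 4} _ _ 2 3 rfl rfl (by decide) (by decide) (by decide +kernel)
    (by decide) (by decide +kernel)) .refl

lemma gridRel₂_slide : Relation.ReflTransGen (SlideStep gridRel₂ 4)
    (∅, ![3, 4, 0, 2, 1, 5]) ({1, 2}, ![3, 0, 2, 1, 4, 5]) :=
  .head (.skip ∅ _ ![3, 0, 4, 2, 1, 5] 1 2 rfl rfl (by decide) (by decide +kernel)
    (by decide +kernel)) <|
  .head (.absorb ∅ {2} _ ![3, 0, 2, 4, 1, 5] 2 3 rfl rfl (by decide) (by decide) (by decide +kernel)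
    (by decide) (by decide +kernel)) <|
  .head (.absorb {2} {1, 2} _ _ 3 4 rfl rfl (by decide) (by decide) (by decide +kernel)
    (by decide) (by decide +kernel)) .refl

lemma gridRel₃_slide : Relation.ReflTransGen (SlideStep gridRel₃ 3)
    (∅, ![3, 0, 2, 1, 4, 5]) ({1, 2}, ![0, 2, 1, 3, 4, 5]) :=
  .head (.skip ∅ _ ![0, 3, 2, 1, 4, 5] 0 1 rfl rfl (by decide) (by decide +kernel)
    (by decide +kernel)) <|
  .head (.absorb ∅ {2} _ ![0, 2, 3, 1, 4, 5] 1 2 rfl rfl (by decide) (by decide) (by decide +kernel)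
    (by decide) (by decide +kernel)) <|
  .head (.absorb {2} {1, 2} _ _ 2 3 rfl rfl (by decide) (by decide) (by decide +kernel)
    (by decide) (by decide +kernel)) .refl

/-- The covering relations after the successive flips are: `3→4, 2→4, 2→0, 4→1, 1→5, 0→5`; then
`3→4, 4→1, 4→2, 0→2, 1→5, 2→5`; then `3→1, 3→2, 0→2, 1→4, 2→4, 4→5`; and finally `0→2, 2→3, 1→3,
3→4, 4→5`, which is `E₆` with all five bits set. -/
lemma flipRel_gridRel₃ : ∀ a b, flipRel gridRel₃ 3 {1, 2} a b ↔ edgeListE6.Rel 31 a b := by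
  decide +kernel

section Stage

variable {k : Type u} [Field k] {T : Type w} [Category.{v} T] [Preadditive T] [Linear k T]
  [HasZeroObject T] [HasShift T ℤ] [∀ n : ℤ, (shiftFunctor T n).Additive] [Pretriangulated T]
  [IsTriangulated T] [∀ n : ℤ, (shiftFunctor T n).Linear k]

theorem isReachable_edgeListD4 {X : Fin 4 → T} (hX : IsThin k (gridRel squarePos) X)
    (o : ℕ) (ho : o < 2 ^ 3) :
    ∃ f : Fin 4 → Fin 4, Function.Bijective f ∧ (∀ i j, i < j → ¬ edgeListD4.Rel o (f j) (f i)) ∧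
      IsReachable k (fun i => X (![1, 0, 2, 3] i)) (edgeListD4.Rel o) f := by
  have h₀ : IsReachable k (fun i => X (![1, 0, 2, 3] i)) (gridRel squarePos) ![1, 0, 2, 3] :=
    ⟨X, _, hX, .refl, fun _ => ⟨Iso.refl _⟩⟩
  have h₁ := (h₀.flip (gridRel_refl _) (gridRel_trans _) squareRel_isFlippable (by decide)
    (by decide) squareRel_slide).congr flipRel_square
  exact edgeListD4_isTreeLike.isReachable_of_rank rankD4 edgeListD4_rank
    ⟨_, by decide, by decide +kernel, h₁⟩ o ho

theorem isReachable_edgeListE6 {X : Fin 6 → T} (hX : IsThin k (gridRel gridPos) X)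
    (o : ℕ) (ho : o < 2 ^ 5) :
    ∃ f : Fin 6 → Fin 6, Function.Bijective f ∧ (∀ i j, i < j → ¬ edgeListE6.Rel o (f j) (f i)) ∧
      IsReachable k (fun i => X (![4, 3, 2, 0, 1, 5] i)) (edgeListE6.Rel o) f := by
  have h₀ : IsReachable k (fun i => X (![4, 3, 2, 0, 1, 5] i)) (gridRel gridPos)
    ![4, 3, 2, 0, 1, 5] := ⟨X, _, hX, .refl, fun _ => ⟨Iso.refl _⟩⟩
  have h₁ := h₀.flip (gridRel_refl _) (gridRel_trans _) gridRel_isFlippable (by decide)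
    (by decide) gridRel_slide
  have h₂ := h₁.flip (by decide +kernel) (by decide +kernel) gridRel₁_isFlippable (by decide)
    (by decide) gridRel₁_slide
  have h₃ := h₂.flip (by decide +kernel) (by decide +kernel) gridRel₂_isFlippable (by decide)
    (by decide) gridRel₂_slide
  have h₄ := (h₃.flip (by decide +kernel) (by decide +kernel) gridRel₃_isFlippable (by decide)
    (by decide) gridRel₃_slide).congr flipRel_gridRel₃
  exact edgeListE6_isTreeLike.isReachable_of_rank rankE6 edgeListE6_rank
    ⟨_, by decide, by decide +kernel, h₄⟩ o ho

end Stage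

/-! ### Incidence algebras -/

/-- A basis of an algebra indexed by the pairs of a relation, which multiplies like the standard
basis of the incidence algebra of a partial order: the product of the basis vectors at `(v, w)` and
`(u, v)` is the basis vector at `(u, w)`. -/
structure IncidenceBasis (k : Type u) [Field k] (C : Type*) [Ring C] [Algebra k C] {V : Type*}
    [Fintype V] (R : V → V → Prop) where
  refl : ∀ x, R x x
  trans : ∀ {x y z}, R x y → R y z → R x z
  /-- The basis. -/
  basis : Module.Basis {p : V × V // R p.1 p.2} k C
  mul_of_eq : ∀ {x y z : V} (h : R x y) (h' : R y z),
    basis ⟨(y, z), h'⟩ * basis ⟨(x, y), h⟩ = basis ⟨(x, z), trans h h'⟩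
  mul_of_ne : ∀ {x y y' z : V} (h : R x y) (h' : R y' z), y ≠ y' →
    basis ⟨(y', z), h'⟩ * basis ⟨(x, y), h⟩ = 0
  sum_eq_one : ∑ x, basis ⟨(x, x), refl x⟩ = 1

namespace IncidenceBasis

variable {k : Type u} [Field k]

/-- Relabelling of an incidence basis. -/
def reindex {C : Type*} [Ring C] [Algebra k C] {V W : Type*} [Fintype V] [Fintype W]
    {R : V → V → Prop} (b : IncidenceBasis k C R) (e : W ≃ V) (S : W → W → Prop)
    (h : ∀ x y, S x y ↔ R (e x) (e y)) : IncidenceBasis k C S where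
  refl x := (h x x).2 (b.refl _)
  trans h₁ h₂ := (h _ _).2 (b.trans ((h _ _).1 h₁) ((h _ _).1 h₂))
  basis := b.basis.reindex ((Equiv.subtypeEquiv (Equiv.prodCongr e e) fun p => h p.1 p.2).symm)
  mul_of_eq h₁ h₂ := by
    simp only [Module.Basis.reindex_apply, Equiv.symm_symm]
    exact b.mul_of_eq ((h _ _).1 h₁) ((h _ _).1 h₂)
  mul_of_ne h₁ h₂ hne := by
    simp only [Module.Basis.reindex_apply, Equiv.symm_symm]
    exact b.mul_of_ne ((h _ _).1 h₁) ((h _ _).1 h₂) (fun h => hne (e.injective h))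
  sum_eq_one := by
    rw [← b.sum_eq_one]
    simp only [Module.Basis.reindex_apply, Equiv.symm_symm]
    exact Fintype.sum_equiv e _ _ fun x => rfl

/-- The tensor product of two incidence bases. -/
def tensor {C D : Type*} [Ring C] [Algebra k C] [Ring D] [Algebra k D] {V W : Type*} [Fintype V]
    [Fintype W] {R : V → V → Prop} {S : W → W → Prop} (b : IncidenceBasis k C R)
    (c : IncidenceBasis k D S) :
    IncidenceBasis k (C ⊗[k] D) fun x y : V × W => R x.1 y.1 ∧ S x.2 y.2 where
  refl x := ⟨b.refl _, c.refl _⟩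
  trans h₁ h₂ := ⟨b.trans h₁.1 h₂.1, c.trans h₁.2 h₂.2⟩
  basis := (b.basis.tensorProduct c.basis).reindex
    { toFun := fun p => ⟨((p.1.1.1, p.2.1.1), (p.1.1.2, p.2.1.2)), p.1.2, p.2.2⟩
      invFun := fun p => (⟨(p.1.1.1, p.1.2.1), p.2.1⟩, ⟨(p.1.1.2, p.1.2.2), p.2.2⟩)
      left_inv := fun _ => rfl
      right_inv := fun _ => rfl }
  mul_of_eq h₁ h₂ := by
    simp only [Module.Basis.reindex_apply, Module.Basis.tensorProduct_apply']
    exact (Algebra.TensorProduct.tmul_mul_tmul _ _ _ _).trans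
      (congrArg₂ (· ⊗ₜ[k] ·) (b.mul_of_eq h₁.1 h₂.1) (c.mul_of_eq h₁.2 h₂.2))
  mul_of_ne {x y y' z} h₁ h₂ hne := by
    simp only [Module.Basis.reindex_apply, Module.Basis.tensorProduct_apply']
    refine (Algebra.TensorProduct.tmul_mul_tmul _ _ _ _).trans ?_
    by_cases h : y.1 = y'.1
    · refine (congrArg (_ ⊗ₜ[k] ·) (c.mul_of_ne h₁.2 h₂.2 fun h' => hne (Prod.ext h h'))).trans ?_
      exact TensorProduct.tmul_zero _ _
    · exact (congrArg (· ⊗ₜ[k] _) (b.mul_of_ne h₁.1 h₂.1 h)).trans (TensorProduct.zero_tmul _ _)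
  sum_eq_one := by
    rw [Algebra.TensorProduct.one_def, ← b.sum_eq_one, ← c.sum_eq_one, TensorProduct.sum_tmul,
      Fintype.sum_prod_type]
    simp only [TensorProduct.tmul_sum]
    refine Finset.sum_congr rfl fun x _ => Finset.sum_congr rfl fun y _ => ?_
    simp only [Module.Basis.reindex_apply, Module.Basis.tensorProduct_apply']
    rfl

end IncidenceBasis


/-- The basis of the path algebra given by the paths. -/
def PathAlgebra.pathBasis (k : Type u) [Field k] (Γ : Type u₁) [Quiver.{v₁} Γ] :
    Module.Basis (QuiverPath Γ) k (PathAlgebra k Γ) :=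
  .ofRepr (LinearEquiv.refl k (QuiverPath Γ →₀ k))

/-- A quiver in which paths are unique has one path for every pair of vertices joined by a path. -/
def QuiverPath.equivSubtype (Γ : Type u₁) [Quiver.{v₁} Γ]
    [h : ∀ a b : Γ, Subsingleton (Quiver.Path a b)] :
    QuiverPath Γ ≃ {p : Γ × Γ // Nonempty (Quiver.Path p.1 p.2)} where
  toFun p := ⟨(p.1, p.2.1), ⟨p.2.2⟩⟩
  invFun p := ⟨p.1.1, p.1.2, p.2.some⟩
  left_inv := fun ⟨a, b, _⟩ => congrArg (fun q => (⟨a, b, q⟩ : QuiverPath Γ)) (Subsingleton.elim _ _)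
  right_inv := fun _ => rfl

/-- The incidence basis of the path algebra of a quiver in which paths are unique. -/
def PathAlgebra.incidenceBasis (k : Type u) [Field k] (Γ : Type u₁) [Quiver.{v₁} Γ] [Fintype Γ]
    [h : ∀ a b : Γ, Subsingleton (Quiver.Path a b)] :
    IncidenceBasis k (PathAlgebra k Γ) fun a b : Γ => Nonempty (Quiver.Path a b) :=
  have hb {x y : Γ} (p : Quiver.Path x y) :
      (pathBasis k Γ).reindex (QuiverPath.equivSubtype Γ) ⟨(x, y), ⟨p⟩⟩ = ofPath k ⟨x, y, p⟩ := by
    rw [Module.Basis.reindex_apply]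
    exact congrArg (pathBasis k Γ) ((QuiverPath.equivSubtype Γ).symm_apply_apply ⟨x, y, p⟩)
  { refl := fun _ => ⟨.nil⟩
    trans := fun ⟨p⟩ ⟨q⟩ => ⟨p.comp q⟩
    basis := (pathBasis k Γ).reindex (QuiverPath.equivSubtype Γ)
    mul_of_eq := fun ⟨p⟩ ⟨q⟩ => by
      rw [hb p, hb q, hb (p.comp q), ofPath_mul_ofPath_of_eq]
    mul_of_ne := fun ⟨p⟩ ⟨q⟩ hne => by
      rw [hb p, hb q, ofPath_mul_ofPath_of_ne hne]
    sum_eq_one := by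
      rw [one_def]
      exact Finset.sum_congr rfl fun x _ => hb .nil }

/-- Paths are unique in a quiver without multiple arrows in which two arrows with the same target
never have sources which are reached from the same vertex. -/
lemma Quiver.Path.subsingleton_of_unique_arrow {Γ : Type u₁} [Quiver.{v₁} Γ]
    [∀ a b : Γ, Subsingleton (a ⟶ b)]
    (h : ∀ a b c c' : Γ, Nonempty (Quiver.Path a c) → Nonempty (c ⟶ b) →
      Nonempty (Quiver.Path a c') → Nonempty (c' ⟶ b) → c = c')
    (h' : ∀ a b : Γ, Nonempty (a ⟶ b) → IsEmpty (Quiver.Path b a)) (a b : Γ) :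
    Subsingleton (Quiver.Path a b) := by
  refine ⟨fun p => ?_⟩
  induction p with
  | nil =>
    intro q
    cases q with
    | nil => rfl
    | cons q f => exact ((h' _ _ ⟨f⟩).false q).elim
  | cons p f ih =>
    intro q
    cases q with
    | nil => exact ((h' _ _ ⟨f⟩).false p).elim
    | cons q g =>
      obtain rfl := h _ _ _ _ ⟨p⟩ ⟨f⟩ ⟨q⟩ ⟨g⟩
      rw [ih q, Subsingleton.elim f g]

namespace LinearQuiver

variable {m : ℕ}

instance (a b : LinearQuiver m) : Subsingleton (a ⟶ b) :=
  inferInstanceAs (Subsingleton (PLift _))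

lemma val_le_of_path {a b : LinearQuiver m} (p : Quiver.Path a b) : a.val ≤ b.val := by
  induction p with
  | nil => rfl
  | cons p f ih =>
    have := f.down
    rw [Fin.le_def] at ih ⊢
    omega

lemma nonempty_path_iff (a b : LinearQuiver m) : Nonempty (Quiver.Path a b) ↔ a.val ≤ b.val := by
  refine ⟨fun ⟨p⟩ => val_le_of_path p, ?_⟩
  obtain ⟨b, hb⟩ := b
  induction b with
  | zero =>
    intro h
    obtain rfl : a = ⟨⟨0, hb⟩⟩ := by
      cases a; congr; ext; simpa [Fin.le_def] using h
    exact ⟨.nil⟩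
  | succ b ih =>
    intro h
    rcases (Fin.le_def.1 h).lt_or_eq with h | h
    · obtain ⟨p⟩ := ih (by omega) (by simp only [Fin.le_def] at h ⊢; omega)
      exact ⟨p.cons ⟨rfl⟩⟩
    · obtain rfl : a = ⟨⟨b + 1, hb⟩⟩ := by
        cases a; congr; ext; exact h
      exact ⟨.nil⟩

instance (a b : LinearQuiver m) : Subsingleton (Quiver.Path a b) :=
  Quiver.Path.subsingleton_of_unique_arrow
    (fun a b c c' _ ⟨f⟩ _ ⟨g⟩ => by
      obtain ⟨f⟩ := f
      obtain ⟨g⟩ := g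
      obtain ⟨c⟩ := c
      obtain ⟨c'⟩ := c'
      congr
      ext
      exact Nat.succ_injective (f.trans g.symm))
    (fun a b ⟨f⟩ => ⟨fun p => by
      have := f.down
      have := Fin.le_def.1 (val_le_of_path p)
      omega⟩) a b

end LinearQuiver

/-- The incidence basis of the path algebra of the quiver `0 → 1 → ⋯ → m - 1`. -/
def LinearPathAlgebra.incidenceBasis (k : Type u) [Field k] (m : ℕ) :
    IncidenceBasis k (LinearPathAlgebra k m) fun a b : Fin m => a ≤ b :=
  (PathAlgebra.incidenceBasis k (LinearQuiver m)).reindex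
    ⟨LinearQuiver.mk, LinearQuiver.val, fun _ => rfl, fun _ => rfl⟩ _
    fun _ _ => (LinearQuiver.nonempty_path_iff _ _).symm

/-- The algebra `B₂ ⊗ B₂` as the incidence algebra of a square. -/
def incidenceBasisSquare (k : Type u) [Field k] :
    IncidenceBasis k (LinearPathAlgebra k 2 ⊗[k] LinearPathAlgebra k 2) (gridRel squarePos) :=
  ((LinearPathAlgebra.incidenceBasis k 2).tensor (LinearPathAlgebra.incidenceBasis k 2)).reindex
    (Equiv.ofBijective ![(1, 0), (0, 0), (0, 1), (1, 1)] (by decide)) _ (by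
      simp only [Equiv.ofBijective_apply, gridRel]
      decide)

/-- The algebra `B₃ ⊗ B₂` as the incidence algebra of a grid. -/
def incidenceBasisGrid (k : Type u) [Field k] :
    IncidenceBasis k (LinearPathAlgebra k 3 ⊗[k] LinearPathAlgebra k 2) (gridRel gridPos) :=
  ((LinearPathAlgebra.incidenceBasis k 3).tensor (LinearPathAlgebra.incidenceBasis k 2)).reindex
    (Equiv.ofBijective ![(2, 0), (1, 1), (1, 0), (0, 1), (0, 0), (2, 1)] (by decide)) _ (by
      simp only [Equiv.ofBijective_apply, gridRel]
      decide)

/-! ### Quivers of Dynkin type -/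

namespace EdgeList

variable {n m : ℕ} (t : EdgeList n m)

lemma arrow_iff (o : ℕ) (a b : Fin n) : t.arrow o a b = true ↔
    ∃ x : Fin m, (o.testBit x = true ∧ t.src x = a ∧ t.tgt x = b) ∨
      (o.testBit x = false ∧ t.src x = b ∧ t.tgt x = a) := by
  simp only [arrow, List.any_eq_true, List.mem_finRange, true_and]
  refine exists_congr fun x => ?_
  cases o.testBit x <;> simp

variable {Γ : Type u₁} [Quiver.{v₁} Γ] {o : ℕ} {e : Γ ≃ Fin n}

lemma nonempty_path_of_reach (h : ∀ a b, Nonempty (a ⟶ b) ↔ t.arrow o (e a) (e b) = true) (l : ℕ)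
    {a b : Fin n} (hab : t.reach o l a b = true) :
    Nonempty (Quiver.Path (e.symm a) (e.symm b)) := by
  induction l generalizing b with
  | zero =>
    obtain rfl : a = b := by simpa [reach] using hab
    exact ⟨.nil⟩
  | succ l ih =>
    simp only [reach, Bool.or_eq_true, beq_iff_eq, List.any_eq_true, Bool.and_eq_true] at hab
    rcases hab with rfl | ⟨c, -, hc, hac⟩
    · exact ⟨.nil⟩
    · obtain ⟨p⟩ := ih hac
      obtain ⟨f⟩ := (h (e.symm c) (e.symm b)).2 (by simpa using hc)
      exact ⟨p.cons f⟩

variable {t}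

lemma IsTreeLike.nonempty_path_iff (ht : t.IsTreeLike) (ho : o < 2 ^ m)
    (h : ∀ a b, Nonempty (a ⟶ b) ↔ t.arrow o (e a) (e b) = true) (a b : Γ) :
    Nonempty (Quiver.Path a b) ↔ t.Rel o (e a) (e b) := by
  refine ⟨fun hp => ?_, fun hab => by simpa using t.nonempty_path_of_reach h _ hab⟩
  obtain ⟨p⟩ := hp
  induction p with
  | nil => exact t.rel_refl _ _
  | cons p f ih => exact ht.trans o ho _ _ _ ih (ht.rel_of_arrow o ho _ _ ((h _ _).1 ⟨f⟩))

lemma IsTreeLike.subsingleton_path [∀ a b : Γ, Subsingleton (a ⟶ b)] (ht : t.IsTreeLike)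
    (ho : o < 2 ^ m) (h : ∀ a b, Nonempty (a ⟶ b) ↔ t.arrow o (e a) (e b) = true) (a b : Γ) :
    Subsingleton (Quiver.Path a b) := by
  refine Quiver.Path.subsingleton_of_unique_arrow (fun a b c c' h₁ h₂ h₃ h₄ => ?_)
    (fun a b f => ⟨fun p => ?_⟩) a b
  · rw [ht.nonempty_path_iff ho h] at h₁ h₃
    rw [h] at h₂ h₄
    exact e.injective (ht.eq_of_arrow o ho _ _ _ _ h₁ h₂ h₃ h₄)
  · exact ht.not_rel_of_arrow o ho _ _ ((h _ _).1 f) ((ht.nonempty_path_iff ho h _ _).1 ⟨p⟩)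

variable (t) in
/-- A Cartan matrix describes the graph of an edge list. -/
structure IsDiagramOf (C : Matrix (Fin n) (Fin n) ℤ) : Prop where
  src_ne_tgt : ∀ x, t.src x ≠ t.tgt x
  edge : ∀ x, C (t.src x) (t.tgt x) = -1
  eq_zero : ∀ a b, a ≠ b → C a b = 0 ∨
    ∃ x, (t.src x = a ∧ t.tgt x = b) ∨ (t.src x = b ∧ t.tgt x = a)

/-- An edge carries exactly one arrow in total, so its direction is one bit: whether it follows the
reference orientation. Pairs that are not edges carry no arrow. -/
lemma IsDiagramOf.exists_orientation {C : Matrix (Fin n) (Fin n) ℤ} (hC : t.IsDiagramOf C)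
    (hΓ : IsOfDynkinType C Γ) : ∃ (e : Γ ≃ Fin n) (o : ℕ), o < 2 ^ m ∧
      (∀ a b : Γ, Subsingleton (a ⟶ b)) ∧
      ∀ a b : Γ, Nonempty (a ⟶ b) ↔ t.arrow o (e a) (e b) = true := by
  classical
  obtain ⟨e, hfin, hempty, hcard⟩ := hΓ
  have hedge (x : Fin m) : Nat.card (e.symm (t.src x) ⟶ e.symm (t.tgt x)) +
      Nat.card (e.symm (t.tgt x) ⟶ e.symm (t.src x)) = 1 := by
    have := hcard (e.symm (t.src x)) (e.symm (t.tgt x)) (by simpa using hC.src_ne_tgt x)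
    simp only [Equiv.apply_symm_apply, hC.edge] at this
    omega
  have hzero (a b : Γ) (hab : a ≠ b) (h0 : C (e a) (e b) = 0) : Nat.card (a ⟶ b) = 0 := by
    have := hcard a b hab
    omega
  let o := Nat.ofBits fun x : Fin m =>
    decide (Nonempty (e.symm (t.src x) ⟶ e.symm (t.tgt x)))
  have ho (x : Fin m) : o.testBit x = true ↔ Nonempty (e.symm (t.src x) ⟶ e.symm (t.tgt x)) := by
    rw [Nat.testBit_ofBits_lt _ _ x.2]
    simp
  have ho' (x : Fin m) : o.testBit x = false ↔ Nonempty (e.symm (t.tgt x) ⟶ e.symm (t.src x)) := by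
    rw [← Bool.not_eq_true, ho, ← not_iff_not, not_not, not_nonempty_iff]
    have h1 := hedge x
    constructor
    · intro h
      have := Nat.card_pos (α := e.symm (t.src x) ⟶ e.symm (t.tgt x))
      exact (Finite.card_eq_zero_iff).1 (by omega)
    · intro h
      have := Nat.card_of_isEmpty (α := e.symm (t.tgt x) ⟶ e.symm (t.src x))
      exact Finite.card_pos_iff.1 (by omega)
  refine ⟨e, o, Nat.ofBits_lt_two_pow _, fun a b => ?_, fun a b => ?_⟩
  · by_cases hab : a = b
    · subst hab
      exact ⟨fun f => ((hempty a).false f).elim⟩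
    rw [← Finite.card_le_one_iff_subsingleton]
    rcases hC.eq_zero (e a) (e b) (by simpa using hab) with h0 | ⟨x, ⟨h₁, h₂⟩ | ⟨h₁, h₂⟩⟩
    · exact (hzero a b hab h0).trans_le zero_le_one
    · have := hedge x
      simp only [h₁, h₂, Equiv.symm_apply_apply] at this
      omega
    · have := hedge x
      simp only [h₁, h₂, Equiv.symm_apply_apply] at this
      omega
  · rw [arrow_iff]
    constructor
    · rintro ⟨f⟩
      have hab : a ≠ b := by
        rintro rfl
        exact (hempty a).false f
      rcases hC.eq_zero (e a) (e b) (by simpa using hab) with h0 | ⟨x, ⟨h₁, h₂⟩ | ⟨h₁, h₂⟩⟩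
      · exact ((Finite.card_eq_zero_iff.1 (hzero a b hab h0)).false f).elim
      · exact ⟨x, .inl ⟨(ho x).2 (by simpa [h₁, h₂] using ⟨f⟩), h₁, h₂⟩⟩
      · exact ⟨x, .inr ⟨(ho' x).2 (by simpa [h₁, h₂] using ⟨f⟩), h₁, h₂⟩⟩
    · rintro ⟨x, ⟨h, h₁, h₂⟩ | ⟨h, h₁, h₂⟩⟩
      · simpa [h₁, h₂] using (ho x).1 h
      · simpa [h₁, h₂] using (ho' x).1 h

end EdgeList

lemma edgeListD4_isDiagramOf : edgeListD4.IsDiagramOf (CartanMatrix.D 4) where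
  src_ne_tgt := by decide
  edge := by decide
  eq_zero a b := by fin_cases a <;> fin_cases b <;> decide

lemma edgeListE6_isDiagramOf : edgeListE6.IsDiagramOf CartanMatrix.E₆ where
  src_ne_tgt := by decide
  edge := by decide
  eq_zero a b := by fin_cases a <;> fin_cases b <;> decide

/-! ### Incidence algebras as endomorphism algebras -/

namespace IncidenceBasis

section ToEnd

variable {k : Type u} [Field k] {C : Type*} [Ring C] [Algebra k C] {V : Type} [Fintype V]
  {R : V → V → Prop} (b : IncidenceBasis k C R)

/-- The coordinate of an element of an incidence algebra at a pair of vertices. -/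
def coord (x : C) (p q : V) (h : R p q) : k := b.basis.repr x ⟨(p, q), h⟩

lemma ext_coord {x y : C} (h : ∀ p q hpq, b.coord x p q hpq = b.coord y p q hpq) : x = y :=
  b.basis.repr.injective (Finsupp.ext fun p => h p.1.1 p.1.2 p.2)

lemma exists_coord_eq (c : ∀ p q, R p q → k) : ∃ x : C, ∀ p q h, b.coord x p q h = c p q h := by
  classical
  refine ⟨b.basis.repr.symm (Finsupp.equivFunOnFinite.symm fun p => c p.1.1 p.1.2 p.2),
    fun p q h => ?_⟩
  simp [coord]

variable {T : Type w} [Category.{v} T] [Preadditive T] [Linear k T] [HasFiniteBiproducts T]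

/-- A representation of an incidence algebra: objects at the vertices and compatible morphisms. -/
structure Representation (b : IncidenceBasis k C R) (X : V → T) where
  /-- The morphisms. -/
  map : ∀ {p q : V}, R p q → (X p ⟶ X q)
  map_refl : ∀ p, map (b.refl p) = 𝟙 (X p)
  map_trans : ∀ {p q r : V} (h : R p q) (h' : R q r), map (b.trans h h') = map h ≫ map h'

namespace Representation

variable {b} {X : V → T} (m : b.Representation X)

/-- The underlying linear map of the action of an incidence algebra on the direct sum of a
representation. -/
def toEndₗ : C →ₗ[k] End (⨁ X) :=
  b.basis.constr k fun p => (biproduct.π X p.1.1 ≫ m.map p.2 ≫ biproduct.ι X p.1.2 : End (⨁ X))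

lemma toEndₗ_basis {p q : V} (h : R p q) : m.toEndₗ (b.basis ⟨(p, q), h⟩) =
    biproduct.π X p ≫ m.map h ≫ biproduct.ι X q :=
  b.basis.constr_basis k _ _

lemma toEndₗ_one : m.toEndₗ 1 = 1 := by
  classical
  rw [← b.sum_eq_one, map_sum]
  simp only [toEndₗ_basis, m.map_refl, Category.id_comp]
  exact biproduct.total

lemma toEndₗ_mul (x y : C) : m.toEndₗ (x * y) = m.toEndₗ x * m.toEndₗ y := by
  classical
  revert x y
  rw [LinearMap.map_mul_iff]
  refine b.basis.ext fun p => b.basis.ext fun q => ?_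
  obtain ⟨⟨p₁, p₂⟩, hp⟩ := p
  obtain ⟨⟨q₁, q₂⟩, hq⟩ := q
  change m.toEndₗ (b.basis _ * b.basis _) = m.toEndₗ (b.basis _) * m.toEndₗ (b.basis _)
  rw [End.mul_def, toEndₗ_basis, toEndₗ_basis]
  by_cases h : q₂ = p₁
  · subst h
    rw [b.mul_of_eq hq hp, toEndₗ_basis, m.map_trans hq hp]
    simp
  · rw [b.mul_of_ne hq hp h, map_zero]
    simp only [Category.assoc, biproduct.ι_π_ne_assoc X h, zero_comp, comp_zero]

/-- The action of an incidence algebra on the direct sum of a representation. -/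
def toEnd : C →ₐ[k] End (⨁ X) :=
  AlgHom.ofLinearMap m.toEndₗ m.toEndₗ_one m.toEndₗ_mul

lemma toEnd_basis {p q : V} (h : R p q) : m.toEnd (b.basis ⟨(p, q), h⟩) =
    biproduct.π X p ≫ m.map h ≫ biproduct.ι X q := m.toEndₗ_basis h

lemma ι_toEnd_π (x : C) {p q : V} (h : R p q) :
    biproduct.ι X p ≫ m.toEnd x ≫ biproduct.π X q = b.coord x p q h • m.map h := by
  classical
  have hx : (LinearMap.toSpanSingleton k _ (m.map h)) ∘ₗ (Finsupp.lapply ⟨(p, q), h⟩) ∘ₗ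
      b.basis.repr.toLinearMap = (Linear.leftComp k _ (biproduct.ι X p)) ∘ₗ
        (Linear.rightComp k _ (biproduct.π X q)) ∘ₗ m.toEndₗ := by
    refine b.basis.ext fun r => ?_
    obtain ⟨⟨r₁, r₂⟩, hr⟩ := r
    change (b.basis.repr (b.basis ⟨(r₁, r₂), hr⟩) ⟨(p, q), h⟩) • m.map h =
      biproduct.ι X p ≫ m.toEndₗ (b.basis ⟨(r₁, r₂), hr⟩) ≫ biproduct.π X q
    rw [toEndₗ_basis, b.basis.repr_self, Finsupp.single_apply]
    simp only [Category.assoc]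
    by_cases h₁ : p = r₁
    · subst h₁
      rw [biproduct.ι_π_self_assoc]
      by_cases h₂ : r₂ = q
      · subst h₂
        rw [biproduct.ι_π_self, Category.comp_id, if_pos rfl, one_smul]
      · rw [biproduct.ι_π_ne X h₂, comp_zero, if_neg (fun h' => h₂ (by cases h'; rfl)), zero_smul]
    · rw [biproduct.ι_π_ne_assoc X h₁, zero_comp, if_neg (fun h' => h₁ (by cases h'; rfl)),
        zero_smul]
  exact (LinearMap.congr_fun hx x).symm

/-- The matrix entries of the action of `x` on `⨁ X` are its coordinates times the structure
morphisms, and these are bases of the corresponding Hom spaces. -/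
lemma toEnd_bijective (h₀ : ∀ p q, ¬ R p q → ∀ f : X p ⟶ X q, f = 0)
    (h₁ : ∀ {p q} (h : R p q) (f : X p ⟶ X q), ∃ c : k, f = c • m.map h)
    (hm : ∀ {p q} (h : R p q), m.map h ≠ 0) : Function.Bijective m.toEnd := by
  constructor
  · intro x y hxy
    refine b.ext_coord fun p q h => ?_
    have := (m.ι_toEnd_π x h).symm.trans ((congrArg (fun f : ⨁ X ⟶ ⨁ X =>
      biproduct.ι X p ≫ f ≫ biproduct.π X q) hxy).trans (m.ι_toEnd_π y h))
    exact smul_left_injective k (hm h) this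
  · intro f
    choose c hc using fun p q (h : R p q) => h₁ h (biproduct.ι X p ≫ f ≫ biproduct.π X q)
    obtain ⟨x, hx⟩ := b.exists_coord_eq c
    refine ⟨x, biproduct.hom_ext _ _ fun q => biproduct.hom_ext' _ _ fun p => ?_⟩
    by_cases h : R p q
    · rw [m.ι_toEnd_π x h, hx, hc p q h]
    · rw [h₀ p q h (_ ≫ _), h₀ p q h (_ ≫ _)]

end Representation

end ToEnd

end IncidenceBasis

/-! ### Projective modules over incidence algebras -/

/-- Left multiplication as a homomorphism of right modules. -/
def leftMulHom {C : Type u} [Ring C] (c : C) : C →ₗ[Cᵐᵒᵖ] C where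
  toFun x := c * x
  map_add' := mul_add c
  map_smul' a x := (mul_assoc c x a.unop).symm

@[simp]
lemma leftMulHom_apply {C : Type u} [Ring C] (c x : C) : leftMulHom c x = c * x := rfl

lemma finite_mulOpposite (C : Type u) [Ring C] : Module.Finite Cᵐᵒᵖ C :=
  .of_surjective (LinearMap.toSpanSingleton Cᵐᵒᵖ C 1) fun x => ⟨.op x, one_mul x⟩

lemma projective_mulOpposite (C : Type u) [Ring C] : Module.Projective Cᵐᵒᵖ C :=
  .of_equiv (LinearEquiv.ofBijective (LinearMap.toSpanSingleton Cᵐᵒᵖ C 1)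
    ⟨fun x y h => MulOpposite.unop_injective
      ((one_mul x.unop).symm.trans (Eq.trans h (one_mul y.unop))),
      fun x => ⟨.op x, one_mul x⟩⟩)

namespace IncidenceBasis

variable {k : Type u} [Field k] {C : Type u} [Ring C] [Algebra k C] {V : Type} [Fintype V]
  {R : V → V → Prop} (b : IncidenceBasis k C R)

/-- The idempotent of an incidence algebra at a vertex. -/
def idem (p : V) : C := b.basis ⟨(p, p), b.refl p⟩

lemma idem_mul_idem (p : V) : b.idem p * b.idem p = b.idem p := b.mul_of_eq _ _

lemma idem_mul_basis {p q : V} (h : R p q) :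
    b.idem q * b.basis ⟨(p, q), h⟩ = b.basis ⟨(p, q), h⟩ := b.mul_of_eq _ _

lemma basis_mul_idem {p q : V} (h : R p q) :
    b.basis ⟨(p, q), h⟩ * b.idem p = b.basis ⟨(p, q), h⟩ := b.mul_of_eq _ _

/-- The projective right module at a vertex. -/
abbrev projSubmodule (p : V) : Submodule Cᵐᵒᵖ C := LinearMap.range (leftMulHom (b.idem p))

lemma idem_mul_of_mem {p : V} {x : C} (hx : x ∈ b.projSubmodule p) : b.idem p * x = x := by
  obtain ⟨y, rfl⟩ := hx
  rw [leftMulHom_apply, ← mul_assoc, idem_mul_idem]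

lemma mem_projSubmodule_iff {p : V} {x : C} : x ∈ b.projSubmodule p ↔ b.idem p * x = x :=
  ⟨b.idem_mul_of_mem, fun h => ⟨x, h⟩⟩

lemma finite_projSubmodule (p : V) : Module.Finite Cᵐᵒᵖ (b.projSubmodule p) := by
  have := finite_mulOpposite C
  infer_instance

lemma projective_projSubmodule (p : V) : Module.Projective Cᵐᵒᵖ (b.projSubmodule p) := by
  have := projective_mulOpposite C
  refine Module.Projective.of_split (b.projSubmodule p).subtype
    (leftMulHom (b.idem p)).rangeRestrict ?_
  ext x
  exact b.idem_mul_of_mem x.2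

/-- The projective right module at a vertex, as an object of the category of right modules. -/
def projMod (p : V) : RightMod C := ModuleCat.of Cᵐᵒᵖ (b.projSubmodule p)

/-- The generator of the projective module at a vertex. -/
def projGen (p : V) : b.projSubmodule p := ⟨b.idem p, b.mem_projSubmodule_iff.2 (b.idem_mul_idem p)⟩

lemma smul_projGen {p : V} (x : b.projSubmodule p) : MulOpposite.op x.1 • b.projGen p = x :=
  Subtype.ext (b.idem_mul_of_mem x.2)

lemma projMod_hom_ext {p : V} {M : RightMod C} {f g : b.projMod p ⟶ M}
    (h : f.hom (b.projGen p) = g.hom (b.projGen p)) : f = g := by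
  have key (f : b.projMod p ⟶ M) (x : b.projSubmodule p) :
      f.hom x = MulOpposite.op x.1 • f.hom (b.projGen p) :=
    (congrArg f.hom (b.smul_projGen x).symm).trans (f.hom.map_smul (MulOpposite.op x.1) (b.projGen p))
  ext x
  exact (key f x).trans ((congrArg _ h).trans (key g x).symm)

/-- The homomorphism from the projective module at a vertex given by an element. -/
def projDesc (p : V) (M : RightMod C) (x : M) : b.projMod p ⟶ M :=
  ModuleCat.ofHom ((LinearMap.toSpanSingleton Cᵐᵒᵖ M x) ∘ₗ
    ({ toFun := fun y => MulOpposite.op y.1, map_add' := fun _ _ => rfl,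
       map_smul' := fun _ _ => rfl } : b.projSubmodule p →ₗ[Cᵐᵒᵖ] Cᵐᵒᵖ))

/-- The maps between the projective modules form a representation. -/
def projRepresentation : b.Representation b.projMod where
  map {p q} h := b.projDesc p (b.projMod q)
    ⟨b.basis ⟨(p, q), h⟩, b.mem_projSubmodule_iff.2 (b.idem_mul_basis h)⟩
  map_refl p := b.projMod_hom_ext (Subtype.ext (b.idem_mul_idem p))
  map_trans {p q r} h h' := b.projMod_hom_ext (Subtype.ext (by
    change b.basis _ * b.idem p = b.basis _ * (b.basis _ * b.idem p)
    rw [basis_mul_idem, basis_mul_idem, b.mul_of_eq h h']))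

lemma projRepresentation_map_apply {p q : V} (h : R p q) :
    ((b.projRepresentation.map h).hom (b.projGen p)).1 = b.basis ⟨(p, q), h⟩ :=
  b.basis_mul_idem h

lemma projRepresentation_map_ne_zero {p q : V} (h : R p q) : b.projRepresentation.map h ≠ 0 := by
  intro h0
  have := b.projRepresentation_map_apply h
  rw [h0] at this
  exact b.basis.ne_zero _ this.symm

/-- The Peirce component `e_q C e_p` is the line through the basis vector at `(p, q)`, or zero. It
is also the space of homomorphisms from `e_p C` to `e_q C`. -/
lemma idem_mul_mul_idem (x : C) (p q : V) :
    (∃ (h : R p q), b.idem q * x * b.idem p = b.coord x p q h • b.basis ⟨(p, q), h⟩) ∨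
      (¬ R p q ∧ b.idem q * x * b.idem p = 0) := by
  classical
  by_cases h : R p q
  · refine .inl ⟨h, ?_⟩
    have hx : (LinearMap.mulLeftRight k (b.idem q, b.idem p)) =
        (LinearMap.toSpanSingleton k _ (b.basis ⟨(p, q), h⟩)) ∘ₗ
          (Finsupp.lapply ⟨(p, q), h⟩) ∘ₗ b.basis.repr.toLinearMap := by
      refine b.basis.ext fun r => ?_
      obtain ⟨⟨r₁, r₂⟩, hr⟩ := r
      change b.idem q * b.basis _ * b.idem p =
        (b.basis.repr (b.basis ⟨(r₁, r₂), hr⟩) ⟨(p, q), h⟩) • b.basis ⟨(p, q), h⟩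
      rw [b.basis.repr_self, Finsupp.single_apply]
      by_cases h₁ : p = r₁
      · subst h₁
        rw [mul_assoc, basis_mul_idem]
        by_cases h₂ : r₂ = q
        · subst h₂
          rw [idem_mul_basis, if_pos rfl, one_smul]
        · rw [if_neg (fun h' => h₂ (by cases h'; rfl)), zero_smul]
          exact b.mul_of_ne _ _ h₂
      · rw [if_neg (fun h' => h₁ (by cases h'; rfl)), zero_smul, mul_assoc,
          show b.basis ⟨(r₁, r₂), hr⟩ * b.idem p = 0 from b.mul_of_ne _ _ h₁, mul_zero]
    exact LinearMap.congr_fun hx x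
  · refine .inr ⟨h, ?_⟩
    have hx : (LinearMap.mulLeftRight k (b.idem q, b.idem p)) = 0 := by
      refine b.basis.ext fun r => ?_
      obtain ⟨⟨r₁, r₂⟩, hr⟩ := r
      change b.idem q * b.basis _ * b.idem p = 0
      by_cases h₁ : p = r₁
      · subst h₁
        rw [mul_assoc, basis_mul_idem]
        exact b.mul_of_ne _ _ (fun h₂ => h (h₂ ▸ hr))
      · rw [mul_assoc, show b.basis ⟨(r₁, r₂), hr⟩ * b.idem p = 0 from b.mul_of_ne _ _ h₁, mul_zero]
    exact LinearMap.congr_fun hx x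

lemma projMod_hom_cases {p q : V} (f : b.projMod p ⟶ b.projMod q) :
    (∃ (h : R p q) (c : k), f = c • b.projRepresentation.map h) ∨ (¬ R p q ∧ f = 0) := by
  -- A homomorphism is determined by the image of the generator `e_p`; this image is fixed by `e_q`
  -- on the left and by `e_p` on the right.
  have hf : (f.hom (b.projGen p)).1 = b.idem q * (f.hom (b.projGen p)).1 * b.idem p := by
    rw [b.idem_mul_of_mem (f.hom (b.projGen p)).2]
    have : MulOpposite.op (b.idem p) • b.projGen p = b.projGen p :=
      b.smul_projGen (b.projGen p)
    exact congrArg Subtype.val ((congrArg f.hom this.symm).trans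
      (f.hom.map_smul (MulOpposite.op (b.idem p)) (b.projGen p)))
  rcases b.idem_mul_mul_idem (f.hom (b.projGen p)).1 p q with ⟨h, hx⟩ | ⟨h, hx⟩
  · refine .inl ⟨h, b.coord (f.hom (b.projGen p)).1 p q h, b.projMod_hom_ext (Subtype.ext (hf.trans (hx.trans ?_)))⟩
    exact (Algebra.smul_def _ _).trans ((Algebra.commutes _ _).trans
      (congrArg (· * algebraMap k C _) (b.projRepresentation_map_apply h).symm))
  · exact .inr ⟨h, b.projMod_hom_ext (Subtype.ext (hf.trans hx))⟩

end IncidenceBasis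

/-! ### Stalk complexes -/

section Stalk

variable {k : Type u} [Field k] {C : Type u} [Ring C] [Algebra k C]

lemma isStrictlyPerfect_single (M : RightMod C) (hf : Module.Finite Cᵐᵒᵖ M)
    (hp : Module.Projective Cᵐᵒᵖ M) :
    IsStrictlyPerfect C ((CochainComplex.singleFunctor (RightMod C) 0).obj M) := by
  have hz (n : ℤ) (hn : n ≠ 0) :
      IsZero (((CochainComplex.singleFunctor (RightMod C) 0).obj M).X n) :=
    HomologicalComplex.isZero_single_obj_X _ 0 M n hn
  have hs (n : ℤ) (hn : n ≠ 0) :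
      Subsingleton (((CochainComplex.singleFunctor (RightMod C) 0).obj M).X n) :=
    ModuleCat.subsingleton_of_isZero (hz n hn)
  let e : ((CochainComplex.singleFunctor (RightMod C) 0).obj M).X 0 ≃ₗ[Cᵐᵒᵖ] M :=
    (HomologicalComplex.singleObjXSelf (ComplexShape.up ℤ) 0 M).toLinearEquiv
  refine ⟨fun n => ?_, fun n => ?_, 0, 0, fun n hn => hz n (by omega)⟩
  · by_cases hn : n = 0
    · subst hn
      exact Module.Finite.equiv e.symm
    · have := hs n hn
      infer_instance
  · by_cases hn : n = 0
    · subst hn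
      exact Module.Projective.of_equiv e.symm
    · have := hs n hn
      infer_instance

lemma quotient_map_single_eq_zero_iff {M N : RightMod C} (f : M ⟶ N) :
    (HomotopyCategory.quotient (RightMod C) (ComplexShape.up ℤ)).map
      ((CochainComplex.singleFunctor (RightMod C) 0).map f) = 0 ↔ f = 0 := by
  constructor
  · intro h
    obtain ⟨h⟩ := (HomotopyCategory.quotient_map_eq_zero_iff _).1 h
    apply (CochainComplex.singleFunctor (RightMod C) 0).map_injective
    rw [Functor.map_zero]
    ext1 n
    rw [h.comm n]
    simp [dNext, prevD]
  · rintro rfl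
    exact (CochainComplex.singleFunctor (RightMod C) 0 ⋙
      HomotopyCategory.quotient (RightMod C) (ComplexShape.up ℤ)).map_zero _ _

lemma hom_single_shift_eq_zero (M N : RightMod C) {i : ℤ} (hi : i ≠ 0)
    (φ : (CochainComplex.singleFunctor (RightMod C) 0).obj M ⟶
      ((CochainComplex.singleFunctor (RightMod C) 0).obj N)⟦i⟧) : φ = 0 := by
  ext1 n
  by_cases hn : n = 0
  · exact (HomologicalComplex.isZero_single_obj_X (ComplexShape.up ℤ) 0 N (n + i)
      (by omega)).eq_of_tgt _ _
  · exact (HomologicalComplex.isZero_single_obj_X (ComplexShape.up ℤ) 0 M n hn).eq_of_src _ _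

/-- Morphisms from a strictly perfect complex to a shift are represented by morphisms of
complexes. -/
lemma exists_complex_hom_shift {K L : CochainComplex (RightMod C) ℤ} (hK : IsStrictlyPerfect C K)
    (hL : IsStrictlyPerfect C L) (i : ℤ)
    (h : ∀ φ : K ⟶ L⟦i⟧, (HomotopyCategory.quotient _ (ComplexShape.up ℤ)).map φ = 0)
    (f : hK.toHomotopyPerf ⟶ hL.toHomotopyPerf⟦i⟧) : f = 0 := by
  let Q := HomotopyCategory.quotient (RightMod C) (ComplexShape.up ℤ)
  let e : (hL.toHomotopyPerf⟦i⟧).obj ≅ Q.obj (L⟦i⟧) :=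
    ((isHomotopyPerfect C).ι.commShiftIso i).app hL.toHomotopyPerf ≪≫ ((Q.commShiftIso i).app L).symm
  obtain ⟨φ, hφ⟩ := Q.map_surjective (f.hom ≫ e.hom)
  rw [h φ] at hφ
  ext
  change f.hom = 0
  rw [← cancel_mono e.hom]
  exact hφ.symm.trans zero_comp.symm

end Stalk

namespace IncidenceBasis

variable {k : Type u} [Field k] {C : Type u} [Ring C] [Algebra k C] {V : Type} [Fintype V]
  {R : V → V → Prop} (b : IncidenceBasis k C R)

/-- The stalk complex of the projective module at a vertex. -/
abbrev projComplex (p : V) : CochainComplex (RightMod C) ℤ :=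
  (CochainComplex.singleFunctor (RightMod C) 0).obj (b.projMod p)

lemma isStrictlyPerfect_projComplex (p : V) : IsStrictlyPerfect C (b.projComplex p) :=
  isStrictlyPerfect_single _ (b.finite_projSubmodule p) (b.projective_projSubmodule p)

/-- The projective module at a vertex as an object of the homotopy category. -/
abbrev projObj (p : V) : HomotopyPerf C := (b.isStrictlyPerfect_projComplex p).toHomotopyPerf

/-- The morphism between stalk complexes given by a homomorphism. -/
def projObjMap {p q : V} : (b.projMod p ⟶ b.projMod q) →ₗ[k] (b.projObj p ⟶ b.projObj q) where
  toFun f := toHomotopyPerfMap _ _ ((CochainComplex.singleFunctor (RightMod C) 0).map f)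
  map_add' f g := by
    ext
    exact ((CochainComplex.singleFunctor (RightMod C) 0) ⋙ HomotopyCategory.quotient (RightMod C)
      (ComplexShape.up ℤ)).map_add
  map_smul' c f := by
    ext
    refine Eq.trans ?_ ((HomotopyCategory.quotient (RightMod C) (ComplexShape.up ℤ)).map_smul c
          ((CochainComplex.singleFunctor (RightMod C) 0).map f))
    refine congrArg (HomotopyCategory.quotient (RightMod C) (ComplexShape.up ℤ)).map ?_
    exact (CochainComplex.singleFunctor (RightMod C) 0).map_smul c f

lemma projObjMap_comp {p q r : V} (f : b.projMod p ⟶ b.projMod q) (g : b.projMod q ⟶ b.projMod r) :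
    b.projObjMap (f ≫ g) = b.projObjMap f ≫ b.projObjMap g := by
  ext
  exact ((CochainComplex.singleFunctor (RightMod C) 0) ⋙ HomotopyCategory.quotient (RightMod C)
    (ComplexShape.up ℤ)).map_comp f g

lemma projObjMap_id (p : V) : b.projObjMap (𝟙 (b.projMod p)) = 𝟙 _ := by
  ext
  exact ((CochainComplex.singleFunctor (RightMod C) 0) ⋙ HomotopyCategory.quotient (RightMod C)
    (ComplexShape.up ℤ)).map_id _

lemma projObjMap_bijective (p q : V) : Function.Bijective (b.projObjMap (p := p) (q := q)) := by
  constructor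
  · rw [injective_iff_map_eq_zero]
    intro f hf
    exact (quotient_map_single_eq_zero_iff f).1 (congrArg (fun g => g.hom) hf)
  · intro f
    obtain ⟨φ, hφ⟩ := (HomotopyCategory.quotient _ _).map_surjective f.hom
    obtain ⟨g, rfl⟩ := (CochainComplex.singleFunctor (RightMod C) 0).map_surjective φ
    exact ⟨g, by ext; exact hφ⟩

/-- The representation of an incidence algebra in the homotopy category given by its projective
modules. -/
def projObjRepresentation : b.Representation b.projObj where
  map h := b.projObjMap (b.projRepresentation.map h)
  map_refl p := by rw [b.projRepresentation.map_refl, projObjMap_id]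
  map_trans h h' := by rw [b.projRepresentation.map_trans h h', projObjMap_comp]

lemma projObjRepresentation_map_ne_zero {p q : V} (h : R p q) :
    b.projObjRepresentation.map h ≠ 0 := by
  intro h0
  exact b.projRepresentation_map_ne_zero h ((b.projObjMap_bijective p q).1 (h0.trans (map_zero _).symm))

lemma projObj_hom_cases {p q : V} (f : b.projObj p ⟶ b.projObj q) :
    (∃ (h : R p q) (c : k), f = c • b.projObjRepresentation.map h) ∨ (¬ R p q ∧ f = 0) := by
  obtain ⟨f, rfl⟩ := (b.projObjMap_bijective p q).2 f
  rcases b.projMod_hom_cases f with ⟨h, c, rfl⟩ | ⟨h, rfl⟩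
  · exact .inl ⟨h, c, map_smul _ _ _⟩
  · exact .inr ⟨h, map_zero _⟩

/-- This is the starting collection for all mutations. Stalks of projectives have no morphisms of
nonzero degree, and the basis vectors multiply to basis vectors. -/
lemma isThin_projObj : IsThin k R b.projObj := by
  have key {p q : V} (h : R p q) (f : b.projObj p ⟶ b.projObj q) :
      ∃ c : k, f = c • b.projObjRepresentation.map h := by
    rcases b.projObj_hom_cases f with ⟨_, c, rfl⟩ | ⟨h', _⟩
    · exact ⟨c, rfl⟩
    · exact absurd h h'
  refine ⟨fun {p q i} hi f => ?_, fun {p q} h f => ?_, fun {p q} h => ?_,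
    fun {p q r} h h' f g hf hg => ?_⟩
  · refine exists_complex_hom_shift _ _ i (fun φ => ?_) f
    rw [hom_single_shift_eq_zero _ _ hi φ, Functor.map_zero]
  · rcases b.projObj_hom_cases f with ⟨h', _⟩ | ⟨_, hf⟩
    · exact absurd h' h
    · exact hf
  · exact finrank_eq_one _ (b.projObjRepresentation_map_ne_zero h) fun f =>
      (key h f).imp fun _ => Eq.symm
  · obtain ⟨c, rfl⟩ := key h f
    obtain ⟨d, rfl⟩ := key h' g
    have hc : c ≠ 0 := fun h => hf (by rw [h, zero_smul])
    have hd : d ≠ 0 := fun h => hg (by rw [h, zero_smul])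
    rw [Linear.smul_comp, Linear.comp_smul, ← b.projObjRepresentation.map_trans]
    exact smul_ne_zero hc (smul_ne_zero hd (b.projObjRepresentation_map_ne_zero _))

end IncidenceBasis

/-! ### Strong exceptional collections from thin families -/

section ThinExceptional

variable {k : Type u} [Field k] {T : Type w} [Category.{v} T] [Preadditive T] [Linear k T]
  [HasZeroObject T] [HasShift T ℤ] [∀ n : ℤ, (shiftFunctor T n).Additive]

lemma IsThin.comp_equiv_of_iso [∀ n : ℤ, (shiftFunctor T n).Linear k] {V W : Type}
    {R : V → V → Prop} {X : V → T} (hX : IsThin k R X)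
    (f : W → V) {E : W → T} (e : ∀ i, E i ≅ X (f i)) : IsThin k (fun i j => R (f i) (f j)) E where
  ext_eq_zero {i j n} hn g := by
    have := hX.ext_eq_zero hn ((e i).inv ≫ g ≫ ((e j).hom)⟦n⟧')
    rw [Preadditive.IsIso.comp_left_eq_zero, Preadditive.IsIso.comp_right_eq_zero] at this
    exact this
  hom_eq_zero {i j} h g := by
    have := hX.hom_eq_zero h ((e i).inv ≫ g ≫ (e j).hom)
    rw [Preadditive.IsIso.comp_left_eq_zero, Preadditive.IsIso.comp_right_eq_zero] at this
    exact this
  finrank_hom {i j} h := by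
    rw [← hX.finrank_hom h]
    exact LinearEquiv.finrank_eq (Linear.homCongr k (e i) (e j))
  comp_ne_zero {i j l} h h' a b ha hb hab := by
    have ha' : (e i).inv ≫ a ≫ (e j).hom ≠ 0 := by
      rwa [ne_eq, Preadditive.IsIso.comp_left_eq_zero, Preadditive.IsIso.comp_right_eq_zero]
    have hb' : (e j).inv ≫ b ≫ (e l).hom ≠ 0 := by
      rwa [ne_eq, Preadditive.IsIso.comp_left_eq_zero, Preadditive.IsIso.comp_right_eq_zero]
    refine hX.comp_ne_zero h h' ha' hb' ?_
    simp [reassoc_of% hab]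

lemma IsThin.isStrongExceptional {n : ℕ} {R : Fin n → Fin n → Prop} {X : Fin n → T}
    (hX : IsThin k R X) (hrefl : ∀ i, R i i) (h : ∀ i j, i < j → ¬ R j i) :
    IsStrongExceptional k X where
  exceptional a := by
    refine ⟨?_, fun i hi => subsingleton_of_forall_eq 0 (hX.ext_eq_zero hi)⟩
    have h1 : 𝟙 (X a) ≠ 0 := by
      obtain ⟨f, hf⟩ := hX.exists_ne_zero (hrefl a)
      intro h0
      exact hf (by rw [← Category.id_comp f, h0, zero_comp])
    refine ⟨smul_left_injective k h1, fun f => ?_⟩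
    obtain ⟨c, rfl⟩ := hX.exists_smul h1 f
    exact ⟨c, rfl⟩
  semiorthogonal a b hab i := by
    by_cases hi : i = 0
    · subst hi
      refine subsingleton_of_forall_eq 0 fun f => ?_
      have := hX.hom_eq_zero (h b a hab) (f ≫ (shiftFunctorZero T ℤ).hom.app (X b))
      rwa [Preadditive.IsIso.comp_right_eq_zero] at this
    · exact subsingleton_of_forall_eq 0 (hX.ext_eq_zero hi)
  strong a b i hi := subsingleton_of_forall_eq 0 (hX.ext_eq_zero hi)

variable {C : Type*} [Ring C] [Algebra k C] {V : Type} [Fintype V] {R : V → V → Prop}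
  {b : IncidenceBasis k C R} {X : V → T}

lemma IsThin.toEnd_bijective [HasFiniteBiproducts T] (hX : IsThin k R X) (m : b.Representation X)
    (hm : ∀ {p q} (h : R p q), m.map h ≠ 0) : Function.Bijective m.toEnd :=
  m.toEnd_bijective (fun _ _ h f => hX.hom_eq_zero h f) (fun h f => hX.exists_smul (hm h) f) hm

end ThinExceptional

/-! ### Generation of the derived category by projective modules -/

section Generation

variable {C : Type u} [Ring C] (P : ObjectProperty (DerivedCategory (RightMod C)))
  [P.IsTriangulated] [P.IsClosedUnderIsomorphisms]

/-- A module lies in `P` if its stalk complex does. -/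
def IsStalkIn (M : RightMod C) : Prop := P ((DerivedCategory.singleFunctor (RightMod C) 0).obj M)

variable {P}

lemma isStalkIn_of_subsingleton (M : RightMod C) [Subsingleton M] : IsStalkIn P M :=
  P.prop_of_isZero ((DerivedCategory.singleFunctor (RightMod C) 0).map_isZero
    (ModuleCat.isZero_of_subsingleton M))

lemma isStalkIn_of_ker {M N : Type u} [AddCommGroup M] [AddCommGroup N] [Module Cᵐᵒᵖ M]
    [Module Cᵐᵒᵖ N] (f : M →ₗ[Cᵐᵒᵖ] N) (hf : Function.Surjective f)
    (h₁ : IsStalkIn P (ModuleCat.of Cᵐᵒᵖ (LinearMap.ker f)))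
    (h₂ : IsStalkIn P (ModuleCat.of Cᵐᵒᵖ N)) : IsStalkIn P (ModuleCat.of Cᵐᵒᵖ M) :=
  P.ext_of_isTriangulatedClosed₂ _
    (LinearMap.shortExact_shortComplexKer hf).singleTriangle_distinguished h₁ h₂

lemma isStalkIn_of_surjective {M N : Type u} [AddCommGroup M] [AddCommGroup N] [Module Cᵐᵒᵖ M]
    [Module Cᵐᵒᵖ N] (f : M →ₗ[Cᵐᵒᵖ] N) (hf : Function.Surjective f)
    (h₁ : IsStalkIn P (ModuleCat.of Cᵐᵒᵖ (LinearMap.ker f)))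
    (h₂ : IsStalkIn P (ModuleCat.of Cᵐᵒᵖ M)) : IsStalkIn P (ModuleCat.of Cᵐᵒᵖ N) :=
  P.ext_of_isTriangulatedClosed₃ _
    (LinearMap.shortExact_shortComplexKer hf).singleTriangle_distinguished h₁ h₂

lemma prop_Q_single (h : ∀ M : RightMod C, Module.Finite Cᵐᵒᵖ M → IsStalkIn P M) (j : ℤ)
    (M : RightMod C) (hM : Module.Finite Cᵐᵒᵖ M) :
    P (DerivedCategory.Q.obj ((HomologicalComplex.single _ (ComplexShape.up ℤ) j).obj M)) :=
  P.prop_of_iso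
    (((DerivedCategory.singleFunctors (RightMod C)).shiftIso (-j) j 0 (neg_add_cancel j)).app M)
    (P.le_shift (-j) _ (h M hM))

/-- Brutal truncation: the top term is a subcomplex concentrated in one degree, and the quotient is
shorter by one. -/
lemma prop_Q_of_bounded (h : ∀ M : RightMod C, Module.Finite Cᵐᵒᵖ M → IsStalkIn P M) (a : ℤ) (n : ℕ)
    (K : CochainComplex (RightMod C) ℤ) (hK : ∀ i, Module.Finite Cᵐᵒᵖ (K.X i))
    (hb : ∀ i, i < a ∨ a + n ≤ i → IsZero (K.X i)) : P (DerivedCategory.Q.obj K) := by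
  induction n generalizing K with
  | zero =>
    refine P.prop_of_isZero (DerivedCategory.Q.map_isZero ?_)
    rw [IsZero.iff_id_eq_zero]
    ext1 i
    exact (hb i (by omega)).eq_of_src _ _
  | succ n ih =>
    have hb' (i : ℤ) (hi : i < a ∨ a + n < i) : IsZero (K.X i) := hb i (by push_cast; omega)
    -- The inclusion of the top term is a chain map since the differential out of degree `a + n` has
    -- zero target.
    let φ : (HomologicalComplex.single (RightMod C) (ComplexShape.up ℤ) (a + n)).obj
        (K.X (a + n)) ⟶ K :=
      HomologicalComplex.mkHomFromSingle (𝟙 _) fun i hi => by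
        obtain rfl : a + n + 1 = i := hi
        exact (hb' _ (by omega)).eq_of_tgt _ _
    have hφ : IsIso (φ.f (a + n)) := by
      rw [HomologicalComplex.mkHomFromSingle_f]
      infer_instance
    have : Mono φ := by
      refine HomologicalComplex.mono_of_mono_f _ fun i => ?_
      by_cases hi : i = a + n
      · subst hi
        infer_instance
      · exact ⟨fun _ _ _ =>
          (HomologicalComplex.isZero_single_obj_X (ComplexShape.up ℤ) _ _ _ hi).eq_of_tgt _ _⟩
    let S : ShortComplex (CochainComplex (RightMod C) ℤ) :=
      ShortComplex.mk φ (cokernel.π φ) (cokernel.condition φ)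
    have hS : S.ShortExact :=
      { exact := ShortComplex.exact_cokernel φ
        mono_f := ‹Mono φ›
        epi_g := inferInstanceAs (Epi (cokernel.π φ)) }
    have hepi (i : ℤ) : Epi ((cokernel.π φ).f i) := inferInstance
    refine P.ext_of_isTriangulatedClosed₂ _ (DerivedCategory.triangleOfSES_distinguished hS)
      (prop_Q_single h _ _ (hK _)) (ih _ (fun i => ?_) fun i hi => ?_)
    · have := hK i
      exact Module.Finite.of_surjective ((cokernel.π φ).f i).hom
        ((ModuleCat.epi_iff_surjective _).1 (hepi i))
    · rw [IsZero.iff_id_eq_zero, ← cancel_epi ((cokernel.π φ).f i)]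
      by_cases hi' : i = a + n
      · subst hi'
        rw [← cancel_epi (φ.f (a + n)), Category.comp_id, comp_zero, comp_zero,
          ← HomologicalComplex.comp_f, cokernel.condition, HomologicalComplex.zero_f]
      · exact (hb' i (by omega)).eq_of_src _ _

lemma isPerfect_le (h : ∀ M : RightMod C, Module.Finite Cᵐᵒᵖ M → IsStalkIn P M) :
    isPerfect C ≤ P := by
  rintro X ⟨K, hK, ⟨e⟩⟩
  obtain ⟨a, c, hac⟩ := hK.bounded
  exact P.prop_of_iso e.symm (prop_Q_of_bounded h a (c - a + 1).toNat K hK.finite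
    fun i hi => hac i (by omega))

end Generation

namespace IncidenceBasis

variable {k : Type u} [Field k] {C : Type u} [Ring C] [Algebra k C] {V : Type} [Fintype V]
  {R : V → V → Prop} (b : IncidenceBasis k C R)

include b in
lemma module_finite : Module.Finite k C :=
  have : Finite {p : V × V // R p.1 p.2} := inferInstance
  Module.Finite.of_basis b.basis

include b in
lemma isNoetherianRing : IsNoetherianRing Cᵐᵒᵖ := by
  have := b.module_finite
  have : Module.Finite k Cᵐᵒᵖ := Module.Finite.equiv (MulOpposite.opLinearEquiv k)
  exact isNoetherian_of_tower k inferInstance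

lemma sum_idem_smul {M : Type*} [AddCommGroup M] [Module Cᵐᵒᵖ M] (x : M) :
    ∑ p, MulOpposite.op (b.idem p) • x = x := by
  rw [← Finset.sum_smul, ← Finset.op_sum]
  exact (congrArg (fun c => MulOpposite.op c • x) b.sum_eq_one).trans (one_smul _ x)

variable {P : ObjectProperty (DerivedCategory (RightMod C))} [P.IsTriangulated]
  [P.IsClosedUnderIsomorphisms]

/-- Directedness gives finite resolutions by the modules `e_p C`. The induction is on a bound `t`
for the ranks of the vertices supporting `M`. A nonzero vector at the top vertex `i` generates a
quotient of `e_i C` whose kernel is supported in strictly smaller rank, because `e_i C e_i = k`.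
Splitting off such submodules terminates since `M` is Noetherian. -/
lemma isStalkIn_of_supported (rank : V → ℕ) (hinj : Function.Injective rank)
    (hrank : ∀ p q, R p q → p ≠ q → rank p < rank q) (hP : ∀ p, IsStalkIn P (b.projMod p))
    (t : ℕ) (M : Type u) [AddCommGroup M] [Module Cᵐᵒᵖ M] [Module.Finite Cᵐᵒᵖ M]
    (hM : ∀ p, t ≤ rank p → ∀ x : M, MulOpposite.op (b.idem p) • x = 0) :
    IsStalkIn P (ModuleCat.of Cᵐᵒᵖ M) := by
  have := b.isNoetherianRing
  induction t generalizing M with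
  | zero =>
    have : Subsingleton M := subsingleton_of_forall_eq 0 fun x => by
      rw [← b.sum_idem_smul x]
      exact Finset.sum_eq_zero fun p _ => hM p (Nat.zero_le _) x
    exact isStalkIn_of_subsingleton _
  | succ t ih =>
    by_cases ht : ∃ i, rank i = t
    swap
    · exact ih M fun p hp => hM p (hp.lt_of_ne fun h => ht ⟨p, h.symm⟩)
    obtain ⟨i, rfl⟩ := ht
    -- Noetherian induction runs over the kernels of the quotients `M'` of `M`, so each enlargement
    -- of the kernel is progress.
    have key (N : Submodule Cᵐᵒᵖ M) : ∀ (M' : Type u) [AddCommGroup M'] [Module Cᵐᵒᵖ M']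
        (f : M →ₗ[Cᵐᵒᵖ] M'), Function.Surjective f → LinearMap.ker f = N →
        IsStalkIn P (ModuleCat.of Cᵐᵒᵖ M') := by
      induction N using IsNoetherian.induction with
      | hgt N ihN =>
        intro M' _ _ f hf hN
        have : Module.Finite Cᵐᵒᵖ M' := .of_surjective f hf
        have hM' (p : V) (hp : rank i + 1 ≤ rank p) (x : M') :
            MulOpposite.op (b.idem p) • x = 0 := by
          obtain ⟨x, rfl⟩ := hf x
          rw [← map_smul, hM p hp, map_zero]
        by_cases hx : ∀ x : M', MulOpposite.op (b.idem i) • x = 0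
        · refine ih M' fun p hp => ?_
          rcases hp.lt_or_eq with hp | hp
          · exact hM' p hp
          · exact hinj hp ▸ hx
        push Not at hx
        obtain ⟨x, hx⟩ := hx
        obtain ⟨y, hy, hy0⟩ : ∃ y : M', MulOpposite.op (b.idem i) • y = y ∧ y ≠ 0 := by
          refine ⟨_, ?_, hx⟩
          rw [← mul_smul, ← MulOpposite.op_mul, idem_mul_idem]
        let φ : b.projSubmodule i →ₗ[Cᵐᵒᵖ] M' := (b.projDesc i (ModuleCat.of Cᵐᵒᵖ M') y).hom
        have hφ (z : b.projSubmodule i) : φ z = MulOpposite.op z.1 • y := rfl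
        let N' := LinearMap.range φ
        have hyN' : y ∈ N' := ⟨b.projGen i, hy⟩
        refine isStalkIn_of_ker N'.mkQ N'.mkQ_surjective ?_
          (ihN (LinearMap.ker (N'.mkQ ∘ₗ f)) ?_ _ (N'.mkQ ∘ₗ f)
            (N'.mkQ_surjective.comp hf) rfl)
        · let ψ : b.projSubmodule i →ₗ[Cᵐᵒᵖ] LinearMap.ker N'.mkQ :=
            φ.codRestrict _ fun z => by
              rw [Submodule.ker_mkQ]
              exact ⟨z, rfl⟩
          have hψ : Function.Surjective ψ := by
            rintro ⟨z, hz⟩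
            obtain ⟨w, hw⟩ : z ∈ N' := by rwa [Submodule.ker_mkQ] at hz
            exact ⟨w, Subtype.ext hw⟩
          refine isStalkIn_of_surjective ψ hψ ?_ (hP i)
          have : IsNoetherian Cᵐᵒᵖ (b.projSubmodule i) := by
            have := b.finite_projSubmodule i
            exact isNoetherian_of_isNoetherianRing_of_finite _ _
          -- The kernel of `e_i C → M'` vanishes at all vertices of rank at least `rank i`: for `p ≠
          -- i` there is no relation from `p` to `i`, and for `p = i` a nonzero multiple of `e_i`
          -- would kill `y`.
          refine ih _ fun p hp z => ?_
          obtain ⟨z, hz⟩ := z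
          have hz0 : MulOpposite.op z.1 • y = 0 := by
            rw [← hφ]
            exact congrArg Subtype.val hz
          refine Subtype.ext (Subtype.ext ?_)
          change z.1 * b.idem p = 0
          rw [← b.idem_mul_of_mem z.2]
          rcases b.idem_mul_mul_idem z.1 p i with ⟨h, hc⟩ | ⟨_, hc⟩
          swap
          · exact hc
          obtain rfl : p = i := by
            by_contra hpi
            exact absurd (hrank p i h hpi) (by omega)
          rw [hc]
          by_contra hne
          have hne' : b.coord z.1 p p h ≠ 0 := fun h0 => hne (by rw [h0, zero_smul])
          refine hy0 ?_
          have hc' := hc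
          rw [b.idem_mul_of_mem z.2] at hc'
          have he : b.idem p = (z.1 * b.idem p) * algebraMap k C (b.coord z.1 p p h)⁻¹ := by
            rw [← Algebra.commutes, ← Algebra.smul_def, hc', smul_smul, inv_mul_cancel₀ hne',
              one_smul]
            rfl
          rw [← hy, he, MulOpposite.op_mul, MulOpposite.op_mul, mul_smul, mul_smul, hz0, smul_zero,
            smul_zero]
        · rw [← hN, gt_iff_lt, SetLike.lt_iff_le_and_exists]
          refine ⟨fun z hz => ?_, ?_⟩
          · rw [LinearMap.mem_ker] at hz ⊢
            rw [LinearMap.comp_apply, hz, map_zero]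
          · obtain ⟨z, rfl⟩ := hf y
            refine ⟨z, ?_, hy0⟩
            rw [LinearMap.mem_ker, LinearMap.comp_apply, Submodule.mkQ_apply,
              Submodule.Quotient.mk_eq_zero]
            exact hyN'
    exact key _ M LinearMap.id Function.surjective_id rfl

/-- The perfect complexes are generated by the projective modules at the vertices. -/
lemma isPerfect_le_of_projMod (rank : V → ℕ) (hinj : Function.Injective rank)
    (hrank : ∀ p q, R p q → p ≠ q → rank p < rank q) (hP : ∀ p, IsStalkIn P (b.projMod p)) :
    isPerfect C ≤ P :=
  isPerfect_le fun M _ => b.isStalkIn_of_supported rank hinj hrank hP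
    -- The bound exceeds every rank, so the support condition is vacuous.
    (∑ p, rank p + 1) M fun p hp => by
      have := Finset.single_le_sum (fun q _ => Nat.zero_le (rank q)) (Finset.mem_univ p)
      omega

end IncidenceBasis

/-! ### The homotopy category and the derived category -/

section QhPerf

variable (C : Type u) [Ring C]

/-- The functor from the homotopy category of strictly perfect complexes to the derived category. -/
abbrev homotopyPerfToDerived : HomotopyPerf C ⥤ DerivedCategory (RightMod C) :=
  (isHomotopyPerfect C).ι ⋙ DerivedCategory.Qh

variable {C}

/-- Bounded complexes of projectives are K-projective, so morphisms out of them agree in the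
homotopy category and in the derived category. -/
lemma homotopyPerfToDerived_map_bijective (X Y : HomotopyPerf C) :
    Function.Bijective ((homotopyPerfToDerived C).map : (X ⟶ Y) → _) := by
  obtain ⟨K, hK, ⟨e⟩⟩ := X.property
  have := hK.isKProjective
  have h := CochainComplex.IsKProjective.Qh_map_bijective K Y.obj
  constructor
  · intro f g hfg
    ext
    rw [← cancel_epi e.inv]
    refine h.1 ?_
    rw [Functor.map_comp, Functor.map_comp]
    exact congrArg (_ ≫ ·) hfg
  · intro f
    obtain ⟨g, hg⟩ := h.2 (DerivedCategory.Qh.map e.inv ≫ f)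
    refine ⟨ObjectProperty.homMk (e.hom ≫ g), ?_⟩
    change DerivedCategory.Qh.map (e.hom ≫ g) = f
    rw [Functor.map_comp, hg, ← Category.assoc, ← Functor.map_comp, e.hom_inv_id]
    exact (congrArg (· ≫ f) (DerivedCategory.Qh.map_id _)).trans (Category.id_comp f)

instance : (homotopyPerfToDerived C).Full :=
  ⟨fun {X Y} => (homotopyPerfToDerived_map_bijective X Y).2⟩

instance : (homotopyPerfToDerived C).Faithful :=
  ⟨fun {X Y} _ _ h => (homotopyPerfToDerived_map_bijective X Y).1 h⟩

lemma isPerfect_homotopyPerfToDerived_obj (X : HomotopyPerf C) :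
    isPerfect C ((homotopyPerfToDerived C).obj X) := by
  obtain ⟨K, hK, ⟨e⟩⟩ := X.property
  exact ⟨K, hK, ⟨DerivedCategory.Qh.mapIso e⟩⟩

variable {k : Type u} [Field k] [Algebra k C] {V : Type} [Fintype V] {R : V → V → Prop}

/-- The homotopy category of strictly perfect complexes is generated by the projective modules at
the vertices. -/
lemma IncidenceBasis.prop_homotopyPerf (b : IncidenceBasis k C R) (rank : V → ℕ)
    (hinj : Function.Injective rank) (hrank : ∀ p q, R p q → p ≠ q → rank p < rank q)
    (P : ObjectProperty (HomotopyPerf C)) [P.IsTriangulated] [P.IsClosedUnderIsomorphisms]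
    (hP : ∀ p, P (b.projObj p)) (X : HomotopyPerf C) : P X := by
  -- Generation was shown in the derived category; `P` is transported there, and the conclusion is
  -- brought back by full faithfulness.
  have h := b.isPerfect_le_of_projMod (P := P.map (homotopyPerfToDerived C)) rank hinj hrank
    (fun p => ⟨b.projObj p, hP p, ⟨Iso.refl _⟩⟩) _ (isPerfect_homotopyPerfToDerived_obj X)
  obtain ⟨Y, hY, ⟨e⟩⟩ := h
  exact P.prop_of_iso ((homotopyPerfToDerived C).preimageIso e) hY

end QhPerf

/-! ### The complex of cochains with an action of an algebra -/

section HomComplexFunctor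

open CochainComplex HomComplex

variable {𝒞 : Type u₁} [Category.{u} 𝒞] [Preadditive 𝒞] {B : Type u} [Ring B]
  {X : CochainComplex 𝒞 ℤ} (ρ : B →+* End X)

/-- The right action of a ring on cochains given by an action on the source. -/
@[reducible]
def cochainModule (Z : CochainComplex 𝒞 ℤ) (n : ℤ) : Module Bᵐᵒᵖ (Cochain X Z n) where
  smul c γ := (Cochain.ofHom (ρ c.unop)).comp γ (zero_add n)
  one_smul γ := (congrArg (fun f : X ⟶ X => (Cochain.ofHom f).comp γ (zero_add n))
    (map_one ρ)).trans (Cochain.id_comp γ)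
  mul_smul c d γ := by
    refine (congrArg (fun f : X ⟶ X => (Cochain.ofHom f).comp γ (zero_add n))
      (map_mul ρ d.unop c.unop)).trans ?_
    refine (congrArg (fun x => Cochain.comp x γ (zero_add n))
      (Cochain.ofHom_comp (ρ c.unop) (ρ d.unop))).trans ?_
    exact Cochain.comp_assoc_of_first_is_zero_cochain _ _ _ _
  smul_zero _ := Cochain.comp_zero _ _
  smul_add _ _ _ := Cochain.comp_add _ _ _ _
  add_smul c d γ := (congrArg (fun f : X ⟶ X => (Cochain.ofHom f).comp γ (zero_add n))
    (map_add ρ c.unop d.unop)).trans ((congrArg (fun x => Cochain.comp x γ (zero_add n))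
      (Cochain.ofHom_add _ _)).trans (Cochain.add_comp _ _ _ _))
  zero_smul γ := (congrArg (fun f : X ⟶ X => (Cochain.ofHom f).comp γ (zero_add n))
    (map_zero ρ)).trans ((congrArg (fun x => Cochain.comp x γ (zero_add n))
      (Cochain.ofHom_zero _ _)).trans (Cochain.zero_comp _ _))

/-- The right module of cochains. -/
def homMod (Z : CochainComplex 𝒞 ℤ) (n : ℤ) : RightMod B :=
  @ModuleCat.of Bᵐᵒᵖ _ (Cochain X Z n) _ (cochainModule ρ Z n)

variable {Z W : CochainComplex 𝒞 ℤ}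

/-- A homomorphism between modules of cochains. -/
def homModHom {n m : ℤ} (f : Cochain X Z n →+ Cochain X W m)
    (hf : ∀ (b : B) (γ : Cochain X Z n), f ((Cochain.ofHom (ρ b)).comp γ (zero_add n)) =
      (Cochain.ofHom (ρ b)).comp (f γ) (zero_add m)) : homMod ρ Z n ⟶ homMod ρ W m :=
  @ModuleCat.ofHom Bᵐᵒᵖ _ (Cochain X Z n) (Cochain X W m) _ (cochainModule ρ Z n) _
    (cochainModule ρ W m) (@LinearMap.mk _ _ _ _ _ _ _ _ _ (cochainModule ρ Z n)
      (cochainModule ρ W m) ⟨f, f.map_add⟩ fun c γ => hf c.unop γ)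

lemma homMod_hom_ext {n : ℤ} {M : RightMod B} {f g : homMod ρ Z n ⟶ M}
    (h : ∀ γ : Cochain X Z n, f.hom γ = g.hom γ) : f = g :=
  ModuleCat.hom_ext (LinearMap.ext h)

lemma homMod_units_smul_hom {n : ℤ} (e : ℤˣ) {M : RightMod B} (f : M ⟶ homMod ρ Z n) (x : M) :
    (e • f).hom x = (e • (f.hom x : Cochain X Z n) : Cochain X Z n) := by
  rcases Int.units_eq_one_or e with rfl | rfl
  · exact (congrArg (fun g : M ⟶ homMod ρ Z n => g.hom x) (one_smul ℤˣ f)).trans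
      (one_smul ℤˣ (f.hom x : Cochain X Z n)).symm
  · refine (congrArg (fun g : M ⟶ homMod ρ Z n => g.hom x) ((Units.neg_smul 1 f).trans
      (congrArg Neg.neg (one_smul ℤˣ f)))).trans ?_
    exact ((Units.neg_smul 1 (f.hom x : Cochain X Z n)).trans
      (congrArg Neg.neg (one_smul ℤˣ (f.hom x : Cochain X Z n)))).symm

/-- The complex of cochains, as a complex of right modules. -/
def homObj (Z : CochainComplex 𝒞 ℤ) : CochainComplex (RightMod B) ℤ where
  X n := homMod ρ Z n
  d n m := homModHom ρ (δ_hom ℤ X Z n m).toAddMonoidHom fun _ _ => δ_ofHom_comp _ _ _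
  shape n m h := homMod_hom_ext ρ fun γ => δ_shape n m h γ
  d_comp_d' n m l _ _ := homMod_hom_ext ρ fun γ => δ_δ n m l γ

/-- Composition with a cochain. -/
def cochainPost (X : CochainComplex 𝒞 ℤ) {j : ℤ} (ζ : Cochain Z W j) (p q : ℤ) (h : p + j = q) :
    Cochain X Z p →+ Cochain X W q :=
  AddMonoidHom.mk' (fun γ => γ.comp ζ h) fun _ _ => Cochain.add_comp _ _ _ _

/-- The cochain between complexes of cochains given by composition with a cochain. -/
def homCochain {j : ℤ} (ζ : Cochain Z W j) : Cochain (homObj ρ Z) (homObj ρ W) j :=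
  Cochain.mk fun p q h => homModHom ρ (cochainPost X ζ p q h)
    fun _ _ => Cochain.comp_assoc_of_first_is_zero_cochain _ _ _ h

lemma homCochain_comp {U : CochainComplex 𝒞 ℤ} {i j l : ℤ} (ζ : Cochain Z W i) (ξ : Cochain W U j)
    (h : i + j = l) : homCochain ρ (ζ.comp ξ h) = (homCochain ρ ζ).comp (homCochain ρ ξ) h := by
  ext1 p q hpq
  rw [Cochain.comp_v _ _ h p (p + i) q rfl (by omega)]
  exact homMod_hom_ext ρ fun γ =>
    (Cochain.comp_assoc γ ζ ξ rfl h (show p + i + j = q by omega)).symm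

lemma homCochain_add {j : ℤ} (ζ ξ : Cochain Z W j) :
    homCochain ρ (ζ + ξ) = homCochain ρ ζ + homCochain ρ ξ := by
  ext1 p q hpq
  exact homMod_hom_ext ρ fun γ => Cochain.comp_add γ ζ ξ hpq

lemma homCochain_zero {j : ℤ} : homCochain ρ (0 : Cochain Z W j) = 0 := by
  ext1 p q hpq
  exact homMod_hom_ext ρ fun γ => Cochain.comp_zero γ hpq

lemma homCochain_neg {j : ℤ} (ζ : Cochain Z W j) : homCochain ρ (-ζ) = -homCochain ρ ζ := by
  rw [eq_neg_iff_add_eq_zero, ← homCochain_add, neg_add_cancel, homCochain_zero]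

lemma homCochain_id : homCochain ρ (Cochain.ofHom (𝟙 Z)) = Cochain.ofHom (𝟙 (homObj ρ Z)) := by
  ext1 p
  rw [Cochain.ofHom_v]
  exact homMod_hom_ext ρ fun γ => Cochain.comp_id _

/-- This is the graded Leibniz rule for `γ ≫ ζ`: the term with `δ γ` is precisely the sign-twisted
commutator term in the differential of a cochain between the Hom complexes. -/
lemma δ_homCochain {i j : ℤ} (ζ : Cochain Z W i) (h : i + 1 = j) :
    δ i j (homCochain ρ ζ) = homCochain ρ (δ i j ζ) := by
  ext1 p q hpq
  rw [δ_v i j h _ p q hpq (q - 1) (p + 1) rfl rfl]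
  refine homMod_hom_ext ρ fun γ => ?_
  have h₁ := δ_comp γ ζ (show p + i = q - 1 by omega) (p + 1) j q (by omega) rfl h
  have hj : j.negOnePow = -i.negOnePow := by rw [← h, Int.negOnePow_succ]
  have h₂ : (γ.comp (δ i j ζ) (show p + j = q by omega) : Cochain X W q) =
      δ (q - 1) q (γ.comp ζ (show p + i = q - 1 by omega)) +
        j.negOnePow • ((δ p (p + 1) γ).comp ζ (show p + 1 + i = q by omega) : Cochain X W q) := by
    rw [h₁, hj, Units.neg_smul, add_neg_cancel_right]
  refine Eq.trans ?_ h₂.symm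
  exact congrArg (δ (q - 1) q (γ.comp ζ (show p + i = q - 1 by omega)) + ·)
    (homMod_units_smul_hom ρ j.negOnePow ((homObj ρ Z).d p (p + 1) ≫
      (homCochain ρ ζ).v (p + 1) q (by omega)) γ)

/-- The functoriality of the complex of cochains. -/
def homMap (φ : Z ⟶ W) : homObj ρ Z ⟶ homObj ρ W where
  f n := (homCochain ρ (Cochain.ofHom φ)).v n n (add_zero n)
  comm' _ m _ := homMod_hom_ext ρ fun γ => δ_comp_ofHom γ φ m

lemma ofHom_homMap (φ : Z ⟶ W) :
    Cochain.ofHom (homMap ρ φ) = homCochain ρ (Cochain.ofHom φ) := by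
  ext1 p
  rw [Cochain.ofHom_v]
  rfl

/-- The functor sending a complex to the complex of cochains from `X`, with the action of a ring
given by an action on `X`. -/
def homFunctor : CochainComplex 𝒞 ℤ ⥤ CochainComplex (RightMod B) ℤ where
  obj := homObj ρ
  map := homMap ρ
  map_id Z := Cochain.ofHom_injective (by rw [ofHom_homMap, homCochain_id])
  map_comp φ ψ := Cochain.ofHom_injective (by
    rw [ofHom_homMap, Cochain.ofHom_comp, homCochain_comp, Cochain.ofHom_comp, ofHom_homMap,
      ofHom_homMap])

instance : (homFunctor ρ).Additive where
  map_add {Z W φ ψ} := Cochain.ofHom_injective (by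
    change Cochain.ofHom (homMap ρ (φ + ψ)) = Cochain.ofHom (homMap ρ φ + homMap ρ ψ)
    rw [ofHom_homMap, Cochain.ofHom_add, homCochain_add, Cochain.ofHom_add, ofHom_homMap,
      ofHom_homMap])

variable {ρ} in
/-- The functor of cochains preserves homotopies. -/
lemma nonempty_homotopy_homMap {φ ψ : Z ⟶ W} (h : Homotopy φ ψ) :
    Nonempty (Homotopy (homMap ρ φ) (homMap ρ ψ)) := by
  obtain ⟨z, hz⟩ := Cochain.equivHomotopy φ ψ h
  refine ⟨(Cochain.equivHomotopy _ _).symm ⟨homCochain ρ z, ?_⟩⟩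
  rw [ofHom_homMap, hz, homCochain_add, δ_homCochain ρ z (neg_add_cancel 1), ofHom_homMap]

/-! ### Compatibility with the shift -/

/-- The functor of cochains commutes with the shift, in every degree. -/
def homShiftXIso (Z : CochainComplex 𝒞 ℤ) (n p : ℤ) :
    homMod ρ (Z⟦n⟧) p ≅ homMod ρ Z (p + n) where
  hom := homModHom ρ (Cochain.rightShiftAddEquiv X Z (p + n) n p rfl).symm.toAddMonoidHom
    fun _ γ => Cochain.rightUnshift_comp _ γ (zero_add p) (p + n) rfl (p + n) rfl
  inv := homModHom ρ (Cochain.rightShiftAddEquiv X Z (p + n) n p rfl).toAddMonoidHom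
    fun b γ => (Cochain.rightShiftAddEquiv X Z (p + n) n p rfl).symm.injective <|
      (Cochain.rightUnshift_rightShift _ n p rfl).trans <| Eq.symm <|
        (Cochain.rightUnshift_comp (Cochain.ofHom (ρ b)) (γ.rightShift n p rfl) (zero_add p) (p + n)
          rfl (p + n) rfl).trans <|
            congrArg (fun x => Cochain.comp _ x _) (Cochain.rightUnshift_rightShift _ _ _ _)
  hom_inv_id := homMod_hom_ext ρ fun γ => Cochain.rightShift_rightUnshift γ (p + n) rfl
  inv_hom_id := homMod_hom_ext ρ fun γ => Cochain.rightUnshift_rightShift γ n p rfl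

/-- The functor of cochains commutes with the shift. -/
def homShiftIso (Z : CochainComplex 𝒞 ℤ) (n : ℤ) : homObj ρ (Z⟦n⟧) ≅ (homObj ρ Z)⟦n⟧ :=
  HomologicalComplex.Hom.isoOfComponents (homShiftXIso ρ Z n) fun p q hpq =>
    homMod_hom_ext ρ fun γ => by
      obtain rfl : p + 1 = q := hpq
      have h := Cochain.δ_rightUnshift γ (p + n) rfl (p + 1 + n) (p + 1) rfl
      have h' : n.negOnePow • δ (p + n) (p + 1 + n) (γ.rightUnshift (p + n) rfl) =
          (δ p (p + 1) γ).rightUnshift (p + 1 + n) rfl := by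
        rw [h, smul_smul, Int.units_mul_self, one_smul]
      refine Eq.trans ?_ h'
      exact homMod_units_smul_hom ρ n.negOnePow ((homObj ρ Z).d (p + n) (p + 1 + n))
        (γ.rightUnshift (p + n) rfl)

lemma rightUnshift_comp_ofHom_shift (n p : ℤ) (γ : Cochain X (Z⟦n⟧) p) (φ : Z ⟶ W) :
    (γ.comp (Cochain.ofHom (φ⟦n⟧')) (add_zero p)).rightUnshift (p + n) rfl =
      (γ.rightUnshift (p + n) rfl).comp (Cochain.ofHom φ) (add_zero (p + n)) := by
  ext a c hac
  rw [Cochain.comp_zero_cochain_v, Cochain.rightUnshift_v _ _ _ a c hac (a + p) rfl,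
    Cochain.rightUnshift_v _ _ _ a c hac (a + p) rfl, Cochain.comp_zero_cochain_v]
  obtain rfl : a + p + n = c := by omega
  simp
  exact congrArg (· ≫ _) (Category.comp_id _).symm

/-- The functor of cochains commutes with the shift, naturally. -/
def homFunctorShiftIso (n : ℤ) :
    CategoryTheory.shiftFunctor (CochainComplex 𝒞 ℤ) n ⋙ homFunctor ρ ≅
      homFunctor ρ ⋙ CategoryTheory.shiftFunctor (CochainComplex (RightMod B) ℤ) n :=
  NatIso.ofComponents (fun Z => homShiftIso ρ Z n) fun {Z W} φ => by
    ext1 p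
    exact homMod_hom_ext ρ fun γ => rightUnshift_comp_ofHom_shift n p γ φ

lemma homObj_XIsoOfEq_v {p q : ℤ} (h : p = q) (γ : Cochain X Z p) (a c : ℤ) (hac : a + q = c) :
    (((homObj ρ Z).XIsoOfEq h).hom.hom γ : Cochain X Z q).v a c hac = γ.v a c (by omega) := by
  subst h
  rfl

lemma rightUnshift_zero_v (p : ℤ) (γ : Cochain X (Z⟦(0 : ℤ)⟧) p) (a c : ℤ) (hac : a + (p + 0) = c) :
    (γ.rightUnshift (p + 0) rfl).v a c hac =
      (γ.comp (Cochain.ofHom ((shiftFunctorZero (CochainComplex 𝒞 ℤ) ℤ).hom.app Z))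
        (add_zero p)).v a c (by omega) := by
  obtain rfl : c = a + p := by omega
  rw [Cochain.rightUnshift_v _ _ _ _ _ _ _ rfl, Cochain.comp_zero_cochain_v, Cochain.ofHom_v,
    shiftFunctorZero_hom_app_f]
  rfl

lemma rightUnshift_add_v (n m p : ℤ) (γ : Cochain X (Z⟦n + m⟧) p) (a c : ℤ)
    (hac : a + (p + (n + m)) = c) :
    (γ.rightUnshift (p + (n + m)) rfl).v a c hac =
      (((γ.comp (Cochain.ofHom ((shiftFunctorAdd (CochainComplex 𝒞 ℤ) n m).hom.app Z))
        (add_zero p)).rightUnshift (p + m) rfl).rightUnshift (p + m + n) rfl).v a c (by omega) := by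
  rw [Cochain.rightUnshift_v _ _ _ _ _ _ _ rfl, Cochain.rightUnshift_v _ _ _ _ _ _ _ rfl,
    Cochain.rightUnshift_v _ _ _ _ _ _ (a + p) rfl, Cochain.comp_zero_cochain_v, Cochain.ofHom_v,
    shiftFunctorAdd_hom_app_f]
  have key : ∀ {i j l r : ℤ} (f : X.X a ⟶ Z.X i) (h₁ : i = j) (h₂ : j = l) (h₃ : l = r)
      (h : i = r), f ≫ (Z.XIsoOfEq h).hom =
        ((f ≫ (Z.XIsoOfEq h₁).hom) ≫ (Z.XIsoOfEq h₂).hom) ≫ (Z.XIsoOfEq h₃).hom := by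
    rintro i _ _ _ f rfl rfl rfl _
    simp
  exact key _ _ (show a + p + m + n = a + (p + m) + n by omega) _ _

/-- On components the shift comparison only renames degrees, so both coherence conditions reduce to
composites of the isomorphisms `XIsoOfEq`. -/
instance : (homFunctor ρ).CommShift ℤ where
  commShiftIso := homFunctorShiftIso ρ
  commShiftIso_zero := by
    ext1
    ext1
    funext Z
    rw [Functor.CommShift.isoZero_hom_app]
    ext1 p
    refine homMod_hom_ext ρ fun γ => ?_
    refine Cochain.ext (F := X) (G := Z) (n := p + 0) _ _ fun a c hac => ?_
    refine (rightUnshift_zero_v p γ a c hac).trans ?_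
    exact (homObj_XIsoOfEq_v ρ (add_zero p).symm _ a c hac).symm
  commShiftIso_add n m := by
    ext1
    ext1
    funext Z
    rw [Functor.CommShift.isoAdd_hom_app]
    ext1 p
    refine homMod_hom_ext ρ fun γ => ?_
    refine Cochain.ext (F := X) (G := Z) (n := p + (n + m)) _ _ fun a c hac => ?_
    refine (rightUnshift_add_v n m p γ a c hac).trans ?_
    exact (homObj_XIsoOfEq_v ρ (by omega : p + m + n = p + (n + m)) _ a c hac).symm

end HomComplexFunctor

/-! ### Compatibility with mapping cones and the homotopy category -/

section HomComplexTriangles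

open CochainComplex HomComplex

variable {𝒞 : Type u₁} [Category.{u} 𝒞] [Preadditive 𝒞] {B : Type u} [Ring B]
  {X : CochainComplex 𝒞 ℤ} (ρ : B →+* End X)

section Cone

variable [HasBinaryBiproducts 𝒞] {Z W : CochainComplex 𝒞 ℤ} (φ : Z ⟶ W)

/-- The canonical map from the cone of a map of complexes of cochains. -/
def homConeDesc : mappingCone (homMap ρ φ) ⟶ homObj ρ (mappingCone φ) :=
  mappingCone.desc _ (homCochain ρ (mappingCone.inl φ)) (homMap ρ (mappingCone.inr φ)) (by
    rw [δ_homCochain ρ _ (neg_add_cancel 1), mappingCone.δ_inl, Cochain.ofHom_comp,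
      homCochain_comp, Cochain.ofHom_comp, ofHom_homMap, ofHom_homMap])

/-- The canonical map to the cone of a map of complexes of cochains. -/
def homConeLift : homObj ρ (mappingCone φ) ⟶ mappingCone (homMap ρ φ) :=
  mappingCone.lift _ (Cocycle.mk (homCochain ρ (mappingCone.fst φ).1) 2 rfl
      ((δ_homCochain ρ _ rfl).trans ((congrArg (homCochain ρ)
        ((mappingCone.fst φ).δ_eq_zero 2)).trans (homCochain_zero ρ))))
    (homCochain ρ (mappingCone.snd φ)) (by
      rw [δ_homCochain ρ _ (zero_add 1), mappingCone.δ_snd, homCochain_neg, homCochain_comp,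
        ofHom_homMap]
      exact neg_add_cancel _)

lemma homConeDesc_homConeLift : homConeDesc ρ φ ≫ homConeLift ρ φ = 𝟙 _ := by
  apply Cochain.ofHom_injective
  rw [Cochain.ofHom_comp, homConeDesc, homConeLift, mappingCone.ofHom_desc, mappingCone.ofHom_lift,
    mappingCone.ext_cochain_from_iff _ (-1) 0 (neg_add_cancel 1)]
  constructor
  · rw [← Cochain.comp_assoc_of_second_is_zero_cochain, mappingCone.inl_descCochain,
      mappingCone.ext_cochain_to_iff _ (-1) 0 (neg_add_cancel 1)]
    constructor
    · simp [← homCochain_comp, homCochain_id]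
    · simp [← homCochain_comp, homCochain_zero]
  · rw [← Cochain.comp_assoc_of_second_is_zero_cochain, mappingCone.inr_descCochain,
      mappingCone.ext_cochain_to_iff _ 0 1 (zero_add 1)]
    constructor
    · simp [← homCochain_comp, ofHom_homMap, homCochain_zero]
    · simp [← homCochain_comp, ofHom_homMap, homCochain_id]

lemma homConeLift_homConeDesc : homConeLift ρ φ ≫ homConeDesc ρ φ = 𝟙 _ := by
  apply Cochain.ofHom_injective
  rw [Cochain.ofHom_comp, homConeDesc, homConeLift, mappingCone.ofHom_desc, mappingCone.ofHom_lift,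
    mappingCone.liftCochain_descCochain, ofHom_homMap]
  refine ((congrArg₂ (· + ·) (homCochain_comp ρ _ _ _) (homCochain_comp ρ _ _ _)).symm.trans
    (homCochain_add ρ _ _).symm).trans ?_
  exact (congrArg (homCochain ρ) (mappingCone.id φ)).trans (homCochain_id ρ)

/-- The functor of cochains preserves mapping cones. -/
def homConeIso : homObj ρ (mappingCone φ) ≅ mappingCone (homMap ρ φ) where
  hom := homConeLift ρ φ
  inv := homConeDesc ρ φ
  hom_inv_id := homConeLift_homConeDesc ρ φ
  inv_hom_id := homConeDesc_homConeLift ρ φ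

lemma homMap_inr_homConeLift :
    homMap ρ (mappingCone.inr φ) ≫ homConeLift ρ φ = mappingCone.inr (homMap ρ φ) := by
  have h : mappingCone.inr (homMap ρ φ) ≫ homConeDesc ρ φ = homMap ρ (mappingCone.inr φ) :=
    mappingCone.inr_desc _ _ _ _
  rw [← h, Category.assoc, homConeDesc_homConeLift, Category.comp_id]

lemma triangle_mor₃_f {𝒟 : Type*} [Category* 𝒟] [Preadditive 𝒟] [HasBinaryBiproducts 𝒟]
    {K L : CochainComplex 𝒟 ℤ} (ψ : K ⟶ L) (p : ℤ) :
    (mappingCone.triangle ψ).mor₃.f p = -(mappingCone.fst ψ).1.v p (p + 1) rfl := by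
  have h : (mappingCone.triangle ψ).mor₃.f p =
      ((-(mappingCone.fst ψ).1).rightShift 1 0 (zero_add 1)).v p p (add_zero p) := rfl
  rw [h, Cochain.rightShift_v _ 1 0 _ p p (add_zero p) (p + 1) rfl, Cochain.neg_v]
  exact Category.comp_id _

/-- The connecting morphisms of both standard triangles are `-fst` up to reindexing, so no extra
sign appears in `homTriangleIso`. -/
lemma rightUnshift_comp_triangle_mor₃ (p : ℤ) (γ : Cochain X (mappingCone φ) p) :
    (γ.comp (Cochain.ofHom (mappingCone.triangle φ).mor₃) (add_zero p)).rightUnshift (p + 1) rfl =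
      -(γ.comp (mappingCone.fst φ).1 rfl) := by
  have h : Cochain.ofHom (mappingCone.triangle φ).mor₃ =
      (-(mappingCone.fst φ).1).rightShift 1 0 (zero_add 1) :=
    Cocycle.cochain_ofHom_homOf_eq_coe _
  refine (Cochain.rightUnshift_comp _ _ _ _ _ 1 (zero_add 1)).trans ?_
  refine (congrArg (fun β : Cochain (mappingCone φ) (Z⟦(1 : ℤ)⟧) 0 =>
    γ.comp (β.rightUnshift 1 (zero_add 1)) rfl) h).trans ?_
  rw [Cochain.rightUnshift_rightShift, Cochain.comp_neg]

/-- The functor of cochains preserves the standard triangles. -/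
def homTriangleIso : (homFunctor ρ).mapTriangle.obj (mappingCone.triangle φ) ≅
    mappingCone.triangle (homMap ρ φ) :=
  Triangle.isoMk _ _ (Iso.refl _) (Iso.refl _) (homConeIso ρ φ)
    ((Category.comp_id _).trans (Category.id_comp _).symm)
    ((homMap_inr_homConeLift ρ φ).trans (Category.id_comp _).symm)
    (by
      refine Eq.trans ((congrArg _ (CategoryTheory.Functor.map_id _ _)).trans
        (Category.comp_id _)) ?_
      ext1 p
      refine homMod_hom_ext ρ fun γ => ?_
      refine (rightUnshift_comp_triangle_mor₃ φ p γ).trans ?_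
      have h : ((homConeLift ρ φ) ≫ (mappingCone.triangle (homMap ρ φ)).mor₃).f p =
          -(homCochain ρ (mappingCone.fst φ).1).v p (p + 1) rfl := by
        refine (congrArg ((homConeLift ρ φ).f p ≫ ·) (triangle_mor₃_f _ _)).trans ?_
        refine (Preadditive.comp_neg _ _).trans (congrArg Neg.neg ?_)
        exact mappingCone.lift_f_fst_v _ _ _ _ _ _ _
      exact (congrArg (fun g => (ModuleCat.Hom.hom g) γ) h).symm)

end Cone

section Linear

variable {k : Type u} [Field k] [Algebra k B] [Linear k 𝒞] (σ : B →ₐ[k] End X)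

/-- Scalars act on the Hom modules through `B`, by precomposition, but on morphisms by
postcomposition; the two agree because `σ` is `k`-linear. -/
instance : (homFunctor (σ : B →+* End X)).Linear k where
  map_smul {Z W} φ c := by
    ext1 n
    refine homMod_hom_ext _ fun γ => ?_
    refine Eq.trans (b := (Cochain.ofHom (σ (algebraMap k B c))).comp
      (γ.comp (Cochain.ofHom φ) (add_zero n)) (zero_add n)) ?_ rfl
    refine Eq.trans ?_ (congrArg (fun f : X ⟶ X => (Cochain.ofHom f).comp
      (γ.comp (Cochain.ofHom φ) (add_zero n)) (zero_add n)) (σ.commutes c).symm)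
    change γ.comp (Cochain.ofHom (c • φ)) (add_zero n) = (Cochain.ofHom (c • 𝟙 X)).comp
      (γ.comp (Cochain.ofHom φ) (add_zero n)) (zero_add n)
    ext p q hpq
    simp

end Linear

section HomotopyCategory

open HomologicalComplex

/-- The functor of cochains on homotopy categories. -/
def homHomotopyFunctor : HomotopyCategory 𝒞 (ComplexShape.up ℤ) ⥤
    HomotopyCategory (RightMod B) (ComplexShape.up ℤ) :=
  CategoryTheory.Quotient.lift _ (homFunctor ρ ⋙ HomotopyCategory.quotient _ _)
    fun _ _ _ _ ⟨h⟩ => HomotopyCategory.eq_of_homotopy _ _ (nonempty_homotopy_homMap h).some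

/-- The functor of cochains on homotopy categories is induced by that on complexes. -/
def homHomotopyFunctorFactors : HomotopyCategory.quotient 𝒞 (ComplexShape.up ℤ) ⋙
    homHomotopyFunctor ρ ≅ homFunctor ρ ⋙ HomotopyCategory.quotient _ _ :=
  CategoryTheory.Quotient.lift.isLift _ _ _

instance : (homHomotopyFunctor ρ).CommShift ℤ :=
  CategoryTheory.Quotient.liftCommShift _ _ _ _

instance : NatTrans.CommShift (homHomotopyFunctorFactors ρ).hom ℤ :=
  CategoryTheory.Quotient.liftCommShift_compatibility _ _ _ _

instance : (homHomotopyFunctor ρ).Additive where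
  map_add {Z W φ ψ} := by
    obtain ⟨Z⟩ := Z
    obtain ⟨W⟩ := W
    obtain ⟨φ : Z ⟶ W, rfl⟩ := (HomotopyCategory.quotient _ _).map_surjective φ
    obtain ⟨ψ : Z ⟶ W, rfl⟩ := (HomotopyCategory.quotient _ _).map_surjective ψ
    refine (congrArg (homHomotopyFunctor ρ).map
      ((HomotopyCategory.quotient _ _).map_add (f := φ) (g := ψ))).symm.trans ?_
    exact (congrArg (HomotopyCategory.quotient _ _).map ((homFunctor ρ).map_add (f := φ) (g := ψ))).trans (Functor.map_add _)

instance {k : Type u} [Field k] [Algebra k B] [Linear k 𝒞] (σ : B →ₐ[k] End X) :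
    (homHomotopyFunctor (σ : B →+* End X)).Linear k where
  map_smul {Z W} φ c := by
    obtain ⟨Z⟩ := Z
    obtain ⟨W⟩ := W
    obtain ⟨φ : Z ⟶ W, rfl⟩ := (HomotopyCategory.quotient _ _).map_surjective φ
    refine (congrArg (homHomotopyFunctor (σ : B →+* End X)).map
      ((HomotopyCategory.quotient _ _).map_smul c φ)).symm.trans ?_
    exact (congrArg (HomotopyCategory.quotient _ _).map ((homFunctor (σ : B →+* End X)).map_smul c φ)).trans (Functor.map_smul _ _ _)

/-- The functor of cochains preserves the standard triangles of the homotopy category. -/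
def homTrianglehIso [HasBinaryBiproducts 𝒞] {Z W : CochainComplex 𝒞 ℤ} (φ : Z ⟶ W) :
    (homHomotopyFunctor ρ).mapTriangle.obj (mappingCone.triangleh φ) ≅
      mappingCone.triangleh (homMap ρ φ) :=
  (Functor.mapTriangleCompIso _ _).symm.app _ ≪≫
    (Functor.mapTriangleIso (homHomotopyFunctorFactors ρ)).app _ ≪≫
    (Functor.mapTriangleCompIso _ _).app _ ≪≫
    (HomotopyCategory.quotient _ (ComplexShape.up ℤ)).mapTriangle.mapIso (homTriangleIso ρ φ)

instance [HasBinaryBiproducts 𝒞] [HasZeroObject 𝒞] : (homHomotopyFunctor ρ).IsTriangulated where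
  map_distinguished := by
    rintro T ⟨K, L, f, ⟨e⟩⟩
    exact ⟨_, _, _, ⟨(homHomotopyFunctor ρ).mapTriangle.mapIso e ≪≫ homTrianglehIso ρ f⟩⟩

end HomotopyCategory

end HomComplexTriangles

/-! ### A criterion for quasi-isomorphisms -/

-- As `S` has zero differential, it is its own cohomology. The hypotheses say that `q` is surjective
-- and injective on cohomology, so a cocycle of the cone has zero component in `S` and its component
-- in `L` bounds.
open CochainComplex in
lemma exactAt_mappingCone_of_d_eq_zero {Λ : Type u} [Ring Λ]
    {S L : CochainComplex (ModuleCat.{u} Λ) ℤ} (q : S ⟶ L) (hS : ∀ i j, S.d i j = 0)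
    (hsurj : ∀ l n m : ℤ, l + 1 = n → n + 1 = m → ∀ γ : L.X n, (L.d n m).hom γ = 0 →
      ∃ (s : S.X n) (η : L.X l), γ = (q.f n).hom s + (L.d l n).hom η)
    (hinj : ∀ n m : ℤ, n + 1 = m → ∀ (s : S.X m) (η : L.X n),
      (q.f m).hom s = (L.d n m).hom η → s = 0) (n : ℤ) :
    (mappingCone q).ExactAt n := by
  rw [HomologicalComplex.exactAt_iff' _ (n - 1) n (n + 1) (by simp) (by simp),
    ShortComplex.moduleCat_exact_iff]
  intro x hx
  change ((mappingCone q).d n (n + 1)).hom x = 0 at hx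
  change ∃ y, ((mappingCone q).d (n - 1) n).hom y = x
  have h₁ : (q.f (n + 1)).hom (((mappingCone.fst q).1.v n (n + 1) rfl).hom x) +
      (L.d n (n + 1)).hom (((mappingCone.snd q).v n n (add_zero n)).hom x) = 0 := by
    refine (congrArg (fun g => (ModuleCat.Hom.hom g) x)
      (mappingCone.d_snd_v q n (n + 1) rfl)).symm.trans ?_
    exact (congrArg ((mappingCone.snd q).v (n + 1) (n + 1) (add_zero _)).hom hx).trans (map_zero _)
  have hs : ((mappingCone.fst q).1.v n (n + 1) rfl).hom x = 0 := by
    refine hinj n (n + 1) rfl _ (-((mappingCone.snd q).v n n (add_zero n)).hom x) ?_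
    rw [map_neg]
    exact eq_neg_of_add_eq_zero_left h₁
  rw [hs, map_zero, zero_add] at h₁
  obtain ⟨s, η, hη⟩ := hsurj (n - 1) n (n + 1) (by omega) rfl _ h₁
  have hx' : x = ((mappingCone.inr q).f n).hom (((mappingCone.snd q).v n n (add_zero n)).hom x) := by
    have h := congrArg (fun g => (ModuleCat.Hom.hom g) x) (mappingCone.id_X q n (n + 1) rfl)
    refine h.symm.trans ?_
    change ((mappingCone.inl q).v (n + 1) n (by omega)).hom
      (((mappingCone.fst q).1.v n (n + 1) rfl).hom x) + _ = _
    rw [hs, map_zero, zero_add]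
    rfl
  refine ⟨((mappingCone.inl q).v n (n - 1) rfl).hom s + ((mappingCone.inr q).f (n - 1)).hom η, ?_⟩
  rw [hx', hη, map_add, map_add]
  congr 1
  · have h := congrArg (fun g => (ModuleCat.Hom.hom g) s)
      (mappingCone.inl_v_d q n (n - 1) (n + 1) rfl (by omega))
    rw [hS, zero_comp, sub_zero] at h
    exact h
  · exact congrArg (fun g => (ModuleCat.Hom.hom g) η) (mappingCone.inr_f_d q (n - 1) n)

open CochainComplex in
lemma isIso_Qh_of_d_eq_zero {Λ : Type u} [Ring Λ]
    {S L : CochainComplex (RightMod Λ) ℤ} (q : S ⟶ L) (hS : ∀ i j, S.d i j = 0)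
    (hsurj : ∀ l n m : ℤ, l + 1 = n → n + 1 = m → ∀ γ : L.X n, (L.d n m).hom γ = 0 →
      ∃ (s : S.X n) (η : L.X l), γ = (q.f n).hom s + (L.d l n).hom η)
    (hinj : ∀ n m : ℤ, n + 1 = m → ∀ (s : S.X m) (η : L.X n),
      (q.f m).hom s = (L.d n m).hom η → s = 0) :
    IsIso (DerivedCategory.Qh.map ((HomotopyCategory.quotient _ (ComplexShape.up ℤ)).map q)) := by
  apply Localization.inverts (DerivedCategory.Qh (C := RightMod Λ))
    (HomotopyCategory.quasiIso (RightMod Λ) (ComplexShape.up ℤ))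
  rw [HomotopyCategory.quasiIso_eq_trW_subcategoryAcyclic]
  refine ⟨_, _, _, HomotopyCategory.mappingCone_triangleh_distinguished q, ?_⟩
  exact (HomotopyCategory.quotient_obj_mem_subcategoryAcyclic_iff_exactAt _).2
    (exactAt_mappingCone_of_d_eq_zero q hS hsurj hinj)

/-! ### Thin collections of complexes -/

section ThinComplexes

open CochainComplex HomComplex

variable {A : Type u} [Ring A] {K L : CochainComplex (RightMod A) ℤ}

lemma toHomotopyPerfMap_eq_zero_iff (hK : IsStrictlyPerfect A K) (hL : IsStrictlyPerfect A L)
    (φ : K ⟶ L) : toHomotopyPerfMap hK hL φ = 0 ↔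
      ∃ η : Cochain K L (-1), Cochain.ofHom φ = δ (-1) 0 η := by
  have h : toHomotopyPerfMap hK hL φ = 0 ↔
      (HomotopyCategory.quotient _ (ComplexShape.up ℤ)).map φ = 0 :=
    ⟨fun h => congrArg (fun g => g.hom) h, fun h => by ext; exact h⟩
  rw [h, HomotopyCategory.quotient_map_eq_zero_iff]
  refine (Cochain.equivHomotopy φ 0).nonempty_congr.trans ?_
  simp

lemma exists_δ_eq_of_hom_shift_eq_zero (hK : IsStrictlyPerfect A K) (hL : IsStrictlyPerfect A L)
    (n m : ℤ) (hm : m + 1 = n) (h : ∀ f : hK.toHomotopyPerf ⟶ hL.toHomotopyPerf⟦n⟧, f = 0)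
    (γ : Cochain K L n) (hγ : δ n (n + 1) γ = 0) : ∃ η : Cochain K L m, γ = δ m n η := by
  let Q := HomotopyCategory.quotient (RightMod A) (ComplexShape.up ℤ)
  let e : (hL.toHomotopyPerf⟦n⟧).obj ≅ Q.obj (L⟦n⟧) :=
    ((isHomotopyPerfect A).ι.commShiftIso n).app hL.toHomotopyPerf ≪≫ ((Q.commShiftIso n).app L).symm
  let x : Cocycle K L n := Cocycle.mk γ (n + 1) rfl hγ
  have hx : CohomologyClass.toHom (CohomologyClass.mk x) = 0 := by
    have h₀ := congrArg (fun g => g.hom)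
      (h (ObjectProperty.homMk (CohomologyClass.toHom (CohomologyClass.mk x) ≫ e.inv)))
    change CohomologyClass.toHom (CohomologyClass.mk x) ≫ e.inv = 0 at h₀
    rw [← cancel_mono e.inv, h₀, zero_comp]
  rw [CohomologyClass.toHom_mk_eq_zero_iff, mem_coboundaries_iff _ m hm] at hx
  obtain ⟨η, hη⟩ := hx
  exact ⟨η, hη.symm⟩

end ThinComplexes

/-! ### The tilting functor of a thin collection of complexes -/

section Tilting

open CochainComplex HomComplex

variable {k : Type u} [Field k] {A : Type u} [Ring A] [Algebra k A] {C : Type u} [Ring C]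
  [Algebra k C] {V : Type} [Fintype V] {R : V → V → Prop} {b : IncidenceBasis k C R}
  {K : V → CochainComplex (RightMod A) ℤ} (m : b.Representation K)

instance (A : Type u) [Ring A] : HasFiniteBiproducts (CochainComplex (RightMod A) ℤ) :=
  HasFiniteBiproducts.of_hasFiniteProducts

namespace IncidenceBasis.Representation

/-- The action on the direct sum, as a ring homomorphism. -/
abbrev ringHom : C →+* End (⨁ K) := (m.toEnd : C →+* End (⨁ K))

lemma toEnd_idem (p : V) :
    m.toEnd (b.idem p) = biproduct.π K p ≫ biproduct.ι K p := by
  refine (m.toEnd_basis (b.refl p)).trans ?_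
  rw [m.map_refl, Category.id_comp]

lemma toEnd_idem_π (p : V) :
    (m.toEnd (b.idem p) : ⨁ K ⟶ ⨁ K) ≫ biproduct.π K p = biproduct.π K p := by
  rw [toEnd_idem, Category.assoc, biproduct.ι_π_self, Category.comp_id]

/-- The morphism from a projective module to a complex of cochains given by a cocycle. -/
def projCocycle (p : V) {Z : CochainComplex (RightMod A) ℤ} (g : ⨁ K ⟶ Z) :
    b.projComplex p ⟶ homObj m.ringHom Z :=
  HomologicalComplex.mkHomFromSingle (b.projDesc p (homMod m.ringHom Z 0) (Cochain.ofHom g))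
    fun j _ => b.projMod_hom_ext (by
      change δ 0 j ((Cochain.ofHom (m.toEnd (b.idem p))).comp (Cochain.ofHom g) (zero_add 0)) = 0
      rw [← Cochain.ofHom_comp, δ_ofHom])

/-- The generator of a projective module, in its stalk complex. -/
def gen (b : IncidenceBasis k C R) (p : V) : (b.projComplex p).X 0 :=
  ((HomologicalComplex.singleObjXSelf (ComplexShape.up ℤ) 0 (b.projMod p)).inv).hom (b.projGen p)

lemma projComplex_hom_ext {p : V} {L : CochainComplex (RightMod C) ℤ}
    {φ ψ : b.projComplex p ⟶ L} (h : (φ.f 0).hom (gen b p) = (ψ.f 0).hom (gen b p)) : φ = ψ := by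
  refine HomologicalComplex.from_single_hom_ext ?_
  rw [← cancel_epi (HomologicalComplex.singleObjXSelf (ComplexShape.up ℤ) 0 (b.projMod p)).inv]
  exact b.projMod_hom_ext h

lemma projCocycle_f_gen (p : V) {Z : CochainComplex (RightMod A) ℤ} (g : ⨁ K ⟶ Z) :
    (((m.projCocycle p g).f 0).hom (gen b p) : Cochain (⨁ K) Z 0) =
      Cochain.ofHom (m.toEnd (b.idem p) ≫ g) := by
  refine Eq.trans ?_ (Cochain.ofHom_comp _ _).symm
  have h : (HomologicalComplex.singleObjXSelf (ComplexShape.up ℤ) 0 (b.projMod p)).inv ≫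
      (m.projCocycle p g).f 0 = b.projDesc p (homMod m.ringHom Z 0) (Cochain.ofHom g) :=
    (congrArg (_ ≫ ·) (HomologicalComplex.mkHomFromSingle_f _ _)).trans
      (Iso.inv_hom_id_assoc _ _)
  have h' : (b.projDesc p (homMod m.ringHom Z 0) (Cochain.ofHom g)).hom (b.projGen p) =
      (Cochain.ofHom (m.toEnd (b.idem p))).comp (Cochain.ofHom g) (zero_add 0) := rfl
  refine Eq.trans ?_ h'
  exact congrArg (fun f : b.projMod p ⟶ homMod m.ringHom Z 0 => f.hom (b.projGen p)) h

/-- A chain map out of the stalk of `e_p C` is determined by the image of the generator. This is a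
cocycle of degree zero fixed by `e_p`, that is, a chain map out of `⨁ K`. -/
lemma exists_projCocycle (p : V) {Z : CochainComplex (RightMod A) ℤ}
    (φ : b.projComplex p ⟶ homObj m.ringHom Z) : ∃ g : ⨁ K ⟶ Z, φ = m.projCocycle p g := by
  let γ : Cochain (⨁ K) Z 0 := (φ.f 0).hom (gen b p)
  have hγ : δ 0 1 γ = 0 := by
    have h := congrArg (fun f => (ModuleCat.Hom.hom f) (gen b p)) (φ.comm 0 1)
    refine h.trans ?_
    have h' : (b.projComplex p).d 0 1 = 0 := HomologicalComplex.single_obj_d _ _ _ _ _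
    refine (congrArg (fun f => (ModuleCat.Hom.hom (f ≫ φ.f 1)) (gen b p)) h').trans ?_
    exact congrArg (fun f => (ModuleCat.Hom.hom f) (gen b p)) (zero_comp (f := φ.f 1))
  let g : ⨁ K ⟶ Z := Cocycle.homOf (Cocycle.mk γ 1 rfl hγ)
  have hg : Cochain.ofHom g = γ := Cocycle.cochain_ofHom_homOf_eq_coe _
  refine ⟨g, projComplex_hom_ext ?_⟩
  refine Eq.trans ?_ (m.projCocycle_f_gen p g).symm
  rw [Cochain.ofHom_comp, hg]
  have h : MulOpposite.op (b.idem p) • gen b p = gen b p := by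
    refine (map_smul ((HomologicalComplex.singleObjXSelf (ComplexShape.up ℤ) 0
      (b.projMod p)).inv).hom (MulOpposite.op (b.idem p)) (b.projGen p)).symm.trans ?_
    exact congrArg _ (Subtype.ext (b.idem_mul_idem p))
  exact (congrArg (φ.f 0).hom h).symm.trans (map_smul (φ.f 0).hom _ _)

/-- The comparison of a projective module with the complex of cochains to the complex at a
vertex. -/
def comparison (p : V) : b.projComplex p ⟶ homObj m.ringHom (K p) :=
  m.projCocycle p (biproduct.π K p)

lemma comparison_homMap (p : V) {Z : CochainComplex (RightMod A) ℤ} (f : K p ⟶ Z) :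
    m.comparison p ≫ homMap m.ringHom f = m.projCocycle p (biproduct.π K p ≫ f) := by
  refine projComplex_hom_ext ?_
  refine Eq.trans ?_ (m.projCocycle_f_gen p _).symm
  refine (congrArg (fun γ : Cochain (⨁ K) (K p) 0 => γ.comp (Cochain.ofHom f) (add_zero 0))
    (m.projCocycle_f_gen p (biproduct.π K p))).trans ?_
  rw [← Cochain.ofHom_comp, Category.assoc]

lemma comparison_homMap_ι (p : V) {Z : CochainComplex (RightMod A) ℤ} (g : ⨁ K ⟶ Z) :
    m.comparison p ≫ homMap m.ringHom (biproduct.ι K p ≫ g) = m.projCocycle p g := by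
  refine (m.comparison_homMap p _).trans (projComplex_hom_ext ?_)
  refine (m.projCocycle_f_gen p _).trans (Eq.trans ?_ (m.projCocycle_f_gen p _).symm)
  rw [← Category.assoc, toEnd_idem_π, ← Category.assoc, ← m.toEnd_idem]

lemma exists_δ_of_quotient_projCocycle_eq_zero (p : V) {Z : CochainComplex (RightMod A) ℤ}
    (g : ⨁ K ⟶ Z)
    (h : (HomotopyCategory.quotient _ (ComplexShape.up ℤ)).map (m.projCocycle p g) = 0) :
    ∃ η : Cochain (⨁ K) Z (-1), Cochain.ofHom (m.toEnd (b.idem p) ≫ g) = δ (-1) 0 η := by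
  rw [HomotopyCategory.quotient_map_eq_zero_iff] at h
  obtain ⟨z, hz⟩ := Cochain.equivHomotopy _ _ h.some
  refine ⟨(z.v 0 (-1) (by omega)).hom (gen b p), ?_⟩
  refine (m.projCocycle_f_gen p g).symm.trans ?_
  have h₁ := Cochain.congr_v hz 0 0 (add_zero 0)
  rw [Cochain.add_v, Cochain.ofHom_zero, Cochain.zero_v, add_zero, Cochain.ofHom_v,
    δ_v (-1) 0 (neg_add_cancel 1) _ 0 0 _ (-1) 1 rfl rfl] at h₁
  have h' : (b.projComplex p).d 0 1 = 0 := HomologicalComplex.single_obj_d _ _ _ _ _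
  rw [h', zero_comp, smul_zero, add_zero] at h₁
  exact congrArg (fun f => (ModuleCat.Hom.hom f) (gen b p)) h₁

/-- A Yoneda argument: `Hom(e_p C, Hom^•(⨁ K, Z))` is the part of `Hom^•(⨁ K, Z)` fixed by `e_p`,
which is `Hom^•(K p, Z)`, homotopies included. No condition on `Z` is needed. -/
lemma comparison_homMap_bijective (p : V) (Z : CochainComplex (RightMod A) ℤ) :
    Function.Bijective (fun f : (HomotopyCategory.quotient _ (ComplexShape.up ℤ)).obj (K p) ⟶
      (HomotopyCategory.quotient _ (ComplexShape.up ℤ)).obj Z =>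
        (HomotopyCategory.quotient _ (ComplexShape.up ℤ)).map (m.comparison p) ≫
          (homHomotopyFunctor m.ringHom).map f) := by
  constructor
  · intro f₁ f₂ hf
    obtain ⟨f, hf'⟩ := (HomotopyCategory.quotient _ _).map_surjective (f₁ - f₂)
    rw [← sub_eq_zero, ← hf', HomotopyCategory.quotient_map_eq_zero_iff]
    have h₀ : (HomotopyCategory.quotient _ (ComplexShape.up ℤ)).map
        (m.projCocycle p (biproduct.π K p ≫ f)) = 0 := by
      rw [← comparison_homMap, Functor.map_comp]
      refine (congrArg (fun g => _ ≫ (homHomotopyFunctor m.ringHom).map g) hf').trans ?_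
      refine (congrArg (_ ≫ ·) (homHomotopyFunctor m.ringHom).map_sub).trans ?_
      exact (Preadditive.comp_sub _ _ _).trans (sub_eq_zero.2 hf)
    obtain ⟨η, hη⟩ := m.exists_δ_of_quotient_projCocycle_eq_zero p _ h₀
    rw [← Category.assoc, toEnd_idem_π] at hη
    refine ⟨(Cochain.equivHomotopy f 0).symm ⟨(Cochain.ofHom (biproduct.ι K p)).comp η
      (zero_add (-1)), ?_⟩⟩
    rw [δ_ofHom_comp, ← hη, ← Cochain.ofHom_comp, biproduct.ι_π_self_assoc, Cochain.ofHom_zero,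
      add_zero]
  · intro φ
    obtain ⟨φ : b.projComplex p ⟶ homObj m.ringHom Z, rfl⟩ :=
      (HomotopyCategory.quotient _ _).map_surjective φ
    obtain ⟨g, rfl⟩ := m.exists_projCocycle p φ
    refine ⟨(HomotopyCategory.quotient _ _).map (biproduct.ι K p ≫ g), ?_⟩
    refine ((HomotopyCategory.quotient _ _).map_comp _ (homMap m.ringHom _)).symm.trans
      (congrArg (HomotopyCategory.quotient _ _).map (m.comparison_homMap_ι p g))

end IncidenceBasis.Representation

end Tilting

/-! ### The comparison map is a quasi-isomorphism -/

section TiltingComparison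

open CochainComplex HomComplex

lemma toHomotopyPerfMap_smul_sub {k : Type u} [Field k] {A : Type u} [Ring A] [Algebra k A]
    {K L : CochainComplex (RightMod A) ℤ} (hK : IsStrictlyPerfect A K) (hL : IsStrictlyPerfect A L)
    (c : k) (φ ψ : K ⟶ L) : toHomotopyPerfMap hK hL (φ - c • ψ) =
      toHomotopyPerfMap hK hL φ - c • toHomotopyPerfMap hK hL ψ := by
  ext
  change (HomotopyCategory.quotient _ _).map (φ - c • ψ) = (HomotopyCategory.quotient _ _).map φ -
    c • (HomotopyCategory.quotient _ _).map ψ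
  rw [Functor.map_sub, Functor.map_smul]

/-- Since `𝟙 = ∑ π_r ≫ ι_r`, primitives on the summands add up to a primitive on the sum. -/
lemma exists_δ_of_biproduct {𝒞 : Type*} [Category* 𝒞] [Preadditive 𝒞] {V : Type} [Fintype V]
    [HasFiniteBiproducts (CochainComplex 𝒞 ℤ)] {K : V → CochainComplex 𝒞 ℤ}
    {Z : CochainComplex 𝒞 ℤ} {l n : ℤ} (γ : Cochain (⨁ K) Z n)
    (h : ∀ r, ∃ η : Cochain (K r) Z l,
      (Cochain.ofHom (biproduct.ι K r)).comp γ (zero_add n) = δ l n η) :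
    ∃ η : Cochain (⨁ K) Z l, γ = δ l n η := by
  classical
  choose η hη using h
  refine ⟨∑ r, (Cochain.ofHom (biproduct.π K r)).comp (η r) (zero_add l), ?_⟩
  let Φ : (⨁ K ⟶ ⨁ K) →+ Cochain (⨁ K) Z n :=
    AddMonoidHom.mk' (fun f => (Cochain.ofHom f).comp γ (zero_add n)) fun f g => by
      rw [Cochain.ofHom_add, Cochain.add_comp]
  have h₁ : Φ (𝟙 _) = γ := Cochain.id_comp γ
  refine (h₁.symm.trans (congrArg Φ biproduct.total.symm)).trans ((map_sum Φ _ _).trans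
    (Eq.trans ?_ (map_sum (δ_hom ℤ (⨁ K) Z l n) _ _).symm))
  refine Finset.sum_congr rfl fun r _ => ?_
  rw [δ_hom_apply, δ_ofHom_comp, ← hη, ← Cochain.comp_assoc_of_first_is_zero_cochain,
    ← Cochain.ofHom_comp]
  rfl

variable {k : Type u} [Field k] {A : Type u} [Ring A] [Algebra k A] {C : Type u} [Ring C]
  [Algebra k C] {V : Type} [Fintype V] {R : V → V → Prop} {b : IncidenceBasis k C R}
  {K : V → CochainComplex (RightMod A) ℤ} (m : b.Representation K)
  (hK : ∀ v, IsStrictlyPerfect A (K v)) (hX : IsThin k R fun v => (hK v).toHomotopyPerf)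
  (hm : ∀ {p q} (h : R p q), toHomotopyPerfMap (hK p) (hK q) (m.map h) ≠ 0)

namespace IncidenceBasis.Representation

lemma comparison_f_smul_gen (p : V) (x : C) :
    (((m.comparison p).f 0).hom (MulOpposite.op x • gen b p) : Cochain (⨁ K) (K p) 0) =
      Cochain.ofHom (m.toEnd x ≫ biproduct.π K p) := by
  refine (map_smul ((m.comparison p).f 0).hom (MulOpposite.op x) (gen b p)).trans ?_
  refine (congrArg (fun γ : Cochain (⨁ K) (K p) 0 => (Cochain.ofHom (m.toEnd x)).comp γ
    (zero_add 0)) (m.projCocycle_f_gen p _)).trans ?_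
  rw [← Cochain.ofHom_comp, toEnd_idem_π]

lemma exists_eq_smul_gen (p : V) (s : (b.projComplex p).X 0) :
    ∃ x : C, b.idem p * x = x ∧ s = MulOpposite.op x • gen b p := by
  let e := HomologicalComplex.singleObjXSelf (ComplexShape.up ℤ) 0 (b.projMod p)
  let y : b.projSubmodule p := e.hom.hom s
  refine ⟨y.1, b.idem_mul_of_mem y.2, ?_⟩
  refine Eq.trans ?_ (map_smul e.inv.hom (MulOpposite.op y.1) (b.projGen p))
  refine Eq.trans ?_ (congrArg e.inv.hom (b.smul_projGen y).symm)
  exact congrArg (fun f => (ModuleCat.Hom.hom f) s) e.hom_inv_id.symm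

include hX hm in
lemma exists_toEnd_of_hom (p : V) (g : ⨁ K ⟶ K p) : ∃ (x : C) (η : Cochain (⨁ K) (K p) (-1)),
    Cochain.ofHom g = Cochain.ofHom (m.toEnd x ≫ biproduct.π K p) + δ (-1) 0 η := by
  classical
  choose c hc using fun r (h : R r p) => hX.exists_smul (hm h)
    (toHomotopyPerfMap (hK r) (hK p) (biproduct.ι K r ≫ g))
  -- Only the entries ending at `p` matter after projecting to `K p`, so the others are set to zero.
  obtain ⟨x, hx⟩ := b.exists_coord_eq fun r q h => if hq : q = p then c r (hq ▸ h) else 0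
  obtain ⟨η, hη⟩ := exists_δ_of_biproduct (l := -1)
    (Cochain.ofHom (g - m.toEnd x ≫ biproduct.π K p)) fun r => by
      rw [← Cochain.ofHom_comp, ← toHomotopyPerfMap_eq_zero_iff (hK r) (hK p)]
      by_cases h : R r p
      · rw [Preadditive.comp_sub, m.ι_toEnd_π x h, hx, dif_pos rfl, toHomotopyPerfMap_smul_sub,
          ← hc r h, sub_self]
      · exact hX.hom_eq_zero h _
  refine ⟨x, η, ?_⟩
  rw [← hη, ← Cochain.ofHom_add, add_sub_cancel]

-- An `x` in `e_p C` acts through the summand `K p`. If its projection to `K p` is null-homotopic,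
-- so is every matrix entry, a coordinate of `x` times a morphism that is nonzero up to homotopy;
-- hence all coordinates vanish.
include hm in
lemma eq_zero_of_toEnd_π (p : V) (x : C) (hx : b.idem p * x = x) (η : Cochain (⨁ K) (K p) (-1))
    (h : Cochain.ofHom (m.toEnd x ≫ biproduct.π K p) = δ (-1) 0 η) : x = 0 := by
  refine b.ext_coord fun r q hr => ?_
  have h₁ : biproduct.ι K r ≫ m.toEnd x ≫ biproduct.π K q =
      biproduct.ι K r ≫ (m.toEnd x ≫ biproduct.π K p) ≫ biproduct.ι K p ≫ biproduct.π K q := by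
    have h₂ : m.toEnd x = m.toEnd x ≫ biproduct.π K p ≫ biproduct.ι K p := by
      rw [← m.toEnd_idem]
      exact (congrArg m.toEnd hx).symm.trans (map_mul m.toEnd _ _)
    refine (congrArg (fun f : ⨁ K ⟶ ⨁ K => biproduct.ι K r ≫ f ≫ biproduct.π K q) h₂).trans ?_
    simp only [Category.assoc]
  rw [m.ι_toEnd_π x hr] at h₁
  have h₃ : toHomotopyPerfMap (hK r) (hK q) (0 - b.coord x r q hr • m.map hr) = 0 := by
    rw [toHomotopyPerfMap_eq_zero_iff]
    refine ⟨-((Cochain.ofHom (biproduct.ι K r)).comp (η.comp (Cochain.ofHom (biproduct.ι K p ≫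
      biproduct.π K q)) (add_zero (-1))) (zero_add (-1))), ?_⟩
    rw [h₁, δ_neg, δ_ofHom_comp, δ_comp_ofHom, ← h, zero_sub, Cochain.ofHom_neg]
    simp only [Cochain.ofHom_comp, Cochain.comp_assoc_of_first_is_zero_cochain]
  have h₄ : toHomotopyPerfMap (hK r) (hK q) 0 = 0 :=
    (toHomotopyPerfMap_eq_zero_iff _ _ _).2 ⟨0, by rw [δ_zero, Cochain.ofHom_zero]⟩
  rw [toHomotopyPerfMap_smul_sub, h₄, zero_sub, neg_eq_zero, smul_eq_zero_iff_left (hm hr)] at h₃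
  rw [h₃]
  exact (DFunLike.congr_fun (map_zero b.basis.repr) _).symm

-- By thinness `Hom^•(⨁ K, K p)` has cohomology only in degree zero. There a basis is given by the
-- structure morphisms into `K p`, and these correspond to the basis of `e_p C`.
include hX hm in
lemma isIso_comparison (p : V) : IsIso (DerivedCategory.Qh.map
    ((HomotopyCategory.quotient _ (ComplexShape.up ℤ)).map (m.comparison p))) := by
  refine isIso_Qh_of_d_eq_zero _ (fun i j => HomologicalComplex.single_obj_d _ _ _ _ _) ?_ ?_
  · intro l n n' hl hn (γ : Cochain (⨁ K) (K p) n) (hγ : δ n n' γ = 0)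
    by_cases h0 : n = 0
    · subst h0
      obtain rfl : l = -1 := by omega
      obtain rfl : n' = 1 := by omega
      obtain ⟨x, η, h⟩ := m.exists_toEnd_of_hom hK hX hm p (Cocycle.homOf (Cocycle.mk γ 1 rfl hγ))
      rw [Cocycle.cochain_ofHom_homOf_eq_coe] at h
      refine ⟨MulOpposite.op x • gen b p, η, ?_⟩
      refine Eq.trans h ?_
      exact congrArg (· + δ (-1) 0 η) (m.comparison_f_smul_gen p x).symm
    · obtain ⟨η, hη⟩ := exists_δ_of_biproduct γ fun r =>
        exists_δ_eq_of_hom_shift_eq_zero (hK r) (hK p) n l hl (fun f => hX.ext_eq_zero h0 f) _ (by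
          rw [hn, δ_ofHom_comp, hγ, Cochain.comp_zero])
      refine ⟨0, η, hη.trans ?_⟩
      exact (zero_add _).symm.trans (congrArg (· + _) (map_zero ((m.comparison p).f n).hom).symm)
  · intro n n' hn s (η : Cochain (⨁ K) (K p) n) hs
    by_cases h0 : n' = 0
    · subst h0
      obtain rfl : n = -1 := by omega
      obtain ⟨x, hx, rfl⟩ := exists_eq_smul_gen p s
      obtain rfl := m.eq_zero_of_toEnd_π hK hm p x hx η ((m.comparison_f_smul_gen p x).symm.trans hs)
      rw [MulOpposite.op_zero, zero_smul]
    · have : Subsingleton ((b.projComplex p).X n') := ModuleCat.subsingleton_of_isZero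
        (HomologicalComplex.isZero_single_obj_X (ComplexShape.up ℤ) 0 (b.projMod p) n' h0)
      exact Subsingleton.elim _ _

end IncidenceBasis.Representation

end TiltingComparison

/-! ### Fully faithful triangulated functors -/

section FullyFaithful

variable {T : Type*} [Category* T] [Preadditive T] [HasZeroObject T] [HasShift T ℤ]
  [∀ n : ℤ, (shiftFunctor T n).Additive] [Pretriangulated T]
  {D : Type*} [Category* D] [Preadditive D] [HasZeroObject D] [HasShift D ℤ]
  [∀ n : ℤ, (shiftFunctor D n).Additive] [Pretriangulated D]
  (F : T ⥤ D) [F.CommShift ℤ]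

/-- The objects from which a functor is fully faithful. -/
def homBijective : ObjectProperty T := fun U => ∀ Z, Function.Bijective (F.map : (U ⟶ Z) → _)

variable {F}

lemma map_shift_eq {X Z : T} (f : X ⟶ Z) (n : ℤ) : F.map (f⟦n⟧') =
    (F.commShiftIso n).hom.app X ≫ (F.map f)⟦n⟧' ≫ (F.commShiftIso n).inv.app Z := by
  have h := F.commShiftIso_hom_naturality f n
  rw [← Category.assoc, ← h, Category.assoc, Iso.hom_inv_id_app]
  exact (Category.comp_id _).symm

lemma map_bijective_of_shift {X Z : T} (n : ℤ)
    (h : Function.Bijective (F.map : (X⟦n⟧ ⟶ Z⟦n⟧) → _)) :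
    Function.Bijective (F.map : (X ⟶ Z) → _) := by
  constructor
  · intro f g hfg
    refine (shiftFunctor T n).map_injective (h.1 ?_)
    rw [map_shift_eq, map_shift_eq, hfg]
  · intro g
    obtain ⟨f', hf'⟩ := h.2 ((F.commShiftIso n).hom.app X ≫ g⟦n⟧' ≫ (F.commShiftIso n).inv.app Z)
    obtain ⟨f, rfl⟩ := (shiftFunctor T n).map_surjective f'
    rw [map_shift_eq, cancel_epi, cancel_mono] at hf'
    exact ⟨f, (shiftFunctor D n).map_injective hf'⟩

instance : (homBijective F).IsClosedUnderIsomorphisms where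
  of_iso {X Y} e h Z := by
    constructor
    · intro f g hfg
      rw [← cancel_epi e.hom]
      refine (h Z).1 ?_
      rw [Functor.map_comp, Functor.map_comp, hfg]
    · intro g
      obtain ⟨f, hf⟩ := (h Z).2 (F.map e.hom ≫ g)
      refine ⟨e.inv ≫ f, ?_⟩
      rw [Functor.map_comp, hf, ← Functor.map_comp_assoc, e.inv_hom_id, F.map_id, Category.id_comp]

instance : (homBijective F).IsStableUnderShift ℤ where
  isStableUnderShiftBy n :=
    { le_shift := fun X h _ => map_bijective_of_shift (-n)
        ((homBijective F).prop_of_iso (shiftShiftNeg X n).symm h _) }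

variable [F.IsTriangulated]

instance : (homBijective F).ContainsZero where
  exists_zero := ⟨0, isZero_zero _, fun _ =>
    ⟨fun _ _ _ => (isZero_zero T).eq_of_src _ _, fun _ =>
      ⟨0, (F.map_isZero (isZero_zero T)).eq_of_src _ _⟩⟩⟩

/-- A five-lemma chase in the long exact sequences of Hom into `W`. Bijectivity is required for all
targets, so it is also available for the shifts of the first two objects. -/
lemma homBijective_of_distinguished (t : Triangle T) (ht : t ∈ distTriang T)
    (h₁ : homBijective F t.obj₁) (h₂ : homBijective F t.obj₂) : homBijective F t.obj₃ := fun W => by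
  have h₁' := (homBijective F).le_shift (1 : ℤ) _ h₁ W
  have h₂' := (homBijective F).le_shift (1 : ℤ) _ h₂ W
  have hF := F.map_distinguished t ht
  have hm (h : (F.obj t.obj₁)⟦(1 : ℤ)⟧ ⟶ F.obj W) : ∃ a : t.obj₁⟦(1 : ℤ)⟧ ⟶ W,
      F.map a = (F.commShiftIso (1 : ℤ)).hom.app t.obj₁ ≫ h := h₁'.2 _
  constructor
  · rw [← F.coe_mapAddHom, injective_iff_map_eq_zero]
    intro f (hf : F.map f = 0)
    obtain ⟨f', rfl⟩ := Triangle.yoneda_exact₃ t ht f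
      ((h₂ W).1 (by rw [F.map_comp, hf, comp_zero, F.map_zero]))
    obtain ⟨h', hh'⟩ : ∃ h' : (F.obj t.obj₂)⟦(1 : ℤ)⟧ ⟶ F.obj W,
        (F.commShiftIso (1 : ℤ)).inv.app t.obj₁ ≫ F.map f' =
          (-(F.map t.mor₁)⟦(1 : ℤ)⟧') ≫ h' := by
      have h₀ : (F.map t.mor₃ ≫ (F.commShiftIso (1 : ℤ)).hom.app t.obj₁) ≫
          (F.commShiftIso (1 : ℤ)).inv.app t.obj₁ ≫ F.map f' = 0 := by
        rw [Category.assoc, Iso.hom_inv_id_app_assoc, ← F.map_comp, hf]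
      exact Triangle.yoneda_exact₃ _ (rot_of_distTriang _ hF)
        ((F.commShiftIso (1 : ℤ)).inv.app t.obj₁ ≫ F.map f') h₀
    obtain ⟨f'', hf''⟩ := h₂'.2 ((F.commShiftIso (1 : ℤ)).hom.app t.obj₂ ≫ h')
    have : f' = (-t.mor₁⟦(1 : ℤ)⟧') ≫ f'' := by
      refine h₁'.1 ?_
      rw [F.map_comp, F.map_neg, map_shift_eq, hf'', ← cancel_epi
        ((F.commShiftIso (1 : ℤ)).inv.app t.obj₁), hh']
      simp
    rw [this, Preadditive.neg_comp, Preadditive.comp_neg, comp_distTriang_mor_zero₃₁_assoc _ ht,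
      zero_comp, neg_zero]
  · intro g
    obtain ⟨h, hh⟩ := (h₂ W).2 (F.map t.mor₂ ≫ g)
    obtain ⟨f, rfl⟩ := Triangle.yoneda_exact₂ t ht h ((h₁ W).1 (by
      rw [F.map_comp, hh, ← F.map_comp_assoc, comp_distTriang_mor_zero₁₂ _ ht, F.map_zero, zero_comp,
        F.map_zero]))
    obtain ⟨a, ha⟩ : ∃ a, g - F.map f =
        (F.map t.mor₃ ≫ (F.commShiftIso (1 : ℤ)).hom.app t.obj₁) ≫ a :=
      Triangle.yoneda_exact₃ _ hF (g - F.map f) (by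
        change F.map t.mor₂ ≫ (g - F.map f) = 0
        rw [Preadditive.comp_sub, ← hh, F.map_comp, sub_self])
    obtain ⟨a', ha'⟩ := hm a
    refine ⟨f + t.mor₃ ≫ a', ?_⟩
    rw [F.map_add, F.map_comp, ha', ← Category.assoc, ← ha, add_sub_cancel]

instance : (homBijective F).IsTriangulatedClosed₃ :=
  .mk' fun t ht h₁ h₂ => homBijective_of_distinguished t ht h₁ h₂

instance : (homBijective F).IsTriangulated where
  toIsTriangulatedClosed₂ := .of_isTriangulatedClosed₃

end FullyFaithful

/-! ### Derived Morita equivalences from tilting complexes -/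

section DerivedMorita

open CochainComplex HomComplex

lemma exists_inverse_isTriangulated (k : Type*) [Field k]
    {T : Type*} [Category* T] [Preadditive T] [Linear k T] [HasZeroObject T] [HasShift T ℤ]
    [∀ n : ℤ, (CategoryTheory.shiftFunctor T n).Additive] [Pretriangulated T]
    {D : Type*} [Category* D] [Preadditive D] [Linear k D] [HasZeroObject D] [HasShift D ℤ]
    [∀ n : ℤ, (CategoryTheory.shiftFunctor D n).Additive] [Pretriangulated D]
    (F : T ⥤ D) [hF : F.CommShift ℤ] [hF' : F.IsTriangulated] [hk : F.Linear k]
    [F.IsEquivalence] :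
    ∃ (G : D ⥤ T) (_ : G.CommShift ℤ),
      G.IsTriangulated ∧ G.Additive ∧ G.Linear k ∧ G.IsEquivalence := by
  let E := F.asEquivalence
  let _ : E.functor.CommShift ℤ := hF
  let _ : E.inverse.CommShift ℤ := E.commShiftInverse ℤ
  have : E.CommShift ℤ := E.commShift_of_functor ℤ
  have : E.IsTriangulated := .mk' E hF'
  have : E.functor.Linear k := hk
  exact ⟨E.inverse, inferInstance, inferInstance, inferInstance, inferInstance, inferInstance⟩

variable (k : Type u) [Field k] (A : Type u) [Ring A] [Algebra k A] (C : Type u) [Ring C]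
  [Algebra k C]

/-- The functor from the homotopy category of strictly perfect complexes to perfect complexes. -/
abbrev homotopyPerfToPerf : HomotopyPerf A ⥤ Perf A :=
  (isPerfect A).lift (homotopyPerfToDerived A) isPerfect_homotopyPerfToDerived_obj

instance : (homotopyPerfToPerf A).EssSurj where
  mem_essImage X := by
    obtain ⟨K, hK, ⟨e⟩⟩ := X.property
    exact ⟨hK.toHomotopyPerf, ⟨(isPerfect A).isoMk e.symm⟩⟩

instance : (homotopyPerfToPerf A).IsEquivalence where

variable {A C}

/-- `Perf A` is equivalent to `HomotopyPerf A`, on which Hom complexes can be computed directly; the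
functor is precomposed with a triangulated inverse of this equivalence. -/
lemma derivedMoritaEquivalent_of_functor (F : HomotopyPerf A ⥤ DerivedCategory (RightMod C))
    [F.CommShift ℤ] [F.IsTriangulated] [F.Linear k] [F.Full] [F.Faithful]
    (h₁ : ∀ X, isPerfect C (F.obj X)) (h₂ : isPerfect C ≤ F.essImage) :
    DerivedMoritaEquivalent k A C := by
  let G : HomotopyPerf A ⥤ Perf C := (isPerfect C).lift F h₁
  have : G.EssSurj := ⟨fun X => by
    obtain ⟨Y, ⟨e⟩⟩ := h₂ _ X.property
    exact ⟨Y, ⟨(isPerfect C).isoMk e⟩⟩⟩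
  have : G.IsEquivalence := {}
  have : (homotopyPerfToPerf A).Linear k := ⟨fun f c => by
    ext
    exact (homotopyPerfToDerived A).map_smul c f⟩
  have : G.Linear k := ⟨fun f c => by
    ext
    exact F.map_smul c f⟩
  obtain ⟨H, _, _, _, _, _⟩ := exists_inverse_isTriangulated k (homotopyPerfToPerf A)
  exact ⟨H ⋙ G, inferInstance, inferInstance, inferInstance, inferInstance, inferInstance⟩

variable {k} {V : Type} [Fintype V] {R : V → V → Prop} {b : IncidenceBasis k C R}
  {K : V → CochainComplex (RightMod A) ℤ} (m : b.Representation K)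
  (hK : ∀ v, IsStrictlyPerfect A (K v)) (hX : IsThin k R fun v => (hK v).toHomotopyPerf)
  (hm : ∀ {p q} (h : R p q), toHomotopyPerfMap (hK p) (hK q) (m.map h) ≠ 0)

namespace IncidenceBasis.Representation

/-- The functor of derived homomorphisms from a complex with an action of an algebra. -/
abbrev tiltingFunctor : HomotopyPerf A ⥤ DerivedCategory (RightMod C) :=
  (isHomotopyPerfect A).ι ⋙ homHomotopyFunctor m.ringHom ⋙ DerivedCategory.Qh

-- Precomposing the action of the functor on `Hom(K p, Z)` with the comparison isomorphism gives the
-- Yoneda bijection followed by passage to the derived category, which is bijective as `e_p C` is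
-- K-projective.
include hX hm in
lemma homBijective_tiltingFunctor (p : V) :
    homBijective m.tiltingFunctor (hK p).toHomotopyPerf := by
  rintro ⟨⟨Z⟩, hZ⟩
  have := m.isIso_comparison hK hX hm p
  have := (b.isStrictlyPerfect_projComplex p).isKProjective
  have h₁ := (IsKProjective.Qh_map_bijective (b.projComplex p)
    ((HomotopyCategory.quotient _ _).obj (homObj m.ringHom Z))).comp
      (m.comparison_homMap_bijective p Z)
  have h₂ (f : (hK p).toHomotopyPerf ⟶ (⟨⟨Z⟩, hZ⟩ : HomotopyPerf A)) :
      DerivedCategory.Qh.map ((HomotopyCategory.quotient _ _).map (m.comparison p) ≫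
        (homHomotopyFunctor m.ringHom).map f.hom) = DerivedCategory.Qh.map
          ((HomotopyCategory.quotient _ _).map (m.comparison p)) ≫ m.tiltingFunctor.map f :=
    DerivedCategory.Qh.map_comp _ _
  constructor
  · intro f g hfg
    ext
    exact h₁.1 ((h₂ f).trans ((congrArg (_ ≫ ·) hfg).trans (h₂ g).symm))
  · intro g
    obtain ⟨f, hf⟩ := h₁.2 (DerivedCategory.Qh.map
      ((HomotopyCategory.quotient _ _).map (m.comparison p)) ≫ g)
    refine ⟨ObjectProperty.homMk f, ?_⟩
    exact (cancel_epi (DerivedCategory.Qh.map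
      ((HomotopyCategory.quotient _ _).map (m.comparison p)))).1 ((h₂ _).symm.trans hf)

include hX hm in
lemma nonempty_tiltingFunctor_obj_iso (p : V) :
    Nonempty (m.tiltingFunctor.obj (hK p).toHomotopyPerf ≅
      (DerivedCategory.singleFunctor (RightMod C) 0).obj (b.projMod p)) := by
  have := m.isIso_comparison hK hX hm p
  exact ⟨(asIso (DerivedCategory.Qh.map
    ((HomotopyCategory.quotient _ (ComplexShape.up ℤ)).map (m.comparison p)))).symm⟩

include hX hm in
/-- A thin collection of complexes which generates the homotopy category of strictly perfect
complexes gives a derived Morita equivalence. -/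
lemma derivedMoritaEquivalent (rank : V → ℕ) (hinj : Function.Injective rank)
    (hrank : ∀ p q, R p q → p ≠ q → rank p < rank q)
    (hgen : ∀ (P : ObjectProperty (HomotopyPerf A)) [P.IsTriangulated]
      [P.IsClosedUnderIsomorphisms], (∀ p, P (hK p).toHomotopyPerf) → ∀ X, P X) :
    DerivedMoritaEquivalent k A C := by
  have h := hgen (homBijective m.tiltingFunctor) (m.homBijective_tiltingFunctor hK hX hm)
  have : m.tiltingFunctor.Full := ⟨fun {X Y} => (h X Y).2⟩
  have : m.tiltingFunctor.Faithful := ⟨fun {X Y} _ _ h' => (h X Y).1 h'⟩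
  have e (p : V) := (m.nonempty_tiltingFunctor_obj_iso hK hX hm p).some
  refine derivedMoritaEquivalent_of_functor k m.tiltingFunctor (fun X => ?_) ?_
  · exact hgen ((isPerfect C).inverseImage m.tiltingFunctor) (fun p =>
      (isPerfect C).prop_of_iso (e p).symm ⟨_, b.isStrictlyPerfect_projComplex p, ⟨Iso.refl _⟩⟩) X
  -- The essential image is a triangulated subcategory containing all `e_p C`, hence all of `Perf
  -- C`.
  · exact b.isPerfect_le_of_projMod rank hinj hrank fun p => ⟨_, ⟨e p⟩⟩

end IncidenceBasis.Representation

end DerivedMorita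

/-! ### Lifting representations of trees to complexes -/

section Strictification

variable {k : Type u} [Field k] {A : Type u} [Ring A] [Algebra k A] {C : Type*} [Ring C]
  [Algebra k C] {V : Type} [Fintype V] {S : V → V → Prop} (c : IncidenceBasis k C S)

lemma toHomotopyPerfMap_comp {K L M : CochainComplex (RightMod A) ℤ} (hK : IsStrictlyPerfect A K)
    (hL : IsStrictlyPerfect A L) (hM : IsStrictlyPerfect A M) (φ : K ⟶ L) (ψ : L ⟶ M) :
    toHomotopyPerfMap hK hM (φ ≫ ψ) = toHomotopyPerfMap hK hL φ ≫ toHomotopyPerfMap hL hM ψ := by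
  ext
  exact (HomotopyCategory.quotient _ _).map_comp _ _

lemma toHomotopyPerfMap_id {K : CochainComplex (RightMod A) ℤ} (hK : IsStrictlyPerfect A K) :
    toHomotopyPerfMap hK hK (𝟙 K) = 𝟙 _ := by
  ext
  exact (HomotopyCategory.quotient _ _).map_id _

instance (n : ℤ) : (shiftFunctor (HomotopyPerf A) n).Linear k where
  map_smul f r := by
    apply (isHomotopyPerfect A).ι.map_injective
    rw [map_shift_eq, Functor.map_smul, Functor.map_smul, Linear.smul_comp, Linear.comp_smul,
      Functor.map_smul, map_shift_eq]

/-- A representation by strictly perfect complexes gives one in the homotopy category. -/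
def IncidenceBasis.Representation.toHomotopyPerf {K : V → CochainComplex (RightMod A) ℤ}
    {c : IncidenceBasis k C S} (m : c.Representation K) (hK : ∀ v, IsStrictlyPerfect A (K v)) :
    c.Representation fun v => (hK v).toHomotopyPerf where
  map h := toHomotopyPerfMap (hK _) (hK _) (m.map h)
  map_refl p := by rw [m.map_refl, toHomotopyPerfMap_id]
  map_trans h h' := by rw [m.map_trans h h', toHomotopyPerfMap_comp _ (hK _)]

/-- A thin collection in the homotopy category whose relation is given by the paths in a quiver with
at most one path between two vertices is given by a representation by complexes. -/
lemma IncidenceBasis.exists_representation {Γ : Type*} [Quiver Γ]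
    [∀ a b : Γ, Subsingleton (Quiver.Path a b)] (e : Γ ≃ V)
    (hS : ∀ a b : Γ, Nonempty (Quiver.Path a b) ↔ S (e a) (e b)) {X : V → HomotopyPerf A}
    (hX : IsThin k S X) :
    ∃ (K : V → CochainComplex (RightMod A) ℤ) (hK : ∀ v, IsStrictlyPerfect A (K v))
      (m : c.Representation K), (∀ v, Nonempty ((hK v).toHomotopyPerf ≅ X v)) ∧
        ∀ {p q : V} (h : S p q), toHomotopyPerfMap (hK p) (hK q) (m.map h) ≠ 0 := by
  classical
  choose K hK ε using fun a : Γ => (X (e a)).property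
  let Y (a : Γ) : HomotopyPerf A := (hK a).toHomotopyPerf
  let ε' (a : Γ) : Y a ≅ X (e a) := (isHomotopyPerfect A).isoMk (ε a).some.symm
  have hconj {a b : Γ} {f : Y a ⟶ Y b} (hf : f ≠ 0) : (ε' a).inv ≫ f ≫ (ε' b).hom ≠ 0 := by
    intro h0
    apply hf
    rw [← cancel_mono (ε' b).hom, ← cancel_epi (ε' a).inv, h0, zero_comp, comp_zero]
  have hcomp {a b c : Γ} (hab : S (e a) (e b)) (hbc : S (e b) (e c)) {f : Y a ⟶ Y b}
      {g : Y b ⟶ Y c} (hf : f ≠ 0) (hg : g ≠ 0) : f ≫ g ≠ 0 := by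
    intro h0
    refine hX.comp_ne_zero hab hbc (hconj hf) (hconj hg) ?_
    simp only [Category.assoc, Iso.hom_inv_id_assoc, reassoc_of% h0, zero_comp, comp_zero]
  have hne (a b : Γ) (f : a ⟶ b) :
      ∃ φ : K a ⟶ K b, toHomotopyPerfMap (hK a) (hK b) φ ≠ 0 := by
    obtain ⟨g, hg⟩ := hX.exists_ne_zero ((hS a b).1 ⟨f.toPath⟩)
    obtain ⟨φ, hφ⟩ := (HomotopyCategory.quotient (RightMod A) (ComplexShape.up ℤ)).map_surjective
      ((ε' a).hom ≫ g ≫ (ε' b).inv).hom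
    have hφ' : toHomotopyPerfMap (hK a) (hK b) φ = (ε' a).hom ≫ g ≫ (ε' b).inv := by
      ext
      exact hφ
    refine ⟨φ, fun h0 => hg ?_⟩
    rw [← cancel_mono (ε' b).inv, ← cancel_epi (ε' a).hom, ← hφ', h0, zero_comp, comp_zero]
  choose φ hφ using hne
  -- The path category is free on its arrows, so arbitrary lifts of the arrows to chain maps give a
  -- strict functor. With relations to satisfy, commutativity would hold only up to homotopy.
  let F : Paths Γ ⥤ CochainComplex (RightMod A) ℤ :=
    Paths.lift { obj := K, map := fun {a b} f => φ a b f }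
  -- Thinness propagates nonvanishing from arrows to paths, so that each path spans its line of
  -- morphisms.
  have hF {a b : Γ} (p : Quiver.Path a b) : toHomotopyPerfMap (hK a) (hK b) (F.map p) ≠ 0 := by
    induction p with
    | nil =>
      intro h0
      refine hX.id_ne_zero ((hS a a).1 ⟨.nil⟩) ?_
      have h₁ : 𝟙 (Y a) = 0 := (toHomotopyPerfMap_id (hK a)).symm.trans
        ((congrArg (toHomotopyPerfMap (hK a) (hK a)) (F.map_id a).symm).trans h0)
      rw [← cancel_epi (ε' a).hom, Category.comp_id, comp_zero, ← Category.id_comp (ε' a).hom, h₁,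
        zero_comp]
    | cons p f ih =>
      intro h0
      refine hcomp ((hS _ _).1 ⟨p⟩) ((hS _ _).1 ⟨f.toPath⟩) ih (hφ _ _ f) ?_
      refine (toHomotopyPerfMap_comp _ _ _ _ _).symm.trans (Eq.trans (congrArg _ ?_) h0)
      rfl
  have path {p q : V} (h : S p q) : Quiver.Path (e.symm p) (e.symm q) :=
    ((hS _ _).2 (by simpa using h)).some
  refine ⟨fun v => K (e.symm v), fun v => hK _,
    { map := fun h => F.map (path h)
      map_refl := fun p => ?_
      map_trans := fun h h' => ?_ }, fun v => ⟨ε' (e.symm v) ≪≫ eqToIso (by simp)⟩, fun h => hF _⟩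
  · exact (congrArg F.map (Subsingleton.elim (α := Quiver.Path _ _) _ .nil)).trans (F.map_id _)
  · exact (congrArg F.map (Subsingleton.elim (α := Quiver.Path _ _) _
      ((path h).comp (path h')))).trans (F.map_comp _ _)

end Strictification

/-! ### Endomorphism algebras of collections -/

section EndAlgebra

variable {k : Type u} [Field k] {C : Type*} [Ring C] [Algebra k C] {V W : Type} [Fintype V]
  [Fintype W] {R : V → V → Prop} {b : IncidenceBasis k C R}
  {T : Type w} [Category.{v} T] [Preadditive T] [Linear k T]

/-- Relabelling of a representation. -/
def IncidenceBasis.Representation.reindex {X : V → T} (m : b.Representation X) (f : W ≃ V)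
    {E : W → T} (ε : ∀ i, E i ≅ X (f i)) :
    (b.reindex f (fun i j => R (f i) (f j)) fun _ _ => Iff.rfl).Representation E where
  map {i j} h := (ε i).hom ≫ m.map h ≫ (ε j).inv
  map_refl i := by
    rw [m.map_refl (f i), Category.id_comp, Iso.hom_inv_id]
  map_trans h h' := by
    rw [m.map_trans h h']
    simp

lemma IsThin.nonempty_algEquiv_end [HasZeroObject T] [HasShift T ℤ]
    [∀ n : ℤ, (shiftFunctor T n).Additive] [∀ n : ℤ, (shiftFunctor T n).Linear k]
    [HasFiniteBiproducts T] {X : V → T} (hX : IsThin k R X) (m : b.Representation X)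
    (hm : ∀ {p q} (h : R p q), m.map h ≠ 0) (f : W ≃ V) {E : W → T} (ε : ∀ i, E i ≅ X (f i)) :
    Nonempty (C ≃ₐ[k] End (⨁ E)) := by
  refine ⟨AlgEquiv.ofBijective (m.reindex f ε).toEnd
    ((hX.comp_equiv_of_iso f ε).toEnd_bijective _ fun {i j} h h0 => hm h ?_)⟩
  have h₁ : (ε i).hom ≫ m.map h ≫ (ε j).inv = 0 := h0
  rw [← cancel_mono (ε j).inv, ← cancel_epi (ε i).hom, h₁, zero_comp, comp_zero]

end EndAlgebra

/-! ### Mutation equivalence and derived equivalence -/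

section Equivalence

variable {k : Type u} [Field k] {A : Type u} [Ring A] [Algebra k A] {C : Type u} [Ring C]
  [Algebra k C] {n : ℕ} {R S : Fin n → Fin n → Prop}

lemma rank_lt_of_linear_extension {R : Fin n → Fin n → Prop} (g : Fin n ≃ Fin n)
    (hg : ∀ i j, i < j → ¬ R (g j) (g i)) (p q : Fin n) (h : R p q) (hpq : p ≠ q) :
    (g.symm p : ℕ) < g.symm q := by
  by_contra hlt
  have hne : g.symm q ≠ g.symm p := fun h' => hpq (g.symm.injective h').symm
  have := hg (g.symm q) (g.symm p) (lt_of_le_of_ne (not_lt.1 hlt) hne)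
  rw [Equiv.apply_symm_apply, Equiv.apply_symm_apply] at this
  exact this h

/-- Uniqueness of paths allows the reachable collection to be realised by a strict diagram. That
diagram yields both its endomorphism algebra and the action needed for the tilting functor. -/
theorem mutationEquivalent_and_derivedMoritaEquivalent (b : IncidenceBasis k A R)
    (c : IncidenceBasis k C S) (g f : Fin n ≃ Fin n) (hg : ∀ i j, i < j → ¬ R (g j) (g i))
    (hf : ∀ i j, i < j → ¬ S (f j) (f i))
    (h : IsReachable k (fun i => b.projObj (g i)) S f)
    {Γ : Type*} [Quiver Γ] [∀ a b : Γ, Subsingleton (Quiver.Path a b)] (e : Γ ≃ Fin n)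
    (hS : ∀ a b : Γ, Nonempty (Quiver.Path a b) ↔ S (e a) (e b)) :
    MutationEquivalent k A C ∧ DerivedMoritaEquivalent k A C := by
  obtain ⟨X, E, hX, hE, ε⟩ := h
  obtain ⟨K, hK, m, ε', hm⟩ := c.exists_representation e hS hX
  have hK' : IsThin k S fun v => (hK v).toHomotopyPerf :=
    hX.comp_equiv_of_iso id fun v => (ε' v).some
  have := b.module_finite
  have hb := b.isThin_projObj
  have ε'' (i : Fin n) : E i ≅ (hK (f i)).toHomotopyPerf := (ε i).some ≪≫ (ε' (f i)).some.symm
  constructor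
  · refine ⟨HomotopyPerf A, inferInstance, inferInstance, inferInstance, inferInstance,
      inferInstance, inferInstance, inferInstance, inferInstance, inferInstance,
      isExtFinite_homotopyPerf, ⟨perfEnhancement k A⟩, n, fun i => b.projObj (g i), E, ?_, ?_, ?_,
      ?_, hE⟩
    · exact (hb.comp_equiv_of_iso g fun _ => Iso.refl _).isStrongExceptional
        (fun _ => b.refl _) hg
    · exact (hX.comp_equiv_of_iso f fun i => (ε i).some).isStrongExceptional
        (fun _ => c.refl _) hf
    · exact hb.nonempty_algEquiv_end b.projObjRepresentation b.projObjRepresentation_map_ne_zero g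
        fun _ => Iso.refl _
    · exact hK'.nonempty_algEquiv_end (m.toHomotopyPerf hK) hm f ε''
  · refine m.derivedMoritaEquivalent hK hK' hm (fun p => f.symm p)
      (Fin.val_injective.comp f.symm.injective) (rank_lt_of_linear_extension f hf) ?_
    -- The `K p` give the mutated collection, undoing the mutations gives the projectives of `A`,
    -- and these generate everything.
    intro P _ _ hP
    refine b.prop_homotopyPerf (fun p => g.symm p) (Fin.val_injective.comp g.symm.injective)
      (rank_lt_of_linear_extension g hg) P fun p => ?_
    rw [← g.apply_symm_apply p]
    exact prop_of_prop_of_mutations hE P (fun i => P.prop_of_iso (ε'' i).symm (hP _)) (g.symm p)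

end Equivalence

/-! ### Dynkin quivers -/

section Dynkin

variable {k : Type u} [Field k] {A : Type u} [Ring A] [Algebra k A] {n m : ℕ}

lemma EdgeList.IsTreeLike.mutationEquivalent_and_derivedMoritaEquivalent {t : EdgeList n m}
    (ht : t.IsTreeLike) {M : Matrix (Fin n) (Fin n) ℤ} (hM : t.IsDiagramOf M)
    {R : Fin n → Fin n → Prop} (b : IncidenceBasis k A R) (g : Fin n ≃ Fin n)
    (hg : ∀ i j, i < j → ¬ R (g j) (g i))
    (h : ∀ o < 2 ^ m, ∃ f : Fin n → Fin n, Function.Bijective f ∧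
      (∀ i j, i < j → ¬ t.Rel o (f j) (f i)) ∧
      IsReachable k (fun i => b.projObj (g i)) (t.Rel o) f)
    (Γ : Type u) [Fintype Γ] [Quiver.{u} Γ] (hΓ : IsOfDynkinType M Γ) :
    MutationEquivalent k A (PathAlgebra k Γ) ∧ DerivedMoritaEquivalent k A (PathAlgebra k Γ) := by
  obtain ⟨e, o, ho, _, ha⟩ := hM.exists_orientation hΓ
  have := ht.subsingleton_path ho ha
  have hS (a b : Γ) := ht.nonempty_path_iff ho ha a b
  obtain ⟨f, hf, hf', hr⟩ := h o ho
  exact _root_.mutationEquivalent_and_derivedMoritaEquivalent b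
    ((PathAlgebra.incidenceBasis k Γ).reindex e.symm (t.Rel o) fun x y => by rw [hS]; simp)
    g (Equiv.ofBijective f hf) hg hf' hr e hS

end Dynkin

end

theorem mainTheorem9 (k : Type u) [Field k] :
    (∀ (Γ : Type u) [Fintype Γ] [Quiver.{u} Γ], IsOfDynkinType (CartanMatrix.D 4) Γ →
      MutationEquivalent k (LinearPathAlgebra k 2 ⊗[k] LinearPathAlgebra k 2) (PathAlgebra k Γ) ∧
      DerivedMoritaEquivalent k (LinearPathAlgebra k 2 ⊗[k] LinearPathAlgebra k 2)
        (PathAlgebra k Γ)) ∧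
    (∀ (Γ : Type u) [Fintype Γ] [Quiver.{u} Γ], IsOfDynkinType CartanMatrix.E₆ Γ →
      MutationEquivalent k (LinearPathAlgebra k 3 ⊗[k] LinearPathAlgebra k 2) (PathAlgebra k Γ) ∧
      DerivedMoritaEquivalent k (LinearPathAlgebra k 3 ⊗[k] LinearPathAlgebra k 2)
        (PathAlgebra k Γ)) := by
  refine ⟨fun Γ _ _ hΓ => ?_, fun Γ _ _ hΓ => ?_⟩
  · exact edgeListD4_isTreeLike.mutationEquivalent_and_derivedMoritaEquivalent
      edgeListD4_isDiagramOf (incidenceBasisSquare k)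
      (Equiv.ofBijective ![1, 0, 2, 3] (by decide)) (by
        simp only [Equiv.ofBijective_apply]
        decide)
      (isReachable_edgeListD4 (incidenceBasisSquare k).isThin_projObj) Γ hΓ
  · exact edgeListE6_isTreeLike.mutationEquivalent_and_derivedMoritaEquivalent
      edgeListE6_isDiagramOf (incidenceBasisGrid k)
      (Equiv.ofBijective ![4, 3, 2, 0, 1, 5] (by decide)) (by
        simp only [Equiv.ofBijective_apply]
        decide)
      (isReachable_edgeListE6 (incidenceBasisGrid k).isThin_projObj) Γ hΓ
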